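/- **Setting.** Let $d\ge 1$, $\beta>0$ and $a>b>0$. For $\alpha<0$, $\mu\in\mathbb R$, a centred box $\Lambda\subset\mathbb R^d$ and $m_\Lambda\in\mathbb N$, let the cycle counts $(|\Lambda|\lambda_k)_{k\ge 1}$ be, under the reference law $\mathsf Q_\Lambda$, independent Poisson variables with means $|\Lambda| q_k e^{\beta\alpha k}$, where $q_k=(4\pi\beta)^{-d/2}k^{-1-d/2}$. Put $$H_\Lambda=|\Lambda|\Big(-(\mu-\alpha)\sum_{k}k\lambda_k+\frac a2\Big(\sum_k k\lambda_k\Big)^2-\frac b2\sum_{k\ge m_\Lambda}k^2\lambda_k^2\Big),\qquad \frac{d\mathbb P_\Lambda}{d\mathsf Q_\Lambda}=\frac{e^{-\beta H_\Lambda}}{\mathsf E_{\mathsf Q_\Lambda}[e^{-\beta H_\Lambda}]},\qquad M^{(2)}_\Lambda=\sum_{k\ge m_\Lambda}k\lambda_k .$$ For $\kappa\in[0,\infty]$ let $\varrho^{(\kappa)}(\mu)=\lim \mathbb E_{\mathbb P_\Lambda}[M^{(2)}_\Lambda]$, the limit being along any sequence of centred boxes with $|\Lambda|\to\infty$, $m_\Lambda\to\infty$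 and $m_\Lambda/|\Lambda|\to\kappa$. Let $p_0(\beta,s)=\frac{1}{\beta(4\pi\beta)^{d/2}}\sum_{k\ge1}e^{\beta sk}k^{-1-d/2}$ for $s\le 0$ and $p_0(\beta,s)=+\infty$ for $s>0$; primes denote derivatives in $s$, and $p_0''(\beta,0)\in[0,\infty]$ is the limit of $p_0''(\beta,s)$ as $s\uparrow0$. Let $f_0(\beta,x)=\sup_s\{sx-p_0(\beta,s)\}$; $\varrho_{\rm c}=(4\pi\beta)^{-d/2}\sum_{k\ge 1} k^{-d/2}$ if $d\ge3$, $\varrho_{\rm c}=\infty$ if $d\le2$; $\mu_{\rm c}=a\varrho_{\rm c}$. For $x>0$ let $s_\beta(x)=0$ if $x\ge\varrho_{\rm c}$, and otherwise let $s_\beta(x)$ be the unique $s<0$ with $p_0'(\beta,s)=x$. Put $\mu_{\rm t}=\inf_{s<0}\{ap_0'(\beta,s)-\frac{a-b}{b}s\}$. Let $\tilde x_1(\mu)$ be the unique solution $x>0$ of $s_\beta(x)=\mu-ax$, and, for $\mu\ge\mu_{\rm t}$, let $\tilde x_2(\mu)$ be the minimal solution $x>0$ of $s_\beta(x)=-\frac{b}{a-b}(\mu-ax)$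 and $\tilde y_2(\mu)=\frac{\mu-a\tilde x_2(\mu)}{a-b}$. For $\kappa\in(0,\infty)$ put $\tilde x_3(\mu)=\tilde x_1(\mu-a\kappa)$ and $\mu_{\rm r}=\inf\{s\ge\mu_{\rm t}:\tilde x_2(s)\le\frac1a(s-\kappa(a-b))\}$. Let $K(\kappa)=[0,\infty)\times(\{0\}\cup[\kappa,\infty))$ (for $\kappa=\infty$: $[0,\infty)\times\{0\}$), let $F_\mu(x,y)=f_0(\beta,x)-\mu(x+y)+\frac a2(x+y)^2-\frac b2y^2$, let $I^{(\kappa)}=F_\mu-\inf_{K(\kappa)}F_\mu$ on $K(\kappa)$ and $+\infty$ elsewhere, and let $\mathscr M^{(\kappa)}(\mu)$ be the set of zeroes of $I^{(\kappa)}$. **Statement.** For all $\alpha<0$, $\mu\in\mathbb R$ and every $\Lambda$, $m_\Lambda$, the measure $\mathbb P_\Lambda$ is a well-defined probability measure and $M_\Lambda^{(2)}$ is $\mathbb P_\Lambda$-integrable. There is a transition chemical potential $\mu^*\in\mathbb R$, $\mu_{\rm t}\le\mu^*\le\mu_{\rm c}$, with $\mathscr M^{(0)}(\mu)$ equal to $\{(\tilde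 x_1,0)\}$ for $\mu<\mu^*$, to $\{(\tilde x_1,0),(\tilde x_2,\tilde y_2)\}$ for $\mu=\mu^*$, and to $\{(\tilde x_2,\tilde y_2)\}$ for $\mu>\mu^*$, and for each $\kappa\in(0,\infty)$ there is $\mu^*_\kappa\in\mathbb R$, with $\mu^*_\kappa=\mu^*$ if $\mu_{\rm r}\le\mu^*$ and $\mu^*_\kappa\in(\mu^*,\mu_{\rm r})$ if $\mu_{\rm r}>\mu^*$, such that $\mathscr M^{(\kappa)}(\mu)$ equals $\{(\tilde x_1,0)\}$ for $\mu<\mu^*_\kappa$; $\{(\tilde x_3,\kappa)\}$ for $\mu_\kappa^*<\mu\le\mu_{\rm r}$; $\{(\tilde x_2,\tilde y_2)\}$ for $\mu\ge\mu_{\rm r}$ with $\mu>\mu^*_\kappa$; and, for $\mu=\mu^*_\kappa$, $\{(\tilde x_1,0),(\tilde x_3,\kappa)\}$ if $\mu_{\rm r}>\mu^*$ and $\{(\tilde x_1,0),(\tilde x_2,\tilde y_2)\}$ if $\mu_{\rm r}\le\mu^*$. None of these depends on $\alpha$ or on the sequences. For every $\alpha<0$ the following holds; in particular the limits exist at the stated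 values of $\mu$. 1. $\kappa=0$: $\varrho^{(0)}(\mu)=0$ for $\mu<\mu^*$ and $\varrho^{(0)}(\mu)=\frac{\mu-a\tilde x_2(\mu)}{a-b}$ for $\mu>\mu^*$. If $\mu^*<\mu_{\rm c}$, then $\varrho^{(0)}$ is not continuous at $\mu^*$, whatever value it is given there. If $\mu^*=\mu_{\rm c}$, then $\tilde x_1(\mu^*)=\tilde x_2(\mu^*)$, the limit $\varrho^{(0)}(\mu^*)$ exists and is $0$, and $\varrho^{(0)}$ is continuous at $\mu^*$. Moreover $\mu^*=\mu_{\rm c}$ if and only if $p_0''(\beta,0)\le\frac{a-b}{ab}$. 2. $\kappa\in(0,\infty)$: $\varrho^{(\kappa)}(\mu)=0$ for $\mu<\mu^*_\kappa$; $\varrho^{(\kappa)}(\mu)=\kappa$ for $\mu^*_\kappa<\mu\le\mu_{\rm r}$; $\varrho^{(\kappa)}(\mu)=\frac{\mu-a\tilde x_2(\mu)}{a-b}$ for $\mu\ge\mu_{\rm r}$ with $\mu>\mu^*_\kappa$. It is continuous at $\mu_{\rm r}$ if $\mu_{\rm r}\ne\mu^*_\kappa$, and it is discontinuous at $\mu^*_\kappa$,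 whatever value it is given there. 3. $\kappa=\infty$: $\varrho^{(\infty)}(\mu)=0$ for all $\mu\in\mathbb R$. -/

import Mathlib

open MeasureTheory Filter Topology
open scoped ENNReal

noncomputable section

namespace CycleHYL

/-! ### The spatial cycle HYL model in a finite volume -/

/-- A configuration of cycle counts: `n k` is the number `|Λ| λ_k` of cycles of length `k`. -/
abbrev CycleCounts : Type := ℕ+ →₀ ℕ

/-- The configuration space is countable and carries the discrete σ-algebra. -/
instance : MeasurableSpace CycleCounts := ⊤

/-- `q_k = 1 / ((4πβ)^{d/2} k^{1+d/2})`. -/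
def cycleWeight (d : ℕ) (β : ℝ) (k : ℕ+) : ℝ :=
  1 / ((4 * Real.pi * β) ^ ((d : ℝ) / 2) * (k : ℝ) ^ (1 + (d : ℝ) / 2))

/-- `q̄^{(α)} = ∑_k q_k e^{βαk}`. -/
def totalCycleWeight (d : ℕ) (β α : ℝ) : ℝ :=
  ∑' k : ℕ+, cycleWeight d β k * Real.exp (β * α * k)

/-- The probability, under the reference process in a box of volume `V`, of the cycle counts `n`:
`e^{-V q̄} ∏_k (V q_k e^{βαk})^{n_k} / n_k!`
(independent Poisson variables with means `V q_k e^{βαk}`). -/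
def referenceMass (d : ℕ) (β α V : ℝ) (n : CycleCounts) : ℝ :=
  Real.exp (-(V * totalCycleWeight d β α)) *
    n.prod fun k j => (V * cycleWeight d β k * Real.exp (β * α * k)) ^ j / (j.factorial : ℝ)

/-- The law `Q_Λ` of the cycle counts under the reference process, `|Λ| = V`. -/
def referenceMeasure (d : ℕ) (β α V : ℝ) : Measure CycleCounts :=
  Measure.sum fun n => ENNReal.ofReal (referenceMass d β α V n) • Measure.dirac n

/-- The particle density `∑_k k λ_k`, where `λ_k = n_k / V`. -/
def particleDensity (V : ℝ) (n : CycleCounts) : ℝ :=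
  n.sum fun k j => (k : ℝ) * ((j : ℝ) / V)

/-- `M_Λ^{(2)} = ∑_{k ≥ m} k λ_k`, the density of particles in cycles of length at least `m`. -/
def longCycleDensity (V : ℝ) (m : ℕ) (n : CycleCounts) : ℝ :=
  n.sum fun k j => if m ≤ (k : ℕ) then (k : ℝ) * ((j : ℝ) / V) else 0

/-- The Hamiltonian
`|Λ| (-(μ - α) ∑_k k λ_k + (a/2) (∑_k k λ_k)² - (b/2) ∑_{k ≥ m} k² λ_k²)`, `|Λ| = V`. -/
def hamiltonian (α μ a b V : ℝ) (m : ℕ) (n : CycleCounts) : ℝ :=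
  V * (-(μ - α) * particleDensity V n + a / 2 * particleDensity V n ^ 2
    - b / 2 * n.sum fun k j => if m ≤ (k : ℕ) then (k : ℝ) ^ 2 * ((j : ℝ) / V) ^ 2 else 0)

/-- The Gibbs measure `P_Λ`, with `dP_Λ/dQ_Λ = e^{-βH_Λ} / E_{Q_Λ}[e^{-βH_Λ}]`. -/
def gibbsMeasure (d : ℕ) (β α μ a b V : ℝ) (m : ℕ) : Measure CycleCounts :=
  (referenceMeasure d β α V).tilted fun n => -(β * hamiltonian α μ a b V m n)

/-! ### The thermodynamic limit -/

/-- `Λ` is a sequence of centred boxes in `ℝ^d` with `|Λ| → ∞`, and `m` is a sequence of cut-offs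
with `m → ∞` and `m / |Λ| → κ ∈ [0, ∞]`. -/
def IsThermodynamicSequence (d : ℕ) (κ : ℝ≥0∞) (Λ : ℕ → Set (Fin d → ℝ)) (m : ℕ → ℕ) : Prop :=
  (∀ i, ∃ l : Fin d → ℝ, (∀ j, 0 < l j) ∧ Λ i = Set.Icc (-l) l) ∧
  Tendsto (fun i => volume.real (Λ i)) atTop atTop ∧
  Tendsto m atTop atTop ∧
  Tendsto (fun i => (m i : ℝ≥0∞) / volume (Λ i)) atTop (𝓝 κ)

/-- `ϱ^{(κ)}(μ) = lim E_{P_Λ}[M_Λ^{(2)}]` exists, along every sequence of boxes and cut-offs with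
parameter `κ`, and equals `r`. -/
def IsLongCycleLimit (d : ℕ) (β α a b : ℝ) (κ : ℝ≥0∞) (μ r : ℝ) : Prop :=
  ∀ (Λ : ℕ → Set (Fin d → ℝ)) (m : ℕ → ℕ), IsThermodynamicSequence d κ Λ m →
    Tendsto
      (fun i => ∫ n, longCycleDensity (volume.real (Λ i)) (m i) n
        ∂(gibbsMeasure d β α μ a b (volume.real (Λ i)) (m i)))
      atTop (𝓝 r)

/-! ### The ideal Bose gas -/

/-- The pressure `p_0(β, s)` of the ideal Bose gas, for `s ≤ 0` (it is `+∞` for `s > 0`). -/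
def idealPressure (d : ℕ) (β s : ℝ) : ℝ :=
  1 / (β * (4 * Real.pi * β) ^ ((d : ℝ) / 2)) *
    ∑' k : ℕ+, Real.exp (β * s * k) / (k : ℝ) ^ (1 + (d : ℝ) / 2)

/-- `p_0''(β, 0) ∈ [0, ∞]`: the left limit at `0` of the second derivative of `p_0(β, ·)`, which
is increasing on `(-∞, 0)`. It is `+∞` exactly for `d ≤ 4`. -/
def idealPressureSecondAtZero (d : ℕ) (β : ℝ) : EReal :=
  limsup (fun s : ℝ => ((iteratedDeriv 2 (idealPressure d β) s : ℝ) : EReal)) (𝓝[<] (0 : ℝ))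

/-- The free energy `f_0(β, x) = sup_s {s x - p_0(β, s)}`; the values `s > 0`, for which
`p_0(β, s) = +∞`, do not contribute to the supremum. -/
def idealFreeEnergy (d : ℕ) (β x : ℝ) : ℝ :=
  sSup ((fun s : ℝ => s * x - idealPressure d β s) '' Set.Iic 0)

/-- The critical density `ϱ_c(d)`, infinite for `d ≤ 2`. -/
def criticalDensity (d : ℕ) (β : ℝ) : EReal :=
  if 3 ≤ d then
    ((1 / (4 * Real.pi * β) ^ ((d : ℝ) / 2) * ∑' k : ℕ+, 1 / (k : ℝ) ^ ((d : ℝ) / 2) : ℝ) : EReal)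
  else ⊤

/-- `μ_c = a ϱ_c(d)`. -/
def muC (d : ℕ) (β a : ℝ) : EReal := (a : EReal) * criticalDensity d β

open Classical in
/-- `s_β(x)`, for `x > 0`: it is `0` for `x ≥ ϱ_c`, and the unique `s < 0` with
`p_0'(β, s) = x` for `x < ϱ_c`. -/
def sBeta (d : ℕ) (β x : ℝ) : ℝ :=
  if criticalDensity d β ≤ (x : EReal) then 0
  else Classical.epsilon fun s : ℝ => s < 0 ∧ deriv (idealPressure d β) s = x

/-! ### The stationary points and the special values of the chemical potential -/

/-- `μ_t = inf_{s < 0} {a p_0'(β, s) - ((a - b)/b) s}`. -/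
def muT (d : ℕ) (β a b : ℝ) : ℝ :=
  sInf ((fun s : ℝ => a * deriv (idealPressure d β) s - (a - b) / b * s) '' Set.Iio 0)

/-- `x̃₁(μ)`: the unique solution `x > 0` of `s_β(x) = μ - a x`. -/
def xOne (d : ℕ) (β a μ : ℝ) : ℝ :=
  Classical.epsilon fun x : ℝ => 0 < x ∧ sBeta d β x = μ - a * x

/-- `x̃₂(μ)`, for `μ ≥ μ_t`: the minimal solution `x > 0` of
`s_β(x) = -(b/(a - b)) (μ - a x)`. -/
def xTwo (d : ℕ) (β a b μ : ℝ) : ℝ :=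
  sInf {x : ℝ | 0 < x ∧ sBeta d β x = -(b / (a - b)) * (μ - a * x)}

/-- `x̃₃(μ) = x̃₁(μ - a κ)`. -/
def xThree (d : ℕ) (β a κ μ : ℝ) : ℝ := xOne d β a (μ - a * κ)

/-- `μ_r = inf {s ≥ μ_t : x̃₂(s) ≤ (s - κ (a - b)) / a}`. -/
def muR (d : ℕ) (β a b κ : ℝ) : ℝ :=
  sInf {s : ℝ | muT d β a b ≤ s ∧ xTwo d β a b s ≤ 1 / a * (s - κ * (a - b))}

/-- The density `(μ - a x̃₂(μ)) / (a - b)`. -/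
def yTwo (d : ℕ) (β a b μ : ℝ) : ℝ := (μ - a * xTwo d β a b μ) / (a - b)

/-! ### The rate function and its zeroes -/

/-- `K(κ) = ℝ_+ × ({0} ∪ [κ, ∞))`; for `κ = ∞` this is `ℝ_+ × {0}`. -/
def rateDomain (κ : ℝ≥0∞) : Set (ℝ × ℝ) :=
  {z | 0 ≤ z.1 ∧ 0 ≤ z.2 ∧ (z.2 = 0 ∨ κ ≤ ENNReal.ofReal z.2)}

/-- `f_0(β, x) - μ (x + y) + (a/2) (x + y)² - (b/2) y²`. -/
def freeEnergyFunctional (d : ℕ) (β a b μ : ℝ) (z : ℝ × ℝ) : ℝ :=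
  idealFreeEnergy d β z.1 - μ * (z.1 + z.2) + a / 2 * (z.1 + z.2) ^ 2 - b / 2 * z.2 ^ 2

/-- The pressure `p^{(κ)}`, given by its variational formula. -/
def pressure (d : ℕ) (β a b : ℝ) (κ : ℝ≥0∞) (μ : ℝ) : ℝ :=
  sSup ((fun z => -freeEnergyFunctional d β a b μ z) '' rateDomain κ)

open Classical in
/-- The rate function `I^{(κ)}` of the pair particle density. -/
def rateFunction (d : ℕ) (β a b : ℝ) (κ : ℝ≥0∞) (μ : ℝ) (z : ℝ × ℝ) : EReal :=
  if z ∈ rateDomain κ then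
    ((freeEnergyFunctional d β a b μ z + pressure d β a b κ μ : ℝ) : EReal)
  else ⊤

/-- The set of zeroes of `I^{(κ)}`. -/
def rateZeroes (d : ℕ) (β a b : ℝ) (κ : ℝ≥0∞) (μ : ℝ) : Set (ℝ × ℝ) :=
  {z | rateFunction d β a b κ μ z = 0}

/-- `μs` is the transition chemical potential `μ^*` for `κ = 0`. -/
def IsTransitionZero (d : ℕ) (β a b μs : ℝ) : Prop :=
  muT d β a b ≤ μs ∧ (μs : EReal) ≤ muC d β a ∧
  ∀ μ : ℝ,
    (μ < μs → rateZeroes d β a b 0 μ = {(xOne d β a μ, 0)}) ∧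
    (μ = μs → rateZeroes d β a b 0 μ =
      {(xOne d β a μ, 0), (xTwo d β a b μ, yTwo d β a b μ)}) ∧
    (μs < μ → rateZeroes d β a b 0 μ = {(xTwo d β a b μ, yTwo d β a b μ)})

/-- `μκ` is the transition chemical potential `μ^*_κ` for `κ ∈ (0, ∞)`, where `μs` is the one for
`κ = 0`. If `μ_r ≤ μs` then `μκ = μs`, and there is no interval on which the second component of
the zero equals `κ`. -/
def IsTransitionPos (d : ℕ) (β a b κ μs μκ : ℝ) : Prop :=
  (muR d β a b κ ≤ μs → μκ = μs) ∧
  (μs < muR d β a b κ → μs < μκ ∧ μκ < muR d β a b κ) ∧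
  ∀ μ : ℝ,
    (μ < μκ → rateZeroes d β a b (ENNReal.ofReal κ) μ = {(xOne d β a μ, 0)}) ∧
    (μ = μκ → μs < muR d β a b κ → rateZeroes d β a b (ENNReal.ofReal κ) μ =
      {(xOne d β a μ, 0), (xThree d β a κ μ, κ)}) ∧
    (μ = μκ → muR d β a b κ ≤ μs → rateZeroes d β a b (ENNReal.ofReal κ) μ =
      {(xOne d β a μ, 0), (xTwo d β a b μ, yTwo d β a b μ)}) ∧
    (μκ < μ → μ ≤ muR d β a b κ →
      rateZeroes d β a b (ENNReal.ofReal κ) μ = {(xThree d β a κ μ, κ)}) ∧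
    (μκ < μ → muR d β a b κ ≤ μ →
      rateZeroes d β a b (ENNReal.ofReal κ) μ = {(xTwo d β a b μ, yTwo d β a b μ)})

end CycleHYL

end

open CycleHYL

/-!
For fixed `y` the infimum of `F_μ(x, y)` over `x` is explicit: it is governed by the mean-field
pressure of the ideal gas at the effective potential `u = μ - a y`. So the zeroes of the rate
function are read off from a one-variable energy gap in `y`. Its critical points solve an equation
`level(u) = μ` in which the level is a convex function of the slope `s_β`; hence the gap increases,
decreases down to `ỹ₂`, and increases again, and on `{0} ∪ [κ, ∞)` its minimiser is `0`, `κ` or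
`ỹ₂`. The gap at the best long density decreases in `μ`, which produces one transition.

For the Gibbs measure, the factor `e^{βαk}` of the Poisson means cancels against `α` in the
Hamiltonian. Bounding the Gibbs weight on `{V M⁽²⁾ = j}` by the exponential of minus the energy gap
at `j / V`, and the partition function from below by putting the optimal long density into a
single cycle, shows that `M⁽²⁾` concentrates at the minimiser of the gap whenever it is unique.
-/

namespace CycleHYL

/-! ### The ideal Bose gas -/

section IdealGas

variable {d : ℕ} {β : ℝ}

/-- The moments `∑_k k^j q_k e^{βsk}` of the cycle weights. Up to powers of `β` they are the
derivatives of the ideal pressure: `β p_0`, `p_0'` and `p_0'' / β` for `j = 0, 1, 2`. -/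
noncomputable def cycleMoment (d : ℕ) (β : ℝ) (j : ℕ) (s : ℝ) : ℝ :=
  ∑' k : ℕ+, (k : ℝ) ^ j * cycleWeight d β k * Real.exp (β * s * k)

lemma thermalConst_pos (hβ : 0 < β) : 0 < (4 * Real.pi * β) ^ ((d : ℝ) / 2) :=
  Real.rpow_pos_of_pos (by positivity) _

lemma cycleWeight_pos (hβ : 0 < β) (k : ℕ+) : 0 < cycleWeight d β k :=
  one_div_pos.2 (mul_pos (thermalConst_pos hβ) (by positivity))

lemma cycleWeight_eq_mul (k : ℕ+) : cycleWeight d β k =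
    ((4 * Real.pi * β) ^ ((d : ℝ) / 2))⁻¹ * (1 / (k : ℝ) ^ (1 + (d : ℝ) / 2)) := by
  rw [cycleWeight, one_div, mul_inv, one_div]

lemma natCast_mul_cycleWeight (k : ℕ+) : (k : ℝ) * cycleWeight d β k =
    ((4 * Real.pi * β) ^ ((d : ℝ) / 2))⁻¹ * (1 / (k : ℝ) ^ ((d : ℝ) / 2)) := by
  have hk : (0 : ℝ) < k := by positivity
  rw [cycleWeight_eq_mul, Real.rpow_add hk, Real.rpow_one]
  field_simp

lemma cycleWeight_le (hβ : 0 < β) (k : ℕ+) :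
    cycleWeight d β k ≤ ((4 * Real.pi * β) ^ ((d : ℝ) / 2))⁻¹ := by
  rw [cycleWeight_eq_mul]
  refine mul_le_of_le_one_right (inv_pos.2 (thermalConst_pos hβ)).le ?_
  rw [div_le_one (by positivity)]
  exact Real.one_le_rpow (Nat.one_le_cast.2 k.pos) (by positivity)

lemma summable_pnat_one_div_rpow {p : ℝ} : (Summable fun k : ℕ+ => 1 / (k : ℝ) ^ p) ↔ 1 < p :=
  (summable_pnat_iff_summable_nat (f := fun n : ℕ => 1 / (n : ℝ) ^ p)).trans
    Real.summable_one_div_nat_rpow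

lemma summable_cycleWeight_iff (hβ : 0 < β) : Summable (cycleWeight d β) ↔ 1 ≤ d := by
  rw [summable_congr cycleWeight_eq_mul,
    summable_mul_left_iff (inv_pos.2 (thermalConst_pos hβ)).ne', summable_pnat_one_div_rpow,
    lt_add_iff_pos_right, div_pos_iff_of_pos_right two_pos, Nat.cast_pos, Nat.one_le_iff_ne_zero,
    Nat.pos_iff_ne_zero]

lemma summable_natCast_mul_cycleWeight_iff (hβ : 0 < β) :
    (Summable fun k : ℕ+ => (k : ℝ) * cycleWeight d β k) ↔ 3 ≤ d := by
  rw [summable_congr natCast_mul_cycleWeight,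
    summable_mul_left_iff (inv_pos.2 (thermalConst_pos hβ)).ne', summable_pnat_one_div_rpow,
    lt_div_iff₀ two_pos, one_mul, Nat.ofNat_lt_cast, Nat.succ_le_iff]

lemma criticalDensity_of_three_le (hd : 3 ≤ d) : criticalDensity d β =
    ((∑' k : ℕ+, (k : ℝ) * cycleWeight d β k : ℝ) : EReal) := by
  rw [criticalDensity, if_pos hd, one_div, ← tsum_mul_left]
  simp only [natCast_mul_cycleWeight]

lemma criticalDensity_of_lt_three (hd : d < 3) : criticalDensity d β = ⊤ :=
  if_neg hd.not_ge

lemma three_le_of_criticalDensity_le_coe {x : ℝ} (hx : criticalDensity d β ≤ (x : EReal)) :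
    3 ≤ d := by
  by_contra! hd
  rw [criticalDensity_of_lt_three hd, top_le_iff] at hx
  exact EReal.coe_ne_top x hx

lemma cycleMoment_term_pos (hβ : 0 < β) (j : ℕ) (s : ℝ) (k : ℕ+) :
    0 < (k : ℝ) ^ j * cycleWeight d β k * Real.exp (β * s * k) := by
  have := cycleWeight_pos (d := d) hβ k
  positivity

lemma summable_cycleMoment (hβ : 0 < β) (j : ℕ) {s : ℝ} (hs : s < 0) :
    Summable fun k : ℕ+ => (k : ℝ) ^ j * cycleWeight d β k * Real.exp (β * s * k) := by
  have hexp : Summable fun k : ℕ+ => (k : ℝ) ^ j * Real.exp (β * s * k) := by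
    refine (summable_pnat_iff_summable_nat
      (f := fun n : ℕ => (n : ℝ) ^ j * Real.exp (β * s * n))).2 ?_
    simpa only [neg_neg] using
      Real.summable_pow_mul_exp_neg_nat_mul j (neg_pos.2 (mul_neg_of_pos_of_neg hβ hs))
  refine Summable.of_nonneg_of_le (fun k => (cycleMoment_term_pos hβ j s k).le) (fun k => ?_)
    (hexp.mul_left ((4 * Real.pi * β) ^ ((d : ℝ) / 2))⁻¹)
  calc (k : ℝ) ^ j * cycleWeight d β k * Real.exp (β * s * k)
      = cycleWeight d β k * ((k : ℝ) ^ j * Real.exp (β * s * k)) := by ring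
    _ ≤ _ := mul_le_mul_of_nonneg_right (cycleWeight_le hβ k) (by positivity)

lemma exp_mul_natCast_le_one (hβ : 0 ≤ β) {s : ℝ} (hs : s ≤ 0) (n : ℕ) :
    Real.exp (β * s * n) ≤ 1 :=
  Real.exp_le_one_iff.2
    (mul_nonpos_of_nonpos_of_nonneg (mul_nonpos_of_nonneg_of_nonpos hβ hs) n.cast_nonneg)

lemma summable_cycleWeight_mul_exp (hd : 1 ≤ d) (hβ : 0 < β) {s : ℝ} (hs : s ≤ 0) :
    Summable fun k : ℕ+ => cycleWeight d β k * Real.exp (β * s * k) :=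
  Summable.of_nonneg_of_le (fun k => (mul_pos (cycleWeight_pos hβ k) (Real.exp_pos _)).le)
    (fun k => mul_le_of_le_one_right (cycleWeight_pos hβ k).le (exp_mul_natCast_le_one hβ.le hs k))
    ((summable_cycleWeight_iff hβ).2 hd)

lemma hasDerivAt_cycleMoment (hβ : 0 < β) (j : ℕ) {s : ℝ} (hs : s < 0) :
    HasDerivAt (cycleMoment d β j) (β * cycleMoment d β (j + 1) s) s := by
  have hmem : s ∈ Set.Iio (s / 2) := by simp only [Set.mem_Iio]; linarith
  have hmaj := (summable_cycleMoment (d := d) hβ (j + 1) (s := s / 2) (by linarith)).mul_left β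
  have hderiv := hasDerivAt_tsum_of_isPreconnected (𝕜 := ℝ) (t := Set.Iio (s / 2))
    (g := fun (k : ℕ+) (x : ℝ) => (k : ℝ) ^ j * cycleWeight d β k * Real.exp (β * x * k))
    (g' := fun k x => β * ((k : ℝ) ^ (j + 1) * cycleWeight d β k * Real.exp (β * x * k)))
    hmaj isOpen_Iio isPreconnected_Iio ?term ?bound hmem (summable_cycleMoment hβ j hs) hmem
  · rwa [tsum_mul_left] at hderiv
  case term =>
    intro k y _
    have hlin : HasDerivAt (fun x : ℝ => β * x * k) (β * k) y := by
      simpa using ((hasDerivAt_id y).const_mul β).mul_const (k : ℝ)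
    convert! hlin.exp.const_mul ((k : ℝ) ^ j * cycleWeight d β k) using 1
    ring
  case bound =>
    intro k y hy
    have hw := cycleWeight_pos (d := d) hβ k
    have hys : y ≤ s / 2 := le_of_lt hy
    rw [Real.norm_of_nonneg (by positivity)]
    gcongr

lemma continuousOn_cycleMoment (hβ : 0 < β) (j : ℕ) :
    ContinuousOn (cycleMoment d β j) (Set.Iio 0) := fun _ hs =>
  (hasDerivAt_cycleMoment hβ j hs).continuousAt.continuousWithinAt

lemma cycleMoment_pos (hβ : 0 < β) (j : ℕ) {s : ℝ} (hs : s < 0) : 0 < cycleMoment d β j s :=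
  (summable_cycleMoment hβ j hs).tsum_pos (fun k => (cycleMoment_term_pos hβ j s k).le) 1
    (cycleMoment_term_pos hβ j s 1)

lemma strictMonoOn_cycleMoment (hβ : 0 < β) (j : ℕ) :
    StrictMonoOn (cycleMoment d β j) (Set.Iio 0) := by
  refine strictMonoOn_of_deriv_pos (convex_Iio 0) (continuousOn_cycleMoment hβ j) fun s hs => ?_
  rw [interior_Iio] at hs
  rw [(hasDerivAt_cycleMoment hβ j hs).deriv]
  exact mul_pos hβ (cycleMoment_pos hβ _ hs)

lemma strictConvexOn_cycleMoment (hβ : 0 < β) (j : ℕ) :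
    StrictConvexOn ℝ (Set.Iio 0) (cycleMoment d β j) := by
  refine StrictMonoOn.strictConvexOn_of_deriv (convex_Iio 0) (continuousOn_cycleMoment hβ j) ?_
  rw [interior_Iio]
  intro s hs t ht hst
  rw [(hasDerivAt_cycleMoment hβ j hs).deriv, (hasDerivAt_cycleMoment hβ j ht).deriv]
  exact mul_lt_mul_of_pos_left (strictMonoOn_cycleMoment hβ _ hs ht hst) hβ

lemma idealPressure_eq_tsum_cycleWeight (s : ℝ) : idealPressure d β s =
    β⁻¹ * ∑' k : ℕ+, cycleWeight d β k * Real.exp (β * s * k) := by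
  rw [idealPressure, one_div, mul_inv, mul_assoc, ← tsum_mul_left]
  refine congrArg (β⁻¹ * ·) (tsum_congr fun k => ?_)
  rw [cycleWeight_eq_mul]
  ring

lemma hasDerivAt_idealPressure (hβ : 0 < β) {s : ℝ} (hs : s < 0) :
    HasDerivAt (idealPressure d β) (cycleMoment d β 1 s) s := by
  have heq : idealPressure d β = fun s => β⁻¹ * cycleMoment d β 0 s := funext fun s => by
    simp only [idealPressure_eq_tsum_cycleWeight, cycleMoment, pow_zero, one_mul]
  rw [heq]
  convert! (hasDerivAt_cycleMoment (d := d) hβ 0 hs).const_mul β⁻¹ using 1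
  rw [inv_mul_cancel_left₀ hβ.ne']

lemma deriv_idealPressure (hβ : 0 < β) {s : ℝ} (hs : s < 0) :
    deriv (idealPressure d β) s = cycleMoment d β 1 s := (hasDerivAt_idealPressure hβ hs).deriv

lemma iteratedDeriv_two_idealPressure (hβ : 0 < β) {s : ℝ} (hs : s < 0) :
    iteratedDeriv 2 (idealPressure d β) s = β * cycleMoment d β 2 s := by
  have hev : deriv (idealPressure d β) =ᶠ[𝓝 s] cycleMoment d β 1 := by
    filter_upwards [Iio_mem_nhds hs] with t ht using deriv_idealPressure hβ ht
  rw [iteratedDeriv_succ, iteratedDeriv_one, hev.deriv_eq, (hasDerivAt_cycleMoment hβ 1 hs).deriv]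

lemma idealPressure_nonneg (hβ : 0 < β) (s : ℝ) : 0 ≤ idealPressure d β s := by
  rw [idealPressure_eq_tsum_cycleWeight]
  exact mul_nonneg (inv_pos.2 hβ).le
    (tsum_nonneg fun k => (mul_pos (cycleWeight_pos hβ k) (Real.exp_pos _)).le)

lemma cycleMoment_one_lt_criticalDensity (hβ : 0 < β) {s : ℝ} (hs : s < 0) :
    (cycleMoment d β 1 s : EReal) < criticalDensity d β := by
  rcases lt_or_ge d 3 with hd | hd
  · rw [criticalDensity_of_lt_three hd]
    exact EReal.coe_lt_top _
  · have hterm (k : ℕ+) : (k : ℝ) ^ 1 * cycleWeight d β k * Real.exp (β * s * k) <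
        (k : ℝ) * cycleWeight d β k := by
      rw [pow_one]
      exact mul_lt_of_lt_one_right (mul_pos (by positivity) (cycleWeight_pos hβ k))
        (Real.exp_lt_one_iff.2
          (mul_neg_of_neg_of_pos (mul_neg_of_pos_of_neg hβ hs) (by positivity)))
    rw [criticalDensity_of_three_le hd, EReal.coe_lt_coe_iff]
    exact (summable_cycleMoment hβ 1 hs).tsum_lt_tsum (fun k => (hterm k).le) (hterm 1)
      ((summable_natCast_mul_cycleWeight_iff hβ).2 hd)

lemma exists_finset_lt_sum_of_lt_criticalDensity (hβ : 0 < β) {B : ℝ}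
    (hB : (B : EReal) < criticalDensity d β) :
    ∃ A : Finset ℕ+, B < ∑ k ∈ A, (k : ℝ) * cycleWeight d β k := by
  rcases lt_or_ge d 3 with hd | hd
  · by_contra! hle
    exact hd.not_ge ((summable_natCast_mul_cycleWeight_iff hβ).1 (summable_of_sum_le
      (fun k => (mul_pos (by positivity) (cycleWeight_pos hβ k)).le) hle))
  · rw [criticalDensity_of_three_le hd, EReal.coe_lt_coe_iff] at hB
    exact ((tendsto_order.1 ((summable_natCast_mul_cycleWeight_iff hβ).2 hd).hasSum).1 B hB).exists

lemma sum_le_cycleMoment_one (hβ : 0 < β) {s : ℝ} (hs : s < 0) (A : Finset ℕ+) :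
    ∑ k ∈ A, (k : ℝ) * cycleWeight d β k * Real.exp (β * s * k) ≤ cycleMoment d β 1 s := by
  simpa only [pow_one, cycleMoment] using (summable_cycleMoment (d := d) hβ 1 hs).sum_le_tsum A
    fun k _ => (cycleMoment_term_pos hβ 1 s k).le

lemma eventually_lt_cycleMoment_one (hβ : 0 < β) {B : ℝ}
    (hB : (B : EReal) < criticalDensity d β) :
    ∀ᶠ s in 𝓝[<] (0 : ℝ), B < cycleMoment d β 1 s := by
  obtain ⟨A, hA⟩ := exists_finset_lt_sum_of_lt_criticalDensity hβ hB
  have hcont : Continuous fun s : ℝ =>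
      ∑ k ∈ A, (k : ℝ) * cycleWeight d β k * Real.exp (β * s * k) := by
    fun_prop
  have hev := (hcont.tendsto 0).eventually (lt_mem_nhds (a := B) (by simpa using hA))
  filter_upwards [nhdsWithin_le_nhds hev, self_mem_nhdsWithin] with s hBs hs
  exact hBs.trans_le (sum_le_cycleMoment_one hβ hs A)

lemma cycleMoment_le_exp_mul (hβ : 0 < β) (j : ℕ) {s t : ℝ} (hst : s ≤ t) (ht : t < 0) :
    cycleMoment d β j s ≤ Real.exp (β * (s - t)) * cycleMoment d β j t := by
  rw [cycleMoment, cycleMoment, ← tsum_mul_left]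
  refine (summable_cycleMoment hβ j (hst.trans_lt ht)).tsum_le_tsum (fun k => ?_)
    ((summable_cycleMoment hβ j ht).mul_left _)
  have hw := cycleWeight_pos (d := d) hβ k
  have hk : (1 : ℝ) ≤ k := Nat.one_le_cast.2 k.pos
  have hshift : β * (s - t) ≤ 0 := mul_nonpos_of_nonneg_of_nonpos hβ.le (sub_nonpos.2 hst)
  calc (k : ℝ) ^ j * cycleWeight d β k * Real.exp (β * s * k)
      ≤ (k : ℝ) ^ j * cycleWeight d β k * Real.exp (β * (s - t) + β * t * k) := by
        gcongr
        nlinarith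
    _ = Real.exp (β * (s - t)) * ((k : ℝ) ^ j * cycleWeight d β k * Real.exp (β * t * k)) := by
        rw [Real.exp_add]
        ring

lemma exists_cycleMoment_lt (hβ : 0 < β) (j : ℕ) {x : ℝ} (hx : 0 < x) :
    ∃ s < 0, cycleMoment d β j s < x := by
  have hlim : Tendsto (fun s : ℝ => Real.exp (β * (s - -1)) * cycleMoment d β j (-1)) atBot
      (𝓝 (0 * cycleMoment d β j (-1))) :=
    (Real.tendsto_exp_atBot.comp
      ((tendsto_atBot_add_const_right _ _ tendsto_id).const_mul_atBot hβ)).mul_const _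
  rw [zero_mul] at hlim
  obtain ⟨s, hsx, hs⟩ :=
    ((hlim.eventually (gt_mem_nhds hx)).and (eventually_le_atBot (-1 : ℝ))).exists
  exact ⟨s, by linarith, (cycleMoment_le_exp_mul hβ j hs (by norm_num)).trans_lt hsx⟩

lemma exists_cycleMoment_one_eq (hβ : 0 < β) {x : ℝ} (hx : 0 < x)
    (hxc : (x : EReal) < criticalDensity d β) : ∃ s < 0, cycleMoment d β 1 s = x := by
  obtain ⟨s₁, hs₁, hlow⟩ := exists_cycleMoment_lt (d := d) hβ 1 hx
  obtain ⟨s₂, hhigh, hs₂⟩ := ((eventually_lt_cycleMoment_one hβ hxc).and self_mem_nhdsWithin).exists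
  exact isPreconnected_Iio.intermediate_value hs₁ hs₂ (continuousOn_cycleMoment hβ 1)
    ⟨hlow.le, hhigh.le⟩

lemma exp_mul_one_add_sub_le_exp (x y : ℝ) : Real.exp x * (1 + (y - x)) ≤ Real.exp y := by
  calc Real.exp x * (1 + (y - x)) ≤ Real.exp x * Real.exp (y - x) := by
        gcongr
        linarith [Real.add_one_le_exp (y - x)]
    _ = Real.exp y := by rw [← Real.exp_add, add_sub_cancel]

lemma idealPressure_add_cycleMoment_mul_le (hd : 1 ≤ d) (hβ : 0 < β) {s t : ℝ} (hs : s ≤ 0)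
    (ht : t ≤ 0)
    (hsum : Summable fun k : ℕ+ => (k : ℝ) * cycleWeight d β k * Real.exp (β * t * k)) :
    idealPressure d β t + cycleMoment d β 1 t * (s - t) ≤ idealPressure d β s := by
  have hsum_t := summable_cycleWeight_mul_exp hd hβ ht
  have hsum' := hsum.mul_left (β * (s - t))
  have htangent : ∑' k : ℕ+, (cycleWeight d β k * Real.exp (β * t * k) +
      β * (s - t) * ((k : ℝ) * cycleWeight d β k * Real.exp (β * t * k))) ≤
      ∑' k : ℕ+, cycleWeight d β k * Real.exp (β * s * k) := by
    refine (hsum_t.add hsum').tsum_le_tsum (fun k => ?_) (summable_cycleWeight_mul_exp hd hβ hs)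
    convert! mul_le_mul_of_nonneg_left (exp_mul_one_add_sub_le_exp (β * t * k) (β * s * k))
      (cycleWeight_pos (d := d) hβ k).le using 1
    ring
  rw [hsum_t.tsum_add hsum', tsum_mul_left] at htangent
  simp only [idealPressure_eq_tsum_cycleWeight, cycleMoment, pow_one]
  convert! mul_le_mul_of_nonneg_left htangent (inv_pos.2 hβ).le using 1
  field_simp

lemma idealPressure_zero_add_mul_le (hd : 1 ≤ d) (hβ : 0 < β) {s x : ℝ} (hs : s ≤ 0)
    (hx : criticalDensity d β ≤ (x : EReal)) :
    idealPressure d β 0 + x * s ≤ idealPressure d β s := by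
  have hd3 := three_le_of_criticalDensity_le_coe hx
  have hmoment : cycleMoment d β 1 0 ≤ x := by
    rw [criticalDensity_of_three_le hd3, EReal.coe_le_coe_iff] at hx
    simpa [cycleMoment] using hx
  have htangent := idealPressure_add_cycleMoment_mul_le hd hβ hs le_rfl
    (by simpa using (summable_natCast_mul_cycleWeight_iff hβ).2 hd3)
  linarith [mul_le_mul_of_nonpos_right hmoment hs]

end IdealGas

/-! ### The mean-field model -/

section MeanField

variable {d : ℕ} {β a : ℝ}

lemma sBeta_of_criticalDensity_le {x : ℝ} (hx : criticalDensity d β ≤ (x : EReal)) :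
    sBeta d β x = 0 := if_pos hx

lemma sBeta_cycleMoment (hβ : 0 < β) {s : ℝ} (hs : s < 0) :
    sBeta d β (cycleMoment d β 1 s) = s := by
  rw [sBeta, if_neg (cycleMoment_one_lt_criticalDensity hβ hs).not_ge]
  have hspec := Classical.epsilon_spec (p := fun t : ℝ => t < 0 ∧
    deriv (idealPressure d β) t = cycleMoment d β 1 s) ⟨s, hs, deriv_idealPressure hβ hs⟩
  refine (strictMonoOn_cycleMoment (d := d) hβ 1).injOn hspec.1 hs ?_
  rw [← deriv_idealPressure hβ hspec.1, hspec.2]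

lemma sBeta_neg_and_cycleMoment_sBeta (hβ : 0 < β) {x : ℝ} (hx : 0 < x)
    (hxc : (x : EReal) < criticalDensity d β) :
    sBeta d β x < 0 ∧ cycleMoment d β 1 (sBeta d β x) = x := by
  obtain ⟨s, hs, rfl⟩ := exists_cycleMoment_one_eq hβ hx hxc
  rw [sBeta_cycleMoment hβ hs]
  exact ⟨hs, rfl⟩

lemma sBeta_nonpos (hβ : 0 < β) {x : ℝ} (hx : 0 < x) : sBeta d β x ≤ 0 := by
  rcases le_or_gt (criticalDensity d β) (x : EReal) with hxc | hxc
  · exact (sBeta_of_criticalDensity_le hxc).le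
  · exact (sBeta_neg_and_cycleMoment_sBeta hβ hx hxc).1.le

lemma sBeta_eq_zero_iff (hβ : 0 < β) {x : ℝ} (hx : 0 < x) :
    sBeta d β x = 0 ↔ criticalDensity d β ≤ (x : EReal) := by
  refine ⟨fun h => ?_, sBeta_of_criticalDensity_le⟩
  by_contra! hxc
  exact (sBeta_neg_and_cycleMoment_sBeta hβ hx hxc).1.ne h

lemma cycleMoment_sBeta (hβ : 0 < β) {x : ℝ} (hx : 0 < x) (hneg : sBeta d β x < 0) :
    cycleMoment d β 1 (sBeta d β x) = x :=
  (sBeta_neg_and_cycleMoment_sBeta hβ hx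
    (lt_of_not_ge fun hxc => hneg.ne (sBeta_of_criticalDensity_le hxc))).2

lemma sBeta_lt_sBeta (hβ : 0 < β) {x y : ℝ} (hx : 0 < x) (hxy : x < y)
    (hneg : sBeta d β x < 0) : sBeta d β x < sBeta d β y := by
  rcases (sBeta_nonpos (d := d) hβ (hx.trans hxy)).lt_or_eq with hy | hy
  · refine ((strictMonoOn_cycleMoment (d := d) hβ 1).lt_iff_lt hneg hy).1 ?_
    rwa [cycleMoment_sBeta hβ hx hneg, cycleMoment_sBeta hβ (hx.trans hxy) hy]
  · rwa [hy]

lemma monotoneOn_sBeta (hβ : 0 < β) : MonotoneOn (sBeta d β) (Set.Ioi 0) := by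
  intro x hx y hy hxy
  rcases hxy.eq_or_lt with rfl | hlt
  · rfl
  rcases (sBeta_nonpos (d := d) hβ hx).lt_or_eq with hneg | hzero
  · exact (sBeta_lt_sBeta hβ hx hlt hneg).le
  · have hxc := (sBeta_eq_zero_iff hβ hx).1 hzero
    rw [hzero, sBeta_of_criticalDensity_le (hxc.trans (EReal.coe_le_coe_iff.2 hxy))]

lemma strictMonoOn_sBeta_add_mul (hβ : 0 < β) (ha : 0 < a) :
    StrictMonoOn (fun x => sBeta d β x + a * x) (Set.Ioi 0) := fun _ hx _ hy hxy =>
  add_lt_add_of_le_of_lt (monotoneOn_sBeta hβ hx hy hxy.le) (mul_lt_mul_of_pos_left hxy ha)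

lemma exists_add_mul_cycleMoment_one_eq (hβ : 0 < β) (ha : 0 < a) {u : ℝ}
    (hu : ((u / a : ℝ) : EReal) < criticalDensity d β) :
    ∃ s < 0, s + a * cycleMoment d β 1 s = u := by
  obtain ⟨B, huB, hB⟩ := EReal.lt_iff_exists_real_btwn.1 hu
  rw [EReal.coe_lt_coe_iff, div_lt_iff₀ ha] at huB
  have hnear : ∀ᶠ s in 𝓝[<] (0 : ℝ), u - a * B < s :=
    nhdsWithin_le_nhds (lt_mem_nhds (by linarith))
  obtain ⟨s₂, ⟨hs₂B, hs₂M⟩, hs₂⟩ :=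
    ((hnear.and (eventually_lt_cycleMoment_one hβ hB)).and self_mem_nhdsWithin).exists
  set s₁ : ℝ := min (-1) (u - a * cycleMoment d β 1 (-1))
  have hs₁ : s₁ ≤ -1 := min_le_left _ _
  have hs₁neg : s₁ < 0 := by linarith
  have hlow : s₁ + a * cycleMoment d β 1 s₁ ≤ u := by
    have hM := (strictMonoOn_cycleMoment (d := d) hβ 1).monotoneOn hs₁neg
      (show (-1 : ℝ) ∈ Set.Iio 0 by simp) hs₁
    linarith [min_le_right (-1) (u - a * cycleMoment d β 1 (-1)),
      mul_le_mul_of_nonneg_left hM ha.le]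
  have hhigh : u ≤ s₂ + a * cycleMoment d β 1 s₂ := by
    linarith [mul_lt_mul_of_pos_left hs₂M ha]
  exact isPreconnected_Iio.intermediate_value hs₁neg hs₂
    (continuousOn_id.add (continuousOn_const.mul (continuousOn_cycleMoment hβ 1))) ⟨hlow, hhigh⟩

lemma pos_of_criticalDensity_le (hβ : 0 < β) {x : ℝ} (hx : criticalDensity d β ≤ (x : EReal)) :
    0 < x :=
  (cycleMoment_pos (d := d) hβ 1 neg_one_lt_zero).trans (EReal.coe_lt_coe_iff.1
    ((cycleMoment_one_lt_criticalDensity hβ neg_one_lt_zero).trans_le hx))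

lemma exists_sBeta_eq (hβ : 0 < β) (ha : 0 < a) (u : ℝ) :
    ∃ x, 0 < x ∧ sBeta d β x = u - a * x := by
  rcases le_or_gt (criticalDensity d β) ((u / a : ℝ) : EReal) with hu | hu
  · refine ⟨u / a, pos_of_criticalDensity_le hβ hu, ?_⟩
    rw [sBeta_of_criticalDensity_le hu, mul_div_cancel₀ _ ha.ne', sub_self]
  · obtain ⟨s, hs, rfl⟩ := exists_add_mul_cycleMoment_one_eq hβ ha hu
    exact ⟨_, cycleMoment_pos hβ 1 hs, by rw [sBeta_cycleMoment hβ hs, add_sub_cancel_right]⟩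

lemma xOne_pos (hβ : 0 < β) (ha : 0 < a) (u : ℝ) : 0 < xOne d β a u :=
  (Classical.epsilon_spec (exists_sBeta_eq hβ ha u)).1

lemma sBeta_xOne (hβ : 0 < β) (ha : 0 < a) (u : ℝ) :
    sBeta d β (xOne d β a u) = u - a * xOne d β a u :=
  (Classical.epsilon_spec (exists_sBeta_eq hβ ha u)).2

/-- The slope `s_β(x̃₁(u)) = u - a x̃₁(u) ≤ 0` at the stationary density `x̃₁(u)`; it is the
chemical potential of an ideal gas of that density. -/
noncomputable def stationarySlope (d : ℕ) (β a u : ℝ) : ℝ := sBeta d β (xOne d β a u)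

lemma stationarySlope_eq_sub (hβ : 0 < β) (ha : 0 < a) (u : ℝ) :
    stationarySlope d β a u = u - a * xOne d β a u := sBeta_xOne hβ ha u

lemma mul_xOne (hβ : 0 < β) (ha : 0 < a) (u : ℝ) :
    a * xOne d β a u = u - stationarySlope d β a u := by
  linarith [stationarySlope_eq_sub (d := d) hβ ha u]

lemma xOne_eq_of_sBeta_eq (hβ : 0 < β) (ha : 0 < a) {u x : ℝ} (hx : 0 < x)
    (h : sBeta d β x = u - a * x) : xOne d β a u = x := by
  refine (strictMonoOn_sBeta_add_mul (d := d) hβ ha).injOn (xOne_pos hβ ha u) hx ?_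
  simp only [sBeta_xOne hβ ha, h, sub_add_cancel]

lemma xOne_sBeta_add_mul (hβ : 0 < β) (ha : 0 < a) {x : ℝ} (hx : 0 < x) :
    xOne d β a (sBeta d β x + a * x) = x :=
  xOne_eq_of_sBeta_eq hβ ha hx (add_sub_cancel_right _ _).symm

lemma stationarySlope_add_mul_cycleMoment (hβ : 0 < β) (ha : 0 < a) {s : ℝ} (hs : s < 0) :
    stationarySlope d β a (s + a * cycleMoment d β 1 s) = s := by
  have hx : xOne d β a (sBeta d β (cycleMoment d β 1 s) + a * cycleMoment d β 1 s) =
      cycleMoment d β 1 s := xOne_sBeta_add_mul hβ ha (cycleMoment_pos hβ 1 hs)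
  rw [sBeta_cycleMoment hβ hs] at hx
  rw [stationarySlope, hx, sBeta_cycleMoment hβ hs]

lemma stationarySlope_nonpos (hβ : 0 < β) (ha : 0 < a) (u : ℝ) : stationarySlope d β a u ≤ 0 :=
  sBeta_nonpos hβ (xOne_pos hβ ha u)

lemma xOne_eq_cycleMoment (hβ : 0 < β) (ha : 0 < a) {u : ℝ} (hneg : stationarySlope d β a u < 0) :
    xOne d β a u = cycleMoment d β 1 (stationarySlope d β a u) :=
  (cycleMoment_sBeta hβ (xOne_pos hβ ha u) hneg).symm

lemma stationarySlope_eq_zero_iff (hβ : 0 < β) (ha : 0 < a) {u : ℝ} :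
    stationarySlope d β a u = 0 ↔ criticalDensity d β ≤ ((u / a : ℝ) : EReal) := by
  constructor <;> intro h
  · have hx : xOne d β a u = u / a := by
      rw [eq_div_iff ha.ne', mul_comm, mul_xOne hβ ha, h, sub_zero]
    rwa [← hx, ← sBeta_eq_zero_iff hβ (xOne_pos hβ ha u)]
  · have hx : xOne d β a u = u / a := xOne_eq_of_sBeta_eq hβ ha (pos_of_criticalDensity_le hβ h)
      (by rw [sBeta_of_criticalDensity_le h, mul_div_cancel₀ _ ha.ne', sub_self])
    rw [stationarySlope, hx, sBeta_of_criticalDensity_le h]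

lemma xOne_strictMono (hβ : 0 < β) (ha : 0 < a) : StrictMono (xOne d β a) := by
  intro u v huv
  refine ((strictMonoOn_sBeta_add_mul (d := d) hβ ha).lt_iff_lt
    (xOne_pos hβ ha u) (xOne_pos hβ ha v)).1 ?_
  simpa only [sBeta_xOne hβ ha, sub_add_cancel] using huv

lemma stationarySlope_mono (hβ : 0 < β) (ha : 0 < a) : Monotone (stationarySlope d β a) :=
  fun u v huv => monotoneOn_sBeta hβ (xOne_pos hβ ha u) (xOne_pos hβ ha v)
    ((xOne_strictMono hβ ha).monotone huv)

lemma stationarySlope_lt (hβ : 0 < β) (ha : 0 < a) {u v : ℝ} (huv : u < v)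
    (hneg : stationarySlope d β a u < 0) : stationarySlope d β a u < stationarySlope d β a v :=
  sBeta_lt_sBeta hβ (xOne_pos hβ ha u) (xOne_strictMono hβ ha huv) hneg

lemma lipschitzWith_stationarySlope (hβ : 0 < β) (ha : 0 < a) :
    LipschitzWith 1 (stationarySlope d β a) := by
  refine LipschitzWith.of_le_add fun u v => ?_
  rw [Real.dist_eq]
  rcases le_total u v with huv | hvu
  · linarith [stationarySlope_mono (d := d) hβ ha huv, abs_nonneg (u - v)]
  · have hx := mul_le_mul_of_nonneg_left ((xOne_strictMono (d := d) hβ ha).monotone hvu) ha.le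
    rw [mul_xOne hβ ha, mul_xOne hβ ha] at hx
    linarith [le_abs_self (u - v)]

lemma continuous_stationarySlope (hβ : 0 < β) (ha : 0 < a) : Continuous (stationarySlope d β a) :=
  (lipschitzWith_stationarySlope hβ ha).continuous

lemma idealPressure_sBeta_add_mul_le (hd : 1 ≤ d) (hβ : 0 < β) {x s : ℝ} (hx : 0 < x)
    (hs : s ≤ 0) :
    idealPressure d β (sBeta d β x) + x * (s - sBeta d β x) ≤ idealPressure d β s := by
  rcases (sBeta_nonpos (d := d) hβ hx).lt_or_eq with hneg | hzero
  · have htangent := idealPressure_add_cycleMoment_mul_le (d := d) hd hβ hs hneg.le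
      (by simpa only [pow_one] using summable_cycleMoment hβ 1 hneg)
    rwa [cycleMoment_sBeta hβ hx hneg] at htangent
  · rw [hzero, sub_zero]
    exact idealPressure_zero_add_mul_le hd hβ hs ((sBeta_eq_zero_iff hβ hx).1 hzero)

lemma le_idealFreeEnergy (hβ : 0 < β) {x s : ℝ} (hx : 0 ≤ x) (hs : s ≤ 0) :
    s * x - idealPressure d β s ≤ idealFreeEnergy d β x := by
  refine le_csSup ⟨0, ?_⟩ ⟨s, hs, rfl⟩
  rintro _ ⟨t, ht, rfl⟩
  exact sub_nonpos.2 ((mul_nonpos_of_nonpos_of_nonneg ht hx).trans (idealPressure_nonneg hβ t))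

lemma idealFreeEnergy_eq (hd : 1 ≤ d) (hβ : 0 < β) {x : ℝ} (hx : 0 < x) :
    idealFreeEnergy d β x = sBeta d β x * x - idealPressure d β (sBeta d β x) := by
  refine le_antisymm (csSup_le (Set.nonempty_Iic.image _) ?_)
    (le_idealFreeEnergy hβ hx.le (sBeta_nonpos hβ hx))
  rintro _ ⟨s, hs, rfl⟩
  linarith [idealPressure_sBeta_add_mul_le hd hβ hx hs]

/-- The pressure `sup_x {u x - a x² / 2 - f_0(β, x)}` of the mean-field gas without long cycles,
expressed through its maximiser `x̃₁(u)`. -/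
noncomputable def meanFieldPressure (d : ℕ) (β a u : ℝ) : ℝ :=
  a / 2 * xOne d β a u ^ 2 + idealPressure d β (stationarySlope d β a u)

lemma meanFieldPressure_le (hd : 1 ≤ d) (hβ : 0 < β) (ha : 0 < a) (u : ℝ) {s : ℝ} (hs : s ≤ 0) :
    meanFieldPressure d β a u ≤ (u - s) ^ 2 / (2 * a) + idealPressure d β s := by
  have htangent := idealPressure_sBeta_add_mul_le hd hβ (xOne_pos (d := d) hβ ha u) hs
  have hsquare : 0 ≤ (s - stationarySlope d β a u) ^ 2 / (2 * a) := by positivity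
  have hexpand : (u - s) ^ 2 / (2 * a) = a / 2 * xOne d β a u ^ 2
      - xOne d β a u * (s - stationarySlope d β a u)
      + (s - stationarySlope d β a u) ^ 2 / (2 * a) := by
    rw [show u - s = a * xOne d β a u - (s - stationarySlope d β a u) by
      rw [mul_xOne hβ ha]; ring]
    field_simp
    ring
  rw [← stationarySlope] at htangent
  rw [meanFieldPressure, hexpand]
  linarith

lemma meanFieldPressure_add_mul_le (hd : 1 ≤ d) (hβ : 0 < β) (ha : 0 < a) (u v : ℝ) :
    meanFieldPressure d β a u + xOne d β a u * (v - u) ≤ meanFieldPressure d β a v := by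
  have htangent := idealPressure_sBeta_add_mul_le hd hβ (xOne_pos (d := d) hβ ha u)
    (stationarySlope_nonpos (d := d) hβ ha v)
  have hsquare := mul_nonneg ha.le (sq_nonneg (xOne d β a u - xOne d β a v))
  rw [← stationarySlope, stationarySlope_eq_sub hβ ha u, stationarySlope_eq_sub hβ ha v] at htangent
  rw [meanFieldPressure, meanFieldPressure, stationarySlope_eq_sub hβ ha u,
    stationarySlope_eq_sub hβ ha v]
  linarith

lemma meanFieldPressure_le_add_mul (hd : 1 ≤ d) (hβ : 0 < β) (ha : 0 < a) (u v : ℝ) :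
    meanFieldPressure d β a v ≤
      meanFieldPressure d β a u + xOne d β a u * (v - u) + 1 / (2 * a) * (v - u) ^ 2 := by
  refine (meanFieldPressure_le hd hβ ha v (stationarySlope_nonpos (d := d) hβ ha u)).trans_eq ?_
  rw [show v - stationarySlope d β a u = a * xOne d β a u + (v - u) by rw [mul_xOne hβ ha]; ring,
    meanFieldPressure]
  field_simp
  ring

lemma hasDerivAt_of_tangent_le_of_le_quadratic {f : ℝ → ℝ} {f' C x : ℝ}
    (hlow : ∀ y, f x + f' * (y - x) ≤ f y)
    (hhigh : ∀ y, f y ≤ f x + f' * (y - x) + C * (y - x) ^ 2) : HasDerivAt f f' x := by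
  rw [hasDerivAt_iff_isLittleO]
  refine Asymptotics.IsBigO.trans_isLittleO (g := fun y => ‖y - x‖ ^ 2) ?_
    (Asymptotics.isLittleO_pow_sub_sub x one_lt_two)
  refine Asymptotics.IsBigO.of_bound C (Eventually.of_forall fun y => ?_)
  rw [smul_eq_mul, Real.norm_of_nonneg (by linarith [hlow y]), norm_pow, norm_norm,
    Real.norm_eq_abs, sq_abs]
  linarith [hhigh y]

lemma hasDerivAt_meanFieldPressure (hd : 1 ≤ d) (hβ : 0 < β) (ha : 0 < a) (u : ℝ) :
    HasDerivAt (meanFieldPressure d β a) (xOne d β a u) u :=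
  hasDerivAt_of_tangent_le_of_le_quadratic (meanFieldPressure_add_mul_le hd hβ ha u)
    (meanFieldPressure_le_add_mul hd hβ ha u)

lemma continuous_meanFieldPressure (hd : 1 ≤ d) (hβ : 0 < β) (ha : 0 < a) :
    Continuous (meanFieldPressure d β a) :=
  continuous_iff_continuousAt.2 fun u => (hasDerivAt_meanFieldPressure hd hβ ha u).continuousAt

end MeanField

/-! ### Energy gaps and stationary points -/

section Reduced

lemma add_mul_sub_lt_of_strictConvexOn {f : ℝ → ℝ} {S : Set ℝ} {f' x y : ℝ}
    (hf : StrictConvexOn ℝ S f) (hx : x ∈ S) (hy : y ∈ S) (hxy : y ≠ x)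
    (hf' : HasDerivAt f f' x) : f x + f' * (y - x) < f y := by
  rcases hxy.lt_or_gt with hlt | hlt
  · have hslope := hf.slope_lt_of_hasDerivAt hy hx hlt hf'
    rw [slope_def_field, div_lt_iff₀ (sub_pos.2 hlt)] at hslope
    linarith
  · have hslope := hf.lt_slope_of_hasDerivAt hx hy hlt hf'
    rw [slope_def_field, lt_div_iff₀ (sub_pos.2 hlt)] at hslope
    linarith

variable {d : ℕ} {β a b : ℝ}

/-- The gap `inf_x F_μ(x, y) - inf_x F_μ(x, 0)`, whose sign decides whether the density `y` of
particles in long cycles is preferred to none. -/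
noncomputable def energyGap (d : ℕ) (β a b μ y : ℝ) : ℝ :=
  meanFieldPressure d β a μ - meanFieldPressure d β a (μ - a * y) + (a - b) / 2 * y ^ 2 - μ * y

/-- The level function in the variable `u = μ - a y`: `y` is a stationary point of
`energyGap d β a b μ` exactly when this function takes the value `μ` at `u`. -/
noncomputable def stationaryLevel (d : ℕ) (β a b u : ℝ) : ℝ :=
  u - a / b * stationarySlope d β a u

@[simp] lemma energyGap_zero (μ : ℝ) : energyGap d β a b μ 0 = 0 := by
  simp [energyGap]

lemma energyGap_sub_add_sq_le_freeEnergyFunctional (hβ : 0 < β) (ha : 0 < a) (μ y : ℝ) {x : ℝ}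
    (hx : 0 ≤ x) : energyGap d β a b μ y - meanFieldPressure d β a μ +
      a / 2 * (x - xOne d β a (μ - a * y)) ^ 2 ≤ freeEnergyFunctional d β a b μ (x, y) := by
  have hlegendre := le_idealFreeEnergy (d := d) hβ hx
    (stationarySlope_nonpos (d := d) hβ ha (μ - a * y))
  rw [energyGap, freeEnergyFunctional, meanFieldPressure.eq_def d β a (μ - a * y)]
  rw [stationarySlope_eq_sub hβ ha] at hlegendre ⊢
  linarith

lemma freeEnergyFunctional_xOne (hd : 1 ≤ d) (hβ : 0 < β) (ha : 0 < a) (μ y : ℝ) :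
    freeEnergyFunctional d β a b μ (xOne d β a (μ - a * y), y) =
      energyGap d β a b μ y - meanFieldPressure d β a μ := by
  rw [energyGap, freeEnergyFunctional, meanFieldPressure.eq_def d β a (μ - a * y),
    idealFreeEnergy_eq hd hβ (xOne_pos hβ ha _), ← stationarySlope, stationarySlope_eq_sub hβ ha]
  ring

lemma continuous_energyGap (hd : 1 ≤ d) (hβ : 0 < β) (ha : 0 < a) :
    Continuous fun p : ℝ × ℝ => energyGap d β a b p.1 p.2 := by
  have := continuous_meanFieldPressure (d := d) hd hβ ha
  unfold energyGap
  fun_prop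

lemma continuous_energyGap_left (hd : 1 ≤ d) (hβ : 0 < β) (ha : 0 < a) (y : ℝ) :
    Continuous fun μ => energyGap d β a b μ y :=
  (continuous_energyGap (d := d) (b := b) hd hβ ha).comp (f := fun μ => (μ, y)) (by fun_prop)

lemma continuous_energyGap_right (hd : 1 ≤ d) (hβ : 0 < β) (ha : 0 < a) (μ : ℝ) :
    Continuous (energyGap d β a b μ) :=
  (continuous_energyGap (d := d) (b := b) hd hβ ha).comp (f := fun y => (μ, y)) (by fun_prop)

lemma hasDerivAt_energyGap_right (hd : 1 ≤ d) (hβ : 0 < β) (ha : 0 < a) (hb : 0 < b) (μ y : ℝ) :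
    HasDerivAt (energyGap d β a b μ) (b / a * (stationaryLevel d β a b (μ - a * y) - μ)) y := by
  have hinner : HasDerivAt (fun y : ℝ => μ - a * y) (-a) y := by
    simpa using ((hasDerivAt_id y).const_mul a).const_sub μ
  have hpressure := (hasDerivAt_meanFieldPressure (d := d) hd hβ ha (μ - a * y)).comp y hinner
  have hsquare : HasDerivAt (fun y : ℝ => (a - b) / 2 * y ^ 2) ((a - b) / 2 * (2 * y)) y := by
    simpa using ((hasDerivAt_id y).pow 2).const_mul ((a - b) / 2)
  have hlinear : HasDerivAt (fun y : ℝ => μ * y) μ y := by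
    simpa using (hasDerivAt_id y).const_mul μ
  convert! ((hpressure.const_sub (meanFieldPressure d β a μ)).add hsquare).sub hlinear using 1
  rw [stationaryLevel, stationarySlope_eq_sub hβ ha]
  field_simp
  ring

lemma hasDerivAt_energyGap_left (hd : 1 ≤ d) (hβ : 0 < β) (ha : 0 < a) (μ y : ℝ) :
    HasDerivAt (fun μ => energyGap d β a b μ y)
      ((stationarySlope d β a (μ - a * y) - stationarySlope d β a μ) / a) μ := by
  have hshifted := (hasDerivAt_meanFieldPressure (d := d) hd hβ ha (μ - a * y)).comp μ
    ((hasDerivAt_id μ).sub_const _)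
  have hlinear : HasDerivAt (fun μ : ℝ => μ * y) y μ := by
    simpa using (hasDerivAt_id μ).mul_const y
  convert! (((hasDerivAt_meanFieldPressure hd hβ ha μ).sub hshifted).add_const
    ((a - b) / 2 * y ^ 2)).sub hlinear using 1
  rw [stationarySlope_eq_sub hβ ha, stationarySlope_eq_sub hβ ha]
  field_simp
  ring

lemma energyGap_anti (hd : 1 ≤ d) (hβ : 0 < β) (ha : 0 < a) {y : ℝ} (hy : 0 ≤ y) :
    Antitone fun μ => energyGap d β a b μ y := by
  refine antitone_of_hasDerivAt_nonpos (fun μ => hasDerivAt_energyGap_left hd hβ ha μ y)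
    fun μ => div_nonpos_of_nonpos_of_nonneg (sub_nonpos.2 ?_) ha.le
  exact stationarySlope_mono hβ ha (sub_le_self μ (by positivity))

lemma energyGap_of_stationarySlope_eq_zero (hβ : 0 < β) (ha : 0 < a) {μ y : ℝ} (hy : 0 ≤ y)
    (hzero : stationarySlope d β a (μ - a * y) = 0) :
    energyGap d β a b μ y = -(b / 2 * y ^ 2) := by
  have hzero' : stationarySlope d β a μ = 0 := by
    refine le_antisymm (stationarySlope_nonpos hβ ha μ) (hzero.ge.trans ?_)
    exact stationarySlope_mono hβ ha (sub_le_self μ (by positivity))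
  have hx := eq_div_of_mul_eq ha.ne' ((mul_comm _ _).trans (mul_xOne (d := d) hβ ha μ))
  have hx' := eq_div_of_mul_eq ha.ne'
    ((mul_comm _ _).trans (mul_xOne (d := d) hβ ha (μ - a * y)))
  rw [hzero', sub_zero] at hx
  rw [hzero, sub_zero] at hx'
  rw [energyGap, meanFieldPressure, meanFieldPressure, hzero, hzero', hx, hx']
  field_simp
  ring

lemma energyGap_neg_of_lt (hd : 1 ≤ d) (hβ : 0 < β) (ha : 0 < a) (hb : 0 < b) {μ μ' y : ℝ}
    (hy : 0 < y) (hgap : energyGap d β a b μ y ≤ 0) (hμ : μ < μ') :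
    energyGap d β a b μ' y < 0 := by
  rcases (stationarySlope_nonpos (d := d) hβ ha (μ' - a * y)).lt_or_eq with hneg | hzero
  · refine lt_of_lt_of_le ?_ hgap
    refine strictAntiOn_of_deriv_neg (convex_Icc μ μ')
      (continuous_energyGap_left hd hβ ha y).continuousOn (fun ν hν => ?_)
      (Set.left_mem_Icc.2 hμ.le) (Set.right_mem_Icc.2 hμ.le) hμ
    rw [interior_Icc] at hν
    rw [(hasDerivAt_energyGap_left hd hβ ha ν y).deriv]
    have hle := stationarySlope_mono (d := d) hβ ha (sub_le_sub_right hν.2.le (a * y))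
    have hlt := stationarySlope_lt (d := d) hβ ha (sub_lt_self ν (by positivity : 0 < a * y))
      (hle.trans_lt hneg)
    exact div_neg_of_neg_of_pos (sub_neg.2 hlt) ha
  · rw [energyGap_of_stationarySlope_eq_zero hβ ha hy.le hzero, neg_lt_zero]
    positivity

lemma le_energyGap (hd : 1 ≤ d) (hβ : 0 < β) (ha : 0 < a) {μ y : ℝ} (hy : 0 ≤ y) :
    (a - b) / 2 * y ^ 2 - μ * y ≤ energyGap d β a b μ y := by
  have htangent := meanFieldPressure_add_mul_le (d := d) hd hβ ha (μ - a * y) μ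
  have hx := xOne_pos (d := d) hβ ha (μ - a * y)
  have hslope : 0 ≤ xOne d β a (μ - a * y) * (μ - (μ - a * y)) := by
    rw [sub_sub_cancel]
    positivity
  rw [energyGap]
  linarith

lemma energyGap_le (hd : 1 ≤ d) (hβ : 0 < β) (ha : 0 < a) (μ y : ℝ) :
    energyGap d β a b μ y ≤
      μ ^ 2 / (2 * a) + idealPressure d β 0 + (a - b) / 2 * y ^ 2 - μ * y := by
  have hupper := meanFieldPressure_le (d := d) hd hβ ha μ le_rfl
  have hnonneg : 0 ≤ meanFieldPressure d β a (μ - a * y) := by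
    have := idealPressure_nonneg (d := d) hβ (stationarySlope d β a (μ - a * y))
    rw [meanFieldPressure]
    positivity
  rw [sub_zero] at hupper
  rw [energyGap]
  linarith

lemma exists_energyGap_neg (hd : 1 ≤ d) (hβ : 0 < β) (hb : 0 < b) (hab : b < a) (r : ℝ) :
    ∃ μ y : ℝ, r < y ∧ energyGap d β a b μ y < 0 := by
  have hab' : 0 < a - b := sub_pos.2 hab
  have hcoeff : 0 < 1 / (2 * (a - b)) - 1 / (2 * a) :=
    sub_pos.2 (one_div_lt_one_div_of_lt (by linarith) (by linarith))
  have hlim : Tendsto (fun μ : ℝ => (1 / (2 * (a - b)) - 1 / (2 * a)) * μ ^ 2) atTop atTop :=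
    (tendsto_pow_atTop two_ne_zero).const_mul_atTop hcoeff
  obtain ⟨μ, hr, hμ⟩ := ((eventually_gt_atTop (r * (a - b))).and
    (hlim.eventually_gt_atTop (idealPressure d β 0))).exists
  refine ⟨μ, μ / (a - b), (lt_div_iff₀ hab').2 hr,
    (energyGap_le hd hβ (hb.trans hab) μ _).trans_lt ?_⟩
  have hvalue : (a - b) / 2 * (μ / (a - b)) ^ 2 - μ * (μ / (a - b)) =
      -(1 / (2 * (a - b)) * μ ^ 2) := by
    field_simp
    ring
  have hsplit : μ ^ 2 / (2 * a) = 1 / (2 * a) * μ ^ 2 := by ring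
  linarith

lemma continuous_stationaryLevel (hβ : 0 < β) (ha : 0 < a) :
    Continuous (stationaryLevel d β a b) :=
  continuous_id.sub (continuous_const.mul (continuous_stationarySlope hβ ha))

lemma stationaryLevel_of_stationarySlope_eq_zero {u : ℝ} (hzero : stationarySlope d β a u = 0) :
    stationaryLevel d β a b u = u := by
  rw [stationaryLevel, hzero, mul_zero, sub_zero]

lemma le_stationaryLevel (hβ : 0 < β) (ha : 0 < a) (hb : 0 < b) (u : ℝ) :
    u ≤ stationaryLevel d β a b u :=
  le_sub_self_iff _ |>.2 <|
    mul_nonpos_of_nonneg_of_nonpos (by positivity) (stationarySlope_nonpos hβ ha u)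

lemma stationaryLevel_eq (hβ : 0 < β) (ha : 0 < a) (hb : 0 < b) (u : ℝ) :
    stationaryLevel d β a b u =
      a * xOne d β a u - (a - b) / b * stationarySlope d β a u := by
  rw [stationaryLevel, mul_xOne hβ ha]
  field_simp
  ring

lemma neg_mul_le_stationaryLevel (hβ : 0 < β) (hb : 0 < b) (hab : b < a) (u : ℝ) :
    -((a - b) / b) * u ≤ stationaryLevel d β a b u := by
  have ha : 0 < a := hb.trans hab
  have hx : 0 < a * xOne d β a u := mul_pos ha (xOne_pos hβ ha u)
  have hslope := mul_le_mul_of_nonneg_left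
    (stationarySlope_eq_sub (d := d) hβ ha u ▸ sub_le_self u hx.le :
      stationarySlope d β a u ≤ u) (div_pos (sub_pos.2 hab) hb).le
  rw [stationaryLevel_eq hβ ha hb]
  linarith

lemma cycleMoment_add_mul_lt (hβ : 0 < β) {s t : ℝ} (hs : s < 0) (ht : t < 0) (hts : t ≠ s) :
    cycleMoment d β 1 s + β * cycleMoment d β 2 s * (t - s) < cycleMoment d β 1 t :=
  add_mul_sub_lt_of_strictConvexOn (strictConvexOn_cycleMoment hβ 1) hs ht hts
    (hasDerivAt_cycleMoment hβ 1 hs)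

lemma cycleMoment_sub_mul_lt_of_criticalDensity_le (hβ : 0 < β) {s x : ℝ} (hs : s < 0)
    (hx : criticalDensity d β ≤ (x : EReal)) :
    cycleMoment d β 1 s - β * cycleMoment d β 2 s * s < x := by
  have hs2 : s / 2 < 0 := by linarith
  have hlim : Tendsto (fun t => cycleMoment d β 1 (s / 2)
      + β * cycleMoment d β 2 (s / 2) * (t - s / 2)) (𝓝[<] 0)
      (𝓝 (cycleMoment d β 1 (s / 2) + β * cycleMoment d β 2 (s / 2) * (0 - s / 2))) :=
    (Continuous.tendsto (by fun_prop) 0).mono_left nhdsWithin_le_nhds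
  have hhalf : cycleMoment d β 1 (s / 2) + β * cycleMoment d β 2 (s / 2) * (0 - s / 2) ≤ x := by
    refine le_of_tendsto hlim ?_
    filter_upwards [Ioo_mem_nhdsLT hs2] with t ht
    exact (cycleMoment_add_mul_lt hβ hs2 ht.2 ht.1.ne').le.trans (EReal.coe_le_coe_iff.1
      ((cycleMoment_one_lt_criticalDensity hβ ht.2).le.trans hx))
  have htangent := cycleMoment_add_mul_lt (d := d) hβ hs hs2 (by linarith)
  have hslope := mul_lt_mul_of_pos_left
    (strictMonoOn_cycleMoment (d := d) hβ 2 hs hs2 (by linarith)) hβ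
  nlinarith

lemma xOne_add_mul_lt (hβ : 0 < β) (ha : 0 < a) {u v : ℝ} (hneg : stationarySlope d β a u < 0)
    (hne : stationarySlope d β a v ≠ stationarySlope d β a u) :
    xOne d β a u + β * cycleMoment d β 2 (stationarySlope d β a u) *
      (stationarySlope d β a v - stationarySlope d β a u) < xOne d β a v := by
  rw [xOne_eq_cycleMoment hβ ha hneg]
  rcases (stationarySlope_nonpos (d := d) hβ ha v).lt_or_eq with hv | hv
  · rw [xOne_eq_cycleMoment hβ ha hv]
    exact cycleMoment_add_mul_lt hβ hneg hv hne
  · have hx := cycleMoment_sub_mul_lt_of_criticalDensity_le hβ hneg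
      ((sBeta_eq_zero_iff hβ (xOne_pos hβ ha v)).1 hv)
    rw [hv]
    linarith

/-- In terms of the slope, the level is a strictly convex function; this is its supporting line. -/
lemma stationaryLevel_add_mul_lt (hβ : 0 < β) (ha : 0 < a) (hb : 0 < b) {u v : ℝ}
    (hneg : stationarySlope d β a u < 0)
    (hne : stationarySlope d β a v ≠ stationarySlope d β a u) :
    stationaryLevel d β a b u +
      (a * (β * cycleMoment d β 2 (stationarySlope d β a u)) - (a - b) / b) *
        (stationarySlope d β a v - stationarySlope d β a u) < stationaryLevel d β a b v := by
  have hx := mul_lt_mul_of_pos_left (xOne_add_mul_lt hβ ha hneg hne) ha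
  rw [stationaryLevel_eq hβ ha hb, stationaryLevel_eq hβ ha hb]
  linarith

lemma stationaryLevel_lt_max (hβ : 0 < β) (ha : 0 < a) (hb : 0 < b) {u₁ u u₂ : ℝ}
    (h₁ : u₁ < u) (h₂ : u < u₂) :
    stationaryLevel d β a b u < max (stationaryLevel d β a b u₁) (stationaryLevel d β a b u₂) := by
  have hmono := stationarySlope_mono (d := d) hβ ha
  rcases (stationarySlope_nonpos (d := d) hβ ha u).lt_or_eq with hneg | hzero
  · have hslope₁ := stationarySlope_lt hβ ha h₁ ((hmono h₁.le).trans_lt hneg)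
    have hslope₂ := stationarySlope_lt hβ ha h₂ hneg
    have hline₁ := stationaryLevel_add_mul_lt hβ ha hb hneg hslope₁.ne
    have hline₂ := stationaryLevel_add_mul_lt hβ ha hb hneg hslope₂.ne'
    rcases le_total 0 (a * (β * cycleMoment d β 2 (stationarySlope d β a u)) - (a - b) / b)
      with hD | hD
    · exact lt_max_of_lt_right (by nlinarith)
    · exact lt_max_of_lt_left (by nlinarith)
  · have hzero₂ : stationarySlope d β a u₂ = 0 :=
      le_antisymm (stationarySlope_nonpos hβ ha u₂) (hzero ▸ hmono h₂.le)
    refine lt_max_of_lt_right ?_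
    rwa [stationaryLevel_of_stationarySlope_eq_zero hzero,
      stationaryLevel_of_stationarySlope_eq_zero hzero₂]

lemma mul_deriv_idealPressure_sub (hβ : 0 < β) (ha : 0 < a) (hb : 0 < b) {s : ℝ} (hs : s < 0) :
    a * deriv (idealPressure d β) s - (a - b) / b * s =
      stationaryLevel d β a b (s + a * cycleMoment d β 1 s) := by
  rw [deriv_idealPressure hβ hs, stationaryLevel, stationarySlope_add_mul_cycleMoment hβ ha hs]
  field_simp
  ring

lemma muT_le_mul_cycleMoment_sub (hβ : 0 < β) (hb : 0 < b) (hab : b < a) {s : ℝ} (hs : s < 0) :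
    muT d β a b ≤ a * cycleMoment d β 1 s - (a - b) / b * s := by
  have ha : 0 < a := hb.trans hab
  have hc : 0 < (a - b) / b := div_pos (sub_pos.2 hab) hb
  rw [← deriv_idealPressure hβ hs]
  refine csInf_le ⟨0, ?_⟩ ⟨s, hs, rfl⟩
  rintro _ ⟨t, ht, rfl⟩
  have hM := cycleMoment_pos (d := d) hβ 1 ht
  simp only [deriv_idealPressure hβ ht]
  linarith [mul_pos ha hM, mul_neg_of_pos_of_neg hc ht]

lemma muT_le_stationaryLevel (hβ : 0 < β) (hb : 0 < b) (hab : b < a) (u : ℝ) :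
    muT d β a b ≤ stationaryLevel d β a b u := by
  have ha : 0 < a := hb.trans hab
  have hc : 0 < (a - b) / b := div_pos (sub_pos.2 hab) hb
  rcases (stationarySlope_nonpos (d := d) hβ ha u).lt_or_eq with hneg | hzero
  · rw [stationaryLevel_eq hβ ha hb, xOne_eq_cycleMoment hβ ha hneg]
    exact muT_le_mul_cycleMoment_sub hβ hb hab hneg
  · rw [stationaryLevel_of_stationarySlope_eq_zero hzero]
    refine le_of_forall_pos_le_add fun ε hε => ?_
    have hs : -(ε / ((a - b) / b)) < 0 := neg_lt_zero.2 (by positivity)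
    have hM := (cycleMoment_one_lt_criticalDensity hβ hs).le.trans
      ((stationarySlope_eq_zero_iff hβ ha).1 hzero)
    rw [EReal.coe_le_coe_iff, le_div_iff₀' ha] at hM
    refine (muT_le_mul_cycleMoment_sub hβ hb hab hs).trans ?_
    rw [mul_neg, mul_div_cancel₀ _ hc.ne']
    linarith

lemma exists_stationaryLevel_eq_muT (hβ : 0 < β) (hb : 0 < b) (hab : b < a) :
    ∃ u, stationaryLevel d β a b u = muT d β a b := by
  have ha : 0 < a := hb.trans hab
  have hc : -((a - b) / b) < 0 := neg_lt_zero.2 (div_pos (sub_pos.2 hab) hb)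
  have hlim : Tendsto (stationaryLevel d β a b) (cocompact ℝ) atTop := by
    rw [cocompact_eq_atBot_atTop]
    exact (tendsto_atTop_mono (neg_mul_le_stationaryLevel hβ hb hab)
      (tendsto_id.const_mul_atBot_of_neg hc)).sup
      (tendsto_atTop_mono (le_stationaryLevel hβ ha hb) tendsto_id)
  obtain ⟨u, hu⟩ := (continuous_stationaryLevel (d := d) (b := b) hβ ha).exists_forall_le hlim
  refine ⟨u, le_antisymm (le_csInf (Set.nonempty_Iio.image _) ?_)
    (muT_le_stationaryLevel hβ hb hab u)⟩
  rintro _ ⟨s, hs, rfl⟩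
  simp only [mul_deriv_idealPressure_sub hβ ha hb hs]
  exact hu _

/-- The smallest solution `u` of `stationaryLevel d β a b u = μ`, for `μ ≥ μ_t`; it corresponds to
the largest stationary point `y = (μ - u) / a` of the energy gap. -/
noncomputable def minStationaryPoint (d : ℕ) (β a b μ : ℝ) : ℝ :=
  sInf {u | stationaryLevel d β a b u ≤ μ}

lemma bddBelow_stationaryLevel_le (hβ : 0 < β) (hb : 0 < b) (hab : b < a) (μ : ℝ) :
    BddBelow {u | stationaryLevel d β a b u ≤ μ} := by
  have hc : 0 < (a - b) / b := div_pos (sub_pos.2 hab) hb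
  refine ⟨-μ / ((a - b) / b), fun u hu => ?_⟩
  rw [div_le_iff₀ hc]
  linarith [(neg_mul_le_stationaryLevel (d := d) hβ hb hab u).trans hu]

lemma minStationaryPoint_le (hβ : 0 < β) (hb : 0 < b) (hab : b < a) {μ u : ℝ}
    (hu : stationaryLevel d β a b u ≤ μ) : minStationaryPoint d β a b μ ≤ u :=
  csInf_le (bddBelow_stationaryLevel_le hβ hb hab μ) hu

lemma lt_stationaryLevel_of_lt_minStationaryPoint (hβ : 0 < β) (hb : 0 < b) (hab : b < a)
    {μ u : ℝ} (hu : u < minStationaryPoint d β a b μ) : μ < stationaryLevel d β a b u := by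
  by_contra! hle
  exact (minStationaryPoint_le hβ hb hab hle).not_gt hu

lemma stationaryLevel_minStationaryPoint (hβ : 0 < β) (hb : 0 < b) (hab : b < a) {μ : ℝ}
    (hμ : muT d β a b ≤ μ) : stationaryLevel d β a b (minStationaryPoint d β a b μ) = μ := by
  have hcont := continuous_stationaryLevel (d := d) (b := b) hβ (hb.trans hab)
  obtain ⟨u, hu⟩ := exists_stationaryLevel_eq_muT (d := d) hβ hb hab
  have hmem : minStationaryPoint d β a b μ ∈ {u | stationaryLevel d β a b u ≤ μ} :=
    (isClosed_le hcont continuous_const).csInf_mem ⟨u, hu.trans_le hμ⟩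
      (bddBelow_stationaryLevel_le hβ hb hab μ)
  refine le_antisymm hmem (ge_of_tendsto ((hcont.tendsto _).mono_left nhdsWithin_le_nhds :
    Tendsto _ (𝓝[<] (minStationaryPoint d β a b μ)) _) ?_)
  filter_upwards [self_mem_nhdsWithin] with v hv
  exact (lt_stationaryLevel_of_lt_minStationaryPoint hβ hb hab hv).le

lemma minStationaryPoint_anti (hβ : 0 < β) (hb : 0 < b) (hab : b < a) {μ μ' : ℝ}
    (hμ : muT d β a b ≤ μ) (h : μ ≤ μ') :
    minStationaryPoint d β a b μ' ≤ minStationaryPoint d β a b μ :=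
  minStationaryPoint_le hβ hb hab ((stationaryLevel_minStationaryPoint hβ hb hab hμ).trans_le h)

lemma stationarySlope_eq_neg_mul_iff (hβ : 0 < β) (hb : 0 < b) (hab : b < a) {μ u : ℝ} :
    stationarySlope d β a u = -(b / (a - b)) * (μ - a * xOne d β a u) ↔
      stationaryLevel d β a b u = μ := by
  have hab' : a - b ≠ 0 := (sub_pos.2 hab).ne'
  rw [mul_xOne hβ (hb.trans hab), stationaryLevel]
  constructor
  · intro h
    field_simp at h ⊢
    linarith
  · rintro rfl
    field_simp
    ring

lemma xTwo_eq (hβ : 0 < β) (hb : 0 < b) (hab : b < a) {μ : ℝ} (hμ : muT d β a b ≤ μ) :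
    xTwo d β a b μ = xOne d β a (minStationaryPoint d β a b μ) := by
  have ha : 0 < a := hb.trans hab
  refine IsLeast.csInf_eq ⟨⟨xOne_pos hβ ha _, ?_⟩, ?_⟩
  · rw [← stationarySlope, stationarySlope_eq_neg_mul_iff hβ hb hab,
      stationaryLevel_minStationaryPoint hβ hb hab hμ]
  · rintro x ⟨hx, hstat⟩
    rw [← xOne_sBeta_add_mul hβ ha hx, ← stationarySlope,
      stationarySlope_eq_neg_mul_iff hβ hb hab] at hstat
    rw [← xOne_sBeta_add_mul hβ ha hx]
    exact (xOne_strictMono hβ ha).monotone (minStationaryPoint_le hβ hb hab hstat.le)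

lemma yTwo_eq (hβ : 0 < β) (hb : 0 < b) (hab : b < a) {μ : ℝ} (hμ : muT d β a b ≤ μ) :
    yTwo d β a b μ = (μ - minStationaryPoint d β a b μ) / a := by
  have ha : 0 < a := hb.trans hab
  have hab' : a - b ≠ 0 := (sub_pos.2 hab).ne'
  have hslope := (stationarySlope_eq_neg_mul_iff hβ hb hab).2
    (stationaryLevel_minStationaryPoint (d := d) hβ hb hab hμ)
  rw [stationarySlope_eq_sub hβ ha] at hslope
  rw [yTwo, xTwo_eq hβ hb hab hμ]
  field_simp at hslope ⊢
  linarith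

lemma sub_mul_yTwo (hβ : 0 < β) (hb : 0 < b) (hab : b < a) {μ : ℝ} (hμ : muT d β a b ≤ μ) :
    μ - a * yTwo d β a b μ = minStationaryPoint d β a b μ := by
  rw [yTwo_eq hβ hb hab hμ, mul_div_cancel₀ _ (hb.trans hab).ne', sub_sub_cancel]

lemma yTwo_nonneg (hβ : 0 < β) (hb : 0 < b) (hab : b < a) {μ : ℝ} (hμ : muT d β a b ≤ μ) :
    0 ≤ yTwo d β a b μ := by
  have hle := le_stationaryLevel (d := d) hβ (hb.trans hab) hb (minStationaryPoint d β a b μ)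
  rw [stationaryLevel_minStationaryPoint hβ hb hab hμ] at hle
  rw [yTwo_eq hβ hb hab hμ]
  exact div_nonneg (sub_nonneg.2 hle) (hb.trans hab).le

lemma yTwo_mono (hβ : 0 < β) (hb : 0 < b) (hab : b < a) {μ μ' : ℝ}
    (hμ : muT d β a b ≤ μ) (h : μ ≤ μ') : yTwo d β a b μ ≤ yTwo d β a b μ' := by
  rw [yTwo_eq hβ hb hab hμ, yTwo_eq hβ hb hab (hμ.trans h)]
  exact div_le_div_of_nonneg_right (sub_le_sub h (minStationaryPoint_anti hβ hb hab hμ h))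
    (hb.trans hab).le

lemma stationaryLevel_lt_of_lt_minStationaryPoint (hβ : 0 < β) (hb : 0 < b) (hab : b < a)
    {μ u v : ℝ} (hμ : muT d β a b ≤ μ) (huv : u < v) (hv : v < minStationaryPoint d β a b μ) :
    stationaryLevel d β a b v < stationaryLevel d β a b u := by
  have hmax := stationaryLevel_lt_max (d := d) hβ (hb.trans hab) hb huv hv
  rw [stationaryLevel_minStationaryPoint hβ hb hab hμ] at hmax
  exact (lt_max_iff.1 hmax).resolve_right
    (lt_stationaryLevel_of_lt_minStationaryPoint hβ hb hab hv).not_gt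

lemma tendsto_minStationaryPoint_nhdsGE (hβ : 0 < β) (hb : 0 < b) (hab : b < a) {μ : ℝ}
    (hμ : muT d β a b ≤ μ) :
    Tendsto (minStationaryPoint d β a b) (𝓝[≥] μ) (𝓝 (minStationaryPoint d β a b μ)) := by
  refine tendsto_order.2 ⟨fun u hu => ?_, fun u hu => ?_⟩
  · filter_upwards [self_mem_nhdsWithin, nhdsWithin_le_nhds (gt_mem_nhds
      (lt_stationaryLevel_of_lt_minStationaryPoint hβ hb hab hu))] with ν hμν hν
    by_contra! hle
    have hlevel := stationaryLevel_minStationaryPoint hβ hb hab (hμ.trans hμν)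
    rcases hle.lt_or_eq with hlt | heq
    · linarith [stationaryLevel_lt_of_lt_minStationaryPoint hβ hb hab hμ hlt hu]
    · rw [heq] at hlevel
      exact hν.ne' hlevel
  · filter_upwards [self_mem_nhdsWithin] with ν hμν
    exact (minStationaryPoint_anti hβ hb hab hμ hμν).trans_lt hu

lemma tendsto_yTwo_nhdsGE (hβ : 0 < β) (hb : 0 < b) (hab : b < a) {μ : ℝ}
    (hμ : muT d β a b ≤ μ) :
    Tendsto (yTwo d β a b) (𝓝[≥] μ) (𝓝 (yTwo d β a b μ)) := by
  rw [yTwo_eq hβ hb hab hμ]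
  refine (((tendsto_id.mono_left nhdsWithin_le_nhds).sub
    (tendsto_minStationaryPoint_nhdsGE hβ hb hab hμ)).div_const a).congr' ?_
  filter_upwards [self_mem_nhdsWithin] with ν hμν
  exact (yTwo_eq hβ hb hab (hμ.trans hμν)).symm

lemma energyGap_lt_of_lt_stationaryLevel (hd : 1 ≤ d) (hβ : 0 < β) (ha : 0 < a) (hb : 0 < b)
    {μ y₁ y₂ : ℝ} (hy : y₁ < y₂)
    (h : ∀ y ∈ Set.Ioo y₁ y₂, μ < stationaryLevel d β a b (μ - a * y)) :
    energyGap d β a b μ y₁ < energyGap d β a b μ y₂ := by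
  refine strictMonoOn_of_deriv_pos (convex_Icc y₁ y₂)
    (continuous_energyGap_right hd hβ ha μ).continuousOn (fun y hy' => ?_)
    (Set.left_mem_Icc.2 hy.le) (Set.right_mem_Icc.2 hy.le) hy
  rw [interior_Icc] at hy'
  rw [(hasDerivAt_energyGap_right hd hβ ha hb μ y).deriv]
  exact mul_pos (div_pos hb ha) (sub_pos.2 (h y hy'))

lemma energyGap_lt_of_stationaryLevel_lt (hd : 1 ≤ d) (hβ : 0 < β) (ha : 0 < a) (hb : 0 < b)
    {μ y₁ y₂ : ℝ} (hy : y₁ < y₂)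
    (h : ∀ y ∈ Set.Ioo y₁ y₂, stationaryLevel d β a b (μ - a * y) < μ) :
    energyGap d β a b μ y₂ < energyGap d β a b μ y₁ := by
  refine strictAntiOn_of_deriv_neg (convex_Icc y₁ y₂)
    (continuous_energyGap_right hd hβ ha μ).continuousOn (fun y hy' => ?_)
    (Set.left_mem_Icc.2 hy.le) (Set.right_mem_Icc.2 hy.le) hy
  rw [interior_Icc] at hy'
  rw [(hasDerivAt_energyGap_right hd hβ ha hb μ y).deriv]
  exact mul_neg_of_pos_of_neg (div_pos hb ha) (sub_neg.2 (h y hy'))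

lemma energyGap_lt_of_yTwo_le (hd : 1 ≤ d) (hβ : 0 < β) (hb : 0 < b) (hab : b < a)
    {μ y₁ y₂ : ℝ} (hμ : muT d β a b ≤ μ) (h₁ : yTwo d β a b μ ≤ y₁) (h₂ : y₁ < y₂) :
    energyGap d β a b μ y₁ < energyGap d β a b μ y₂ := by
  have ha : 0 < a := hb.trans hab
  refine energyGap_lt_of_lt_stationaryLevel hd hβ ha hb h₂ fun y hy =>
    lt_stationaryLevel_of_lt_minStationaryPoint hβ hb hab ?_
  rw [← sub_mul_yTwo hβ hb hab hμ]
  exact sub_lt_sub_left (mul_lt_mul_of_pos_left (h₁.trans_lt hy.1) ha) μ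

/-- Starting from `0`, the gap increases, then decreases down to `ỹ₂`, then increases. -/
lemma energyGap_trichotomy (hd : 1 ≤ d) (hβ : 0 < β) (hb : 0 < b) (hab : b < a) {μ y : ℝ}
    (hμ : muT d β a b ≤ μ) (hy : 0 ≤ y) (hne : y ≠ yTwo d β a b μ) :
    y = 0 ∨ 0 < energyGap d β a b μ y ∨
      energyGap d β a b μ (yTwo d β a b μ) < energyGap d β a b μ y := by
  have ha : 0 < a := hb.trans hab
  have hanti : ∀ {z w : ℝ}, z < w → μ - a * w < μ - a * z := fun h =>
    sub_lt_sub_left (mul_lt_mul_of_pos_left h ha) μ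
  have hlevel : stationaryLevel d β a b (μ - a * yTwo d β a b μ) = μ := by
    rw [sub_mul_yTwo hβ hb hab hμ, stationaryLevel_minStationaryPoint hβ hb hab hμ]
  rcases hne.lt_or_gt with hlt | hgt
  · rcases le_or_gt (stationaryLevel d β a b (μ - a * y)) μ with hle | hgt
    · refine Or.inr (Or.inr (energyGap_lt_of_stationaryLevel_lt hd hβ ha hb hlt fun z hz => ?_))
      have hmax := stationaryLevel_lt_max (d := d) hβ ha hb (hanti hz.2) (hanti hz.1)
      rwa [hlevel, max_eq_left hle] at hmax
    · refine hy.eq_or_lt.imp Eq.symm fun hpos => Or.inl ?_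
      rw [← energyGap_zero (d := d) (β := β) (a := a) (b := b) μ]
      refine energyGap_lt_of_lt_stationaryLevel hd hβ ha hb hpos fun z hz => ?_
      have hmax := stationaryLevel_lt_max (d := d) hβ ha hb (hanti hlt) (hanti hz.2)
      rw [hlevel] at hmax
      exact hgt.trans ((lt_max_iff.1 hmax).resolve_left hgt.not_gt)
  · exact Or.inr (Or.inr (energyGap_lt_of_yTwo_le hd hβ hb hab hμ le_rfl hgt))

end Reduced

/-! ### The transition chemical potential -/

section Transition

variable {d : ℕ} {β a b : ℝ}

/-- `y` is an admissible density of long cycles: `y ∈ {0} ∪ [κ, ∞)`, for `κ = ∞` only `y = 0`. -/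
def IsLongDensity (κ : ℝ≥0∞) (y : ℝ) : Prop := 0 ≤ y ∧ (y = 0 ∨ κ ≤ ENNReal.ofReal y)

/-- `y` is the unique minimiser of the energy gap among the admissible densities of long cycles. -/
def IsEquilibrium (d : ℕ) (β a b : ℝ) (κ : ℝ≥0∞) (μ y : ℝ) : Prop :=
  IsLongDensity κ y ∧
    ∀ z, IsLongDensity κ z → z ≠ y → energyGap d β a b μ y < energyGap d β a b μ z

lemma isLongDensity_zero (κ : ℝ≥0∞) : IsLongDensity κ 0 := ⟨le_rfl, Or.inl rfl⟩

lemma isLongDensity_zero_iff {y : ℝ} : IsLongDensity 0 y ↔ 0 ≤ y := by simp [IsLongDensity]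

lemma isLongDensity_top_iff {y : ℝ} : IsLongDensity ⊤ y ↔ y = 0 := by
  simp +contextual [IsLongDensity]

lemma isLongDensity_ofReal_iff {κ y : ℝ} (hκ : 0 ≤ κ) :
    IsLongDensity (ENNReal.ofReal κ) y ↔ y = 0 ∨ κ ≤ y := by
  constructor
  · rintro ⟨hy, h | h⟩
    · exact Or.inl h
    · exact Or.inr ((ENNReal.ofReal_le_ofReal_iff hy).1 h)
  · rintro (rfl | h)
    · exact isLongDensity_zero _
    · exact ⟨hκ.trans h, Or.inr (ENNReal.ofReal_le_ofReal h)⟩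

lemma mk_mem_rateDomain {κ : ℝ≥0∞} {x y : ℝ} :
    (x, y) ∈ rateDomain κ ↔ 0 ≤ x ∧ IsLongDensity κ y := Iff.rfl

lemma pressure_eq_meanFieldPressure_sub (hd : 1 ≤ d) (hβ : 0 < β) (ha : 0 < a) {κ : ℝ≥0∞}
    {μ c : ℝ} (hc : IsLeast (energyGap d β a b μ '' {y | IsLongDensity κ y}) c) :
    pressure d β a b κ μ = meanFieldPressure d β a μ - c := by
  obtain ⟨⟨y₀, hy₀, hcy₀⟩, hle⟩ := hc
  refine IsGreatest.csSup_eq ⟨⟨(xOne d β a (μ - a * y₀), y₀),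
    mk_mem_rateDomain.2 ⟨(xOne_pos hβ ha _).le, hy₀⟩, ?_⟩, ?_⟩
  · change -freeEnergyFunctional d β a b μ (xOne d β a (μ - a * y₀), y₀) = _
    rw [freeEnergyFunctional_xOne hd hβ ha, hcy₀, neg_sub]
  · rintro _ ⟨⟨x, y⟩, ⟨hx, hy⟩, rfl⟩
    have hfree := energyGap_sub_add_sq_le_freeEnergyFunctional (d := d) (b := b) hβ ha μ y hx
    have hcy : c ≤ energyGap d β a b μ y := hle ⟨y, hy, rfl⟩
    have hsq : 0 ≤ a / 2 * (x - xOne d β a (μ - a * y)) ^ 2 := by positivity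
    dsimp only
    linarith

lemma mk_mem_rateZeroes_iff (hd : 1 ≤ d) (hβ : 0 < β) (ha : 0 < a) {κ : ℝ≥0∞} {μ c : ℝ}
    (hc : IsLeast (energyGap d β a b μ '' {y | IsLongDensity κ y}) c) {x y : ℝ} :
    (x, y) ∈ rateZeroes d β a b κ μ ↔
      IsLongDensity κ y ∧ energyGap d β a b μ y = c ∧ x = xOne d β a (μ - a * y) := by
  have hp := pressure_eq_meanFieldPressure_sub hd hβ ha hc
  rw [rateZeroes, Set.mem_ofPred_eq, rateFunction]
  constructor
  · intro h
    split_ifs at h with hz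
    · obtain ⟨hx, hy⟩ := mk_mem_rateDomain.1 hz
      rw [EReal.coe_eq_zero, hp] at h
      have hfree := energyGap_sub_add_sq_le_freeEnergyFunctional (d := d) (b := b) hβ ha μ y hx
      have hcy : c ≤ energyGap d β a b μ y := hc.2 ⟨y, hy, rfl⟩
      have hsq : 0 ≤ a / 2 * (x - xOne d β a (μ - a * y)) ^ 2 := by positivity
      have hzero : (x - xOne d β a (μ - a * y)) ^ 2 = 0 :=
        (mul_eq_zero.1 (by linarith : a / 2 * (x - xOne d β a (μ - a * y)) ^ 2 = 0)).resolve_left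
          (by positivity)
      exact ⟨hy, by linarith, sub_eq_zero.1 (pow_eq_zero_iff two_ne_zero |>.1 hzero)⟩
    · exact absurd h EReal.top_ne_zero
  · rintro ⟨hy, hcy, rfl⟩
    rw [if_pos (mk_mem_rateDomain.2 ⟨(xOne_pos hβ ha _).le, hy⟩),
      freeEnergyFunctional_xOne hd hβ ha, hp, hcy, EReal.coe_eq_zero]
    ring

lemma IsEquilibrium.rateZeroes_eq (hd : 1 ≤ d) (hβ : 0 < β) (ha : 0 < a) {κ : ℝ≥0∞} {μ y : ℝ}
    (h : IsEquilibrium d β a b κ μ y) :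
    rateZeroes d β a b κ μ = {(xOne d β a (μ - a * y), y)} := by
  have hc : IsLeast (energyGap d β a b μ '' {z | IsLongDensity κ z}) (energyGap d β a b μ y) := by
    refine ⟨⟨y, h.1, rfl⟩, ?_⟩
    rintro _ ⟨z, hz, rfl⟩
    rcases eq_or_ne z y with rfl | hne
    exacts [le_rfl, (h.2 z hz hne).le]
  ext ⟨x, z⟩
  rw [mk_mem_rateZeroes_iff hd hβ ha hc, Set.mem_singleton_iff, Prod.mk.injEq]
  constructor
  · rintro ⟨hz, hgap, rfl⟩
    obtain rfl : z = y := by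
      by_contra hne
      exact (h.2 z hz hne).ne' hgap
    exact ⟨rfl, rfl⟩
  · rintro ⟨rfl, rfl⟩
    exact ⟨h.1, rfl, rfl⟩

lemma rateZeroes_eq_pair (hd : 1 ≤ d) (hβ : 0 < β) (ha : 0 < a) {κ : ℝ≥0∞} {μ y : ℝ}
    (hy : IsLongDensity κ y) (hgap : energyGap d β a b μ y = 0)
    (hlt : ∀ z, IsLongDensity κ z → z ≠ 0 → z ≠ y → 0 < energyGap d β a b μ z) :
    rateZeroes d β a b κ μ = {(xOne d β a μ, 0), (xOne d β a (μ - a * y), y)} := by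
  have hc : IsLeast (energyGap d β a b μ '' {z | IsLongDensity κ z}) 0 := by
    refine ⟨⟨y, hy, hgap⟩, ?_⟩
    rintro _ ⟨z, hz, rfl⟩
    by_cases hz0 : z = 0
    · rw [hz0, energyGap_zero]
    · by_cases hzy : z = y
      · rw [hzy, hgap]
      · exact (hlt z hz hz0 hzy).le
  ext ⟨x, z⟩
  simp only [mk_mem_rateZeroes_iff hd hβ ha hc, Set.mem_insert_iff, Set.mem_singleton_iff,
    Prod.mk.injEq]
  constructor
  · rintro ⟨hz, hgapz, rfl⟩
    by_cases hz0 : z = 0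
    · exact Or.inl ⟨by rw [hz0, mul_zero, sub_zero], hz0⟩
    · by_cases hzy : z = y
      · exact Or.inr ⟨by rw [hzy], hzy⟩
      · exact absurd hgapz (hlt z hz hz0 hzy).ne'
  · rintro (⟨rfl, rfl⟩ | ⟨rfl, rfl⟩)
    · exact ⟨isLongDensity_zero κ, energyGap_zero μ, by rw [mul_zero, sub_zero]⟩
    · exact ⟨hy, hgap, rfl⟩

lemma isEquilibrium_top (d : ℕ) (β a b μ : ℝ) : IsEquilibrium d β a b ⊤ μ 0 :=
  ⟨isLongDensity_zero _, fun _ hz hne => absurd (isLongDensity_top_iff.1 hz) hne⟩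

/-- The transition chemical potential `μ^*_κ`, for `κ = 0` the paper's `μ^*`: the infimum of the
`μ` at which some density `y ≥ κ`, `y > 0`, of long cycles is favourable. -/
noncomputable def transitionPotential (d : ℕ) (β a b κ : ℝ) : ℝ :=
  sInf {μ | ∃ y, 0 < y ∧ κ ≤ y ∧ energyGap d β a b μ y < 0}

lemma muT_le_of_energyGap_neg (hd : 1 ≤ d) (hβ : 0 < β) (hb : 0 < b) (hab : b < a) {μ y : ℝ}
    (hy : 0 < y) (h : energyGap d β a b μ y < 0) : muT d β a b ≤ μ := by
  by_contra! hμ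
  have hpos := energyGap_lt_of_lt_stationaryLevel (d := d) hd hβ (hb.trans hab) hb hy
    fun z _ => hμ.trans_le (muT_le_stationaryLevel hβ hb hab (μ - a * z))
  rw [energyGap_zero] at hpos
  exact h.not_gt hpos

lemma nonempty_setOf_energyGap_neg (hd : 1 ≤ d) (hβ : 0 < β) (hb : 0 < b) (hab : b < a) (κ : ℝ) :
    {μ | ∃ y, 0 < y ∧ κ ≤ y ∧ energyGap d β a b μ y < 0}.Nonempty := by
  obtain ⟨μ, y, hy, h⟩ := exists_energyGap_neg (d := d) hd hβ hb hab (max κ 0)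
  exact ⟨μ, y, (le_max_right _ _).trans_lt hy, ((le_max_left _ _).trans_lt hy).le, h⟩

lemma transitionPotential_le (hd : 1 ≤ d) (hβ : 0 < β) (hb : 0 < b) (hab : b < a) {κ μ y : ℝ}
    (hy : 0 < y) (hκ : κ ≤ y) (h : energyGap d β a b μ y < 0) :
    transitionPotential d β a b κ ≤ μ :=
  csInf_le ⟨muT d β a b, fun _ ⟨_, hz, _, hneg⟩ => muT_le_of_energyGap_neg hd hβ hb hab hz hneg⟩
    ⟨y, hy, hκ, h⟩

lemma le_transitionPotential (hd : 1 ≤ d) (hβ : 0 < β) (hb : 0 < b) (hab : b < a) {κ c : ℝ}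
    (h : ∀ μ y, 0 < y → κ ≤ y → energyGap d β a b μ y < 0 → c ≤ μ) :
    c ≤ transitionPotential d β a b κ :=
  le_csInf (nonempty_setOf_energyGap_neg hd hβ hb hab κ)
    fun μ ⟨y, hy, hκ, hneg⟩ => h μ y hy hκ hneg

lemma muT_le_transitionPotential (hd : 1 ≤ d) (hβ : 0 < β) (hb : 0 < b) (hab : b < a) (κ : ℝ) :
    muT d β a b ≤ transitionPotential d β a b κ :=
  le_transitionPotential hd hβ hb hab fun _ _ hy _ => muT_le_of_energyGap_neg hd hβ hb hab hy

lemma transitionPotential_mono (hd : 1 ≤ d) (hβ : 0 < β) (hb : 0 < b) (hab : b < a) :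
    Monotone (transitionPotential d β a b) := fun _ _ hκ =>
  le_transitionPotential hd hβ hb hab fun _ _ hy hκy =>
    transitionPotential_le hd hβ hb hab hy (hκ.trans hκy)

lemma energyGap_pos_of_lt_transitionPotential (hd : 1 ≤ d) (hβ : 0 < β) (hb : 0 < b)
    (hab : b < a) {κ μ y : ℝ} (hμ : μ < transitionPotential d β a b κ) (hy : 0 < y) (hκ : κ ≤ y) :
    0 < energyGap d β a b μ y := by
  by_contra! hgap
  obtain ⟨ν, hμν, hν⟩ := exists_between hμ
  exact (transitionPotential_le hd hβ hb hab hy hκ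
    (energyGap_neg_of_lt hd hβ (hb.trans hab) hb hy hgap hμν)).not_gt hν

lemma energyGap_transitionPotential_nonneg (hd : 1 ≤ d) (hβ : 0 < β) (hb : 0 < b) (hab : b < a)
    {κ y : ℝ} (hy : 0 < y) (hκ : κ ≤ y) :
    0 ≤ energyGap d β a b (transitionPotential d β a b κ) y := by
  have hlim : Tendsto (fun μ => energyGap d β a b μ y) (𝓝[<] transitionPotential d β a b κ)
      (𝓝 (energyGap d β a b (transitionPotential d β a b κ) y)) :=
    (continuous_energyGap_left hd hβ (hb.trans hab) y).continuousWithinAt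
  refine ge_of_tendsto hlim ?_
  filter_upwards [self_mem_nhdsWithin] with ν hν
  exact (energyGap_pos_of_lt_transitionPotential hd hβ hb hab hν hy hκ).le

lemma exists_energyGap_neg_of_transitionPotential_lt (hd : 1 ≤ d) (hβ : 0 < β) (hb : 0 < b)
    (hab : b < a) {κ μ : ℝ} (hμ : transitionPotential d β a b κ < μ) :
    ∃ y, 0 < y ∧ κ ≤ y ∧ energyGap d β a b μ y < 0 := by
  obtain ⟨ν, ⟨y, hy, hκy, h⟩, hν⟩ :=
    exists_lt_of_csInf_lt (nonempty_setOf_energyGap_neg hd hβ hb hab κ) hμ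
  exact ⟨y, hy, hκy, (energyGap_anti hd hβ (hb.trans hab) hy.le hν.le).trans_lt h⟩

lemma isEquilibrium_zero_of_lt_transitionPotential (hd : 1 ≤ d) (hβ : 0 < β) (hb : 0 < b)
    (hab : b < a) {κ μ : ℝ} (hκ : 0 ≤ κ) (hμ : μ < transitionPotential d β a b κ) :
    IsEquilibrium d β a b (ENNReal.ofReal κ) μ 0 := by
  refine ⟨isLongDensity_zero _, fun z hz hne => ?_⟩
  rw [energyGap_zero]
  exact energyGap_pos_of_lt_transitionPotential hd hβ hb hab hμ (hz.1.lt_of_ne' hne)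
    (((isLongDensity_ofReal_iff hκ).1 hz).resolve_left hne)

lemma energyGap_yTwo_neg (hd : 1 ≤ d) (hβ : 0 < β) (hb : 0 < b) (hab : b < a) {μ : ℝ}
    (hμ : transitionPotential d β a b 0 < μ) :
    energyGap d β a b μ (yTwo d β a b μ) < 0 := by
  obtain ⟨y, hy, -, hneg⟩ := exists_energyGap_neg_of_transitionPotential_lt hd hβ hb hab hμ
  have hμt := (muT_le_transitionPotential (d := d) hd hβ hb hab 0).trans hμ.le
  rcases eq_or_ne y (yTwo d β a b μ) with rfl | hne
  · exact hneg
  · rcases energyGap_trichotomy hd hβ hb hab hμt hy.le hne with h | h | h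
    · exact absurd h hy.ne'
    · exact absurd hneg h.not_gt
    · exact h.trans hneg

lemma isEquilibrium_yTwo (hd : 1 ≤ d) (hβ : 0 < β) (hb : 0 < b) (hab : b < a) {κ : ℝ≥0∞} {μ : ℝ}
    (hμ : transitionPotential d β a b 0 < μ) (hy : IsLongDensity κ (yTwo d β a b μ)) :
    IsEquilibrium d β a b κ μ (yTwo d β a b μ) := by
  have hμt := (muT_le_transitionPotential (d := d) hd hβ hb hab 0).trans hμ.le
  have hneg := energyGap_yTwo_neg hd hβ hb hab hμ
  refine ⟨hy, fun z hz hne => ?_⟩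
  rcases energyGap_trichotomy hd hβ hb hab hμt hz.1 hne with h | h | h
  · rwa [h, energyGap_zero]
  · exact hneg.trans h
  · exact h

lemma tendsto_energyGap_yTwo_nhdsGE (hd : 1 ≤ d) (hβ : 0 < β) (hb : 0 < b) (hab : b < a) {μ : ℝ}
    (hμ : muT d β a b ≤ μ) :
    Tendsto (fun ν => energyGap d β a b ν (yTwo d β a b ν)) (𝓝[≥] μ)
      (𝓝 (energyGap d β a b μ (yTwo d β a b μ))) := by
  have hpair : Tendsto (fun ν => (ν, yTwo d β a b ν)) (𝓝[≥] μ) (𝓝 (μ, yTwo d β a b μ)) :=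
    (tendsto_id.mono_left nhdsWithin_le_nhds).prodMk_nhds (tendsto_yTwo_nhdsGE hβ hb hab hμ)
  have hgap := ((continuous_energyGap (d := d) (b := b) hd hβ (hb.trans hab)).tendsto'
    (μ, yTwo d β a b μ) (energyGap d β a b μ (yTwo d β a b μ)) rfl).comp hpair
  simpa only [Function.comp_def] using hgap

lemma energyGap_yTwo_transitionPotential (hd : 1 ≤ d) (hβ : 0 < β) (hb : 0 < b) (hab : b < a) :
    energyGap d β a b (transitionPotential d β a b 0)
      (yTwo d β a b (transitionPotential d β a b 0)) = 0 := by
  have hμt := muT_le_transitionPotential (d := d) hd hβ hb hab 0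
  refine le_antisymm ?_ ?_
  · refine le_of_tendsto ((tendsto_energyGap_yTwo_nhdsGE hd hβ hb hab hμt).mono_left
      (nhdsWithin_mono _ Set.Ioi_subset_Ici_self)) ?_
    filter_upwards [self_mem_nhdsWithin] with μ hμ
    exact (energyGap_yTwo_neg hd hβ hb hab hμ).le
  · rcases (yTwo_nonneg (d := d) hβ hb hab hμt).eq_or_lt with h | h
    · rw [← h, energyGap_zero]
    · exact energyGap_transitionPotential_nonneg hd hβ hb hab h h.le

lemma energyGap_transitionPotential_pos (hd : 1 ≤ d) (hβ : 0 < β) (hb : 0 < b) (hab : b < a)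
    {y : ℝ} (hy : 0 < y) (hne : y ≠ yTwo d β a b (transitionPotential d β a b 0)) :
    0 < energyGap d β a b (transitionPotential d β a b 0) y := by
  have hμt := muT_le_transitionPotential (d := d) hd hβ hb hab 0
  rcases energyGap_trichotomy hd hβ hb hab hμt hy.le hne with h | h | h
  · exact absurd h hy.ne'
  · exact h
  · rwa [energyGap_yTwo_transitionPotential hd hβ hb hab] at h

lemma isEquilibrium_zero_transitionPotential (hd : 1 ≤ d) (hβ : 0 < β) (hb : 0 < b) (hab : b < a)
    (h0 : yTwo d β a b (transitionPotential d β a b 0) = 0) (κ : ℝ≥0∞) :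
    IsEquilibrium d β a b κ (transitionPotential d β a b 0) 0 := by
  refine ⟨isLongDensity_zero _, fun z hz hne => ?_⟩
  rw [energyGap_zero]
  exact energyGap_transitionPotential_pos hd hβ hb hab (hz.1.lt_of_ne' hne) (by rwa [h0])

lemma xOne_sub_mul_yTwo (hβ : 0 < β) (hb : 0 < b) (hab : b < a) {μ : ℝ} (hμ : muT d β a b ≤ μ) :
    xOne d β a (μ - a * yTwo d β a b μ) = xTwo d β a b μ := by
  rw [sub_mul_yTwo hβ hb hab hμ, xTwo_eq hβ hb hab hμ]

lemma rateZeroes_of_lt_transitionPotential (hd : 1 ≤ d) (hβ : 0 < β) (hb : 0 < b) (hab : b < a)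
    {κ μ : ℝ} (hκ : 0 ≤ κ) (hμ : μ < transitionPotential d β a b κ) :
    rateZeroes d β a b (ENNReal.ofReal κ) μ = {(xOne d β a μ, 0)} := by
  simpa only [mul_zero, sub_zero] using
    (isEquilibrium_zero_of_lt_transitionPotential hd hβ hb hab hκ hμ).rateZeroes_eq hd hβ
      (hb.trans hab)

lemma rateZeroes_of_transitionPotential_lt (hd : 1 ≤ d) (hβ : 0 < β) (hb : 0 < b) (hab : b < a)
    {κ : ℝ≥0∞} {μ : ℝ} (hμ : transitionPotential d β a b 0 < μ)
    (hy : IsLongDensity κ (yTwo d β a b μ)) :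
    rateZeroes d β a b κ μ = {(xTwo d β a b μ, yTwo d β a b μ)} := by
  rw [(isEquilibrium_yTwo hd hβ hb hab hμ hy).rateZeroes_eq hd hβ (hb.trans hab),
    xOne_sub_mul_yTwo hβ hb hab ((muT_le_transitionPotential hd hβ hb hab 0).trans hμ.le)]

lemma rateZeroes_transitionPotential_zero (hd : 1 ≤ d) (hβ : 0 < β) (hb : 0 < b) (hab : b < a)
    {κ : ℝ≥0∞} (hy : IsLongDensity κ (yTwo d β a b (transitionPotential d β a b 0))) :
    rateZeroes d β a b κ (transitionPotential d β a b 0) =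
      {(xOne d β a (transitionPotential d β a b 0), 0),
        (xTwo d β a b (transitionPotential d β a b 0),
          yTwo d β a b (transitionPotential d β a b 0))} := by
  rw [rateZeroes_eq_pair hd hβ (hb.trans hab) hy
      (energyGap_yTwo_transitionPotential hd hβ hb hab) fun z hz h0 hne =>
        energyGap_transitionPotential_pos hd hβ hb hab (hz.1.lt_of_ne' h0) hne,
    xOne_sub_mul_yTwo hβ hb hab (muT_le_transitionPotential hd hβ hb hab 0)]

lemma muC_le_coe_iff (hβ : 0 < β) (ha : 0 < a) {u : ℝ} :
    muC d β a ≤ (u : EReal) ↔ stationarySlope d β a u = 0 := by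
  rw [stationarySlope_eq_zero_iff hβ ha, muC]
  by_cases hd : 3 ≤ d
  · rw [criticalDensity_of_three_le hd, ← EReal.coe_mul, EReal.coe_le_coe_iff,
      EReal.coe_le_coe_iff, le_div_iff₀' ha]
  · simp [criticalDensity_of_lt_three (not_le.1 hd), EReal.coe_mul_top_of_pos ha]

lemma transitionPotential_le_muC (hd : 1 ≤ d) (hβ : 0 < β) (hb : 0 < b) (hab : b < a) :
    ((transitionPotential d β a b 0 : ℝ) : EReal) ≤ muC d β a := by
  have ha : 0 < a := hb.trans hab
  by_contra! hcon
  obtain ⟨u, hcu, huμ⟩ := EReal.lt_iff_exists_real_btwn.1 hcon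
  obtain ⟨ν, huν, hν⟩ := exists_between (EReal.coe_lt_coe_iff.1 huμ)
  have hy : 0 < (ν - u) / a := div_pos (sub_pos.2 huν) ha
  have hslope : stationarySlope d β a (ν - a * ((ν - u) / a)) = 0 := by
    rw [mul_div_cancel₀ _ ha.ne', sub_sub_cancel]
    exact (muC_le_coe_iff hβ ha).1 hcu.le
  have hgap := energyGap_of_stationarySlope_eq_zero (b := b) hβ ha hy.le hslope
  have hpos := energyGap_pos_of_lt_transitionPotential hd hβ hb hab hν hy hy.le
  have hsq : 0 < b / 2 * ((ν - u) / a) ^ 2 := by positivity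
  linarith

lemma transitionPotential_eq_muC_iff (hd : 1 ≤ d) (hβ : 0 < β) (hb : 0 < b) (hab : b < a) :
    ((transitionPotential d β a b 0 : ℝ) : EReal) = muC d β a ↔
      stationarySlope d β a (transitionPotential d β a b 0) = 0 := by
  rw [← muC_le_coe_iff hβ (hb.trans hab)]
  exact ⟨fun h => h.ge, fun h => le_antisymm (transitionPotential_le_muC hd hβ hb hab) h⟩

lemma yTwo_eq_zero_iff (hβ : 0 < β) (hb : 0 < b) (hab : b < a) {μ : ℝ} (hμ : muT d β a b ≤ μ) :
    yTwo d β a b μ = 0 ↔ minStationaryPoint d β a b μ = μ := by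
  rw [← sub_mul_yTwo hβ hb hab hμ, sub_eq_self, mul_eq_zero, or_iff_right (hb.trans hab).ne']

lemma yTwo_transitionPotential_eq_zero_iff (hd : 1 ≤ d) (hβ : 0 < β) (hb : 0 < b) (hab : b < a) :
    yTwo d β a b (transitionPotential d β a b 0) = 0 ↔
      stationarySlope d β a (transitionPotential d β a b 0) = 0 := by
  have ha : 0 < a := hb.trans hab
  have hμt := muT_le_transitionPotential (d := d) hd hβ hb hab 0
  set μs := transitionPotential d β a b 0
  have hlevel := stationaryLevel_minStationaryPoint hβ hb hab hμt
  constructor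
  · intro h
    rw [(yTwo_eq_zero_iff hβ hb hab hμt).1 h, stationaryLevel, sub_eq_self, mul_eq_zero] at hlevel
    exact hlevel.resolve_left (div_pos ha hb).ne'
  · intro h
    by_contra hne
    have hpos := (yTwo_nonneg (d := d) hβ hb hab hμt).lt_of_ne' hne
    have hlt : energyGap d β a b μs (yTwo d β a b μs) < energyGap d β a b μs 0 := by
      refine energyGap_lt_of_stationaryLevel_lt hd hβ ha hb hpos fun z hz => ?_
      have hleft : minStationaryPoint d β a b μs < μs - a * z := by
        rw [← sub_mul_yTwo hβ hb hab hμt]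
        gcongr
        exact hz.2
      have hright : μs - a * z < μs := sub_lt_self _ (mul_pos ha hz.1)
      simpa only [hlevel, stationaryLevel_of_stationarySlope_eq_zero h, max_self] using
        stationaryLevel_lt_max (d := d) hβ ha hb hleft hright
    rw [energyGap_yTwo_transitionPotential hd hβ hb hab, energyGap_zero] at hlt
    exact hlt.false

lemma isTransitionZero_transitionPotential (hd : 1 ≤ d) (hβ : 0 < β) (hb : 0 < b)
    (hab : b < a) : IsTransitionZero d β a b (transitionPotential d β a b 0) := by
  have hμt := muT_le_transitionPotential (d := d) hd hβ hb hab 0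
  refine ⟨hμt, transitionPotential_le_muC hd hβ hb hab, fun μ => ⟨fun h => ?_, ?_, fun h => ?_⟩⟩
  · simpa only [ENNReal.ofReal_zero] using
      rateZeroes_of_lt_transitionPotential hd hβ hb hab le_rfl h
  · rintro rfl
    exact rateZeroes_transitionPotential_zero hd hβ hb hab
      (isLongDensity_zero_iff.2 (yTwo_nonneg hβ hb hab hμt))
  · exact rateZeroes_of_transitionPotential_lt hd hβ hb hab h
      (isLongDensity_zero_iff.2 (yTwo_nonneg hβ hb hab (hμt.trans h.le)))

/-! ### The order of the transition -/

lemma idealPressureSecondAtZero_le_iff (hβ : 0 < β) {c : ℝ} :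
    idealPressureSecondAtZero d β ≤ (c : EReal) ↔ ∀ s < 0, β * cycleMoment d β 2 s ≤ c := by
  rw [idealPressureSecondAtZero]
  constructor
  · intro h s hs
    refine le_of_forall_gt_imp_ge_of_dense fun c' hc' => ?_
    obtain ⟨t, hlt, hst, ht⟩ := ((eventually_lt_of_limsup_lt
      (h.trans_lt (EReal.coe_lt_coe_iff.2 hc'))).and (Ioo_mem_nhdsLT hs)).exists
    rw [iteratedDeriv_two_idealPressure hβ ht, EReal.coe_lt_coe_iff] at hlt
    exact (mul_lt_mul_of_pos_left (strictMonoOn_cycleMoment hβ 2 hs ht hst) hβ).le.trans hlt.le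
  · intro h
    refine limsup_le_of_le (by isBoundedDefault) ?_
    filter_upwards [self_mem_nhdsWithin] with s hs
    rw [iteratedDeriv_two_idealPressure hβ hs]
    exact EReal.coe_le_coe_iff.2 (h s hs)

lemma level_slope_nonpos_of_stationarySlope_transitionPotential_eq_zero (hd : 1 ≤ d) (hβ : 0 < β)
    (hb : 0 < b) (hab : b < a) (h0 : stationarySlope d β a (transitionPotential d β a b 0) = 0)
    {s : ℝ} (hs : s < 0) : a * (β * cycleMoment d β 2 s) - (a - b) / b ≤ 0 := by
  have ha : 0 < a := hb.trans hab
  have hμt := muT_le_transitionPotential (d := d) hd hβ hb hab 0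
  have hy := (yTwo_transitionPotential_eq_zero_iff hd hβ hb hab).2 h0
  set μs := transitionPotential d β a b 0
  by_contra! hpos
  have hslope := stationarySlope_add_mul_cycleMoment (d := d) hβ ha hs
  set u := s + a * cycleMoment d β 1 s
  have hlevel := stationaryLevel_add_mul_lt (v := μs) hβ ha hb (hslope.trans_lt hs)
    (by rw [h0, hslope]; exact hs.ne')
  rw [hslope, h0, stationaryLevel_of_stationarySlope_eq_zero h0] at hlevel
  have hle : minStationaryPoint d β a b μs ≤ u :=
    minStationaryPoint_le hβ hb hab (by nlinarith)
  rw [(yTwo_eq_zero_iff hβ hb hab hμt).1 hy] at hle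
  have hmono := stationarySlope_mono (d := d) hβ ha hle
  linarith

lemma stationarySlope_transitionPotential_eq_zero_of_level_slope_nonpos (hd : 1 ≤ d)
    (hβ : 0 < β) (hb : 0 < b) (hab : b < a)
    (hD : ∀ s < 0, a * (β * cycleMoment d β 2 s) - (a - b) / b ≤ 0) :
    stationarySlope d β a (transitionPotential d β a b 0) = 0 := by
  have ha : 0 < a := hb.trans hab
  have hμt := muT_le_transitionPotential (d := d) hd hβ hb hab 0
  set μs := transitionPotential d β a b 0
  by_contra hne
  have hneg := (stationarySlope_nonpos (d := d) hβ ha μs).lt_of_ne hne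
  have hm := stationaryLevel_minStationaryPoint hβ hb hab hμt
  have hle : minStationaryPoint d β a b μs ≤ μs := by
    have := mul_nonneg ha.le (yTwo_nonneg (d := d) hβ hb hab hμt)
    linarith [sub_mul_yTwo hβ hb hab hμt]
  have hlt : μs < stationaryLevel d β a b μs := by
    rw [stationaryLevel]
    linarith [mul_neg_of_pos_of_neg (div_pos ha hb) hneg]
  have hslope : stationarySlope d β a (minStationaryPoint d β a b μs) <
      stationarySlope d β a μs :=
    stationarySlope_lt hβ ha (hle.lt_of_ne fun h => by rw [h] at hm; exact hlt.ne' hm)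
      ((stationarySlope_mono hβ ha hle).trans_lt hneg)
  have htangent := stationaryLevel_add_mul_lt (b := b) hβ ha hb hneg hslope.ne
  rw [hm] at htangent
  linarith [mul_nonneg_of_nonpos_of_nonpos (hD _ hneg) (sub_nonpos.2 hslope.le)]

/-- As a function of the slope `s < 0`, the stationary level is `a p₀'(s) - ((a - b)/b) s`; the
right-hand side says that it decreases up to `s = 0`. -/
lemma transitionPotential_eq_muC_iff_second (hd : 1 ≤ d) (hβ : 0 < β) (hb : 0 < b)
    (hab : b < a) : ((transitionPotential d β a b 0 : ℝ) : EReal) = muC d β a ↔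
      idealPressureSecondAtZero d β ≤ (((a - b) / (a * b) : ℝ) : EReal) := by
  have hcoeff (x : ℝ) : x ≤ (a - b) / (a * b) ↔ a * x - (a - b) / b ≤ 0 := by
    rw [sub_nonpos, mul_comm a b, ← div_div, le_div_iff₀' (hb.trans hab)]
  simp only [idealPressureSecondAtZero_le_iff hβ, transitionPotential_eq_muC_iff hd hβ hb hab,
    hcoeff]
  exact ⟨fun h0 _ =>
    level_slope_nonpos_of_stationarySlope_transitionPotential_eq_zero hd hβ hb hab h0,
    stationarySlope_transitionPotential_eq_zero_of_level_slope_nonpos hd hβ hb hab⟩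

/-! ### The transition for a positive finite cut-off ratio -/

lemma muR_eq_sInf (hb : 0 < b) (hab : b < a) (κ : ℝ) :
    muR d β a b κ = sInf {s | muT d β a b ≤ s ∧ κ ≤ yTwo d β a b s} := by
  have ha : 0 < a := hb.trans hab
  rw [muR]
  congr! 4 with s
  rw [yTwo, le_div_iff₀ (sub_pos.2 hab), one_div, ← div_eq_inv_mul, le_div_iff₀ ha]
  constructor <;> intro h <;> linarith

lemma exists_le_yTwo (hβ : 0 < β) (hb : 0 < b) (hab : b < a) {κ : ℝ} (hκ : 0 < κ) :
    ∃ μ, muT d β a b ≤ μ ∧ κ ≤ yTwo d β a b μ := by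
  have ha : 0 < a := hb.trans hab
  have hs : -(b * κ) < 0 := neg_neg_of_pos (mul_pos hb hκ)
  set u := -(b * κ) + a * cycleMoment d β 1 (-(b * κ))
  have hlevel : stationaryLevel d β a b u = u + a * κ := by
    rw [stationaryLevel, stationarySlope_add_mul_cycleMoment hβ ha hs]
    field_simp
    ring
  have hμ := hlevel ▸ muT_le_stationaryLevel (d := d) hβ hb hab u
  refine ⟨u + a * κ, hμ, ?_⟩
  rw [yTwo_eq hβ hb hab hμ, le_div_iff₀ ha]
  linarith [minStationaryPoint_le hβ hb hab hlevel.le]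

lemma muR_le (hb : 0 < b) (hab : b < a) {κ μ : ℝ} (hμ : muT d β a b ≤ μ)
    (hκ : κ ≤ yTwo d β a b μ) : muR d β a b κ ≤ μ := by
  rw [muR_eq_sInf hb hab]
  exact csInf_le ⟨muT d β a b, fun s hs => hs.1⟩ ⟨hμ, hκ⟩

lemma muT_le_muR (hβ : 0 < β) (hb : 0 < b) (hab : b < a) {κ : ℝ} (hκ : 0 < κ) :
    muT d β a b ≤ muR d β a b κ := by
  rw [muR_eq_sInf hb hab]
  exact le_csInf (exists_le_yTwo hβ hb hab hκ) fun s hs => hs.1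

lemma le_yTwo_muR (hβ : 0 < β) (hb : 0 < b) (hab : b < a) {κ : ℝ} (hκ : 0 < κ) :
    κ ≤ yTwo d β a b (muR d β a b κ) := by
  refine ge_of_tendsto ((tendsto_yTwo_nhdsGE hβ hb hab (muT_le_muR hβ hb hab hκ)).mono_left
    (nhdsWithin_mono _ Set.Ioi_subset_Ici_self)) ?_
  filter_upwards [self_mem_nhdsWithin] with ν hν
  rw [Set.mem_Ioi, muR_eq_sInf hb hab] at hν
  obtain ⟨s, ⟨hs, hκs⟩, hsν⟩ := exists_lt_of_csInf_lt (exists_le_yTwo hβ hb hab hκ) hν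
  exact hκs.trans (yTwo_mono hβ hb hab hs hsν.le)

lemma le_yTwo_of_muR_le (hβ : 0 < β) (hb : 0 < b) (hab : b < a) {κ μ : ℝ} (hκ : 0 < κ)
    (hμ : muR d β a b κ ≤ μ) : κ ≤ yTwo d β a b μ :=
  (le_yTwo_muR hβ hb hab hκ).trans (yTwo_mono hβ hb hab (muT_le_muR hβ hb hab hκ) hμ)

lemma yTwo_lt_of_lt_muR (hb : 0 < b) (hab : b < a) {κ μ : ℝ}
    (hμ : muT d β a b ≤ μ) (h : μ < muR d β a b κ) : yTwo d β a b μ < κ := by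
  by_contra! hκ
  exact (muR_le hb hab hμ hκ).not_gt h

lemma exists_stationaryLevel_lt (hβ : 0 < β) (hb : 0 < b) (hab : b < a) {μ u : ℝ}
    (hμ : muT d β a b < μ) (hu : minStationaryPoint d β a b μ < u) :
    ∃ v < u, stationaryLevel d β a b v < μ := by
  have hm := stationaryLevel_minStationaryPoint hβ hb hab hμ.le
  obtain ⟨w, hw⟩ := exists_stationaryLevel_eq_muT (d := d) hβ hb hab
  have hmw : minStationaryPoint d β a b μ < w := by
    refine (minStationaryPoint_le hβ hb hab (hw.trans_le hμ.le)).lt_of_ne ?_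
    rintro rfl
    exact hμ.ne' (hm.symm.trans hw)
  obtain ⟨v, hmv, hv⟩ := exists_between (lt_min hu hmw)
  refine ⟨v, hv.trans_le (min_le_left _ _), ?_⟩
  have hmax := stationaryLevel_lt_max (d := d) hβ (hb.trans hab) hb hmv
    (hv.trans_le (min_le_right _ _))
  rwa [hm, hw, max_eq_left hμ.le] at hmax

lemma yTwo_muR (hβ : 0 < β) (hb : 0 < b) (hab : b < a) {κ : ℝ} (hκ : 0 < κ)
    (h : muT d β a b < muR d β a b κ) : yTwo d β a b (muR d β a b κ) = κ := by
  have ha : 0 < a := hb.trans hab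
  refine le_antisymm ?_ (le_yTwo_muR hβ hb hab hκ)
  by_contra! hlt
  have hm : minStationaryPoint d β a b (muR d β a b κ) < muR d β a b κ - a * κ := by
    rw [← sub_mul_yTwo hβ hb hab h.le]
    gcongr
  obtain ⟨v, hv, hlevel⟩ := exists_stationaryLevel_lt hβ hb hab h hm
  obtain ⟨μ, hμ, hμr⟩ := exists_between (max_lt (max_lt hlevel h) (lt_sub_iff_add_lt.1 hv))
  simp only [max_lt_iff] at hμ
  obtain ⟨⟨hvμ, hμt⟩, hκμ⟩ := hμ
  have hy := yTwo_lt_of_lt_muR hb hab hμt.le hμr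
  rw [yTwo_eq hβ hb hab hμt.le, div_lt_iff₀ ha] at hy
  linarith [minStationaryPoint_le hβ hb hab hvμ.le]

lemma energyGap_lt_of_le_muR (hd : 1 ≤ d) (hβ : 0 < β) (hb : 0 < b) (hab : b < a) {κ μ y : ℝ}
    (hκ : 0 < κ) (hμ : muT d β a b ≤ μ) (htr : muT d β a b < muR d β a b κ)
    (hμr : μ ≤ muR d β a b κ) (hy : κ < y) :
    energyGap d β a b μ κ < energyGap d β a b μ y := by
  refine energyGap_lt_of_yTwo_le hd hβ hb hab hμ ?_ hy
  rcases hμr.lt_or_eq with h | rfl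
  · exact (yTwo_lt_of_lt_muR hb hab hμ h).le
  · exact (yTwo_muR hβ hb hab hκ htr).le

lemma transitionPotential_eq_of_muR_le (hd : 1 ≤ d) (hβ : 0 < β) (hb : 0 < b) (hab : b < a)
    {κ : ℝ} (hκ : 0 < κ) (h : muR d β a b κ ≤ transitionPotential d β a b 0) :
    transitionPotential d β a b κ = transitionPotential d β a b 0 := by
  refine le_antisymm (le_of_forall_gt_imp_ge_of_dense fun μ hμ => ?_)
    (transitionPotential_mono hd hβ hb hab hκ.le)
  have hy := le_yTwo_of_muR_le (d := d) hβ hb hab hκ (h.trans hμ.le)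
  exact transitionPotential_le hd hβ hb hab (hκ.trans_le hy) hy
    (energyGap_yTwo_neg hd hβ hb hab hμ)

lemma transitionPotential_lt_muR (hd : 1 ≤ d) (hβ : 0 < β) (hb : 0 < b) (hab : b < a) {κ : ℝ}
    (hκ : 0 < κ) (h : transitionPotential d β a b 0 < muR d β a b κ) :
    transitionPotential d β a b κ < muR d β a b κ := by
  have hneg := energyGap_yTwo_neg hd hβ hb hab h
  rw [yTwo_muR hβ hb hab hκ ((muT_le_transitionPotential hd hβ hb hab 0).trans_lt h)] at hneg
  obtain ⟨ν, hνgap, hν⟩ := ((((continuous_energyGap_left hd hβ (hb.trans hab) κ).tendsto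
    _).eventually_lt_const hneg).filter_mono nhdsWithin_le_nhds |>.and
      (self_mem_nhdsWithin (s := Set.Iio (muR d β a b κ)))).exists
  exact (transitionPotential_le hd hβ hb hab hκ le_rfl hνgap).trans_lt hν

lemma isEquilibrium_kappa (hd : 1 ≤ d) (hβ : 0 < β) (hb : 0 < b) (hab : b < a) {κ μ : ℝ}
    (hκ : 0 < κ) (hμ : transitionPotential d β a b κ < μ) (hμr : μ ≤ muR d β a b κ) :
    IsEquilibrium d β a b (ENNReal.ofReal κ) μ κ := by
  have hμt := (muT_le_transitionPotential (d := d) hd hβ hb hab κ).trans_lt hμ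
  have hlt : ∀ y, κ < y → energyGap d β a b μ κ < energyGap d β a b μ y := fun y =>
    energyGap_lt_of_le_muR hd hβ hb hab hκ hμt.le (hμt.trans_le hμr) hμr
  refine ⟨(isLongDensity_ofReal_iff hκ.le).2 (Or.inr le_rfl), fun z hz hne => ?_⟩
  rcases (isLongDensity_ofReal_iff hκ.le).1 hz with rfl | h
  · obtain ⟨y, -, hκy, hneg⟩ := exists_energyGap_neg_of_transitionPotential_lt hd hβ hb hab hμ
    rw [energyGap_zero]
    rcases hκy.lt_or_eq with h | rfl
    exacts [(hlt y h).trans hneg, hneg]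
  · exact hlt z (h.lt_of_ne' hne)

lemma energyGap_transitionPotential_kappa (hd : 1 ≤ d) (hβ : 0 < β) (hb : 0 < b) (hab : b < a)
    {κ : ℝ} (hκ : 0 < κ) (h : transitionPotential d β a b κ < muR d β a b κ) :
    energyGap d β a b (transitionPotential d β a b κ) κ = 0 := by
  refine le_antisymm ?_ (energyGap_transitionPotential_nonneg hd hβ hb hab hκ le_rfl)
  have hlim : Tendsto (fun μ => energyGap d β a b μ κ) (𝓝[>] transitionPotential d β a b κ)
      (𝓝 (energyGap d β a b (transitionPotential d β a b κ) κ)) :=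
    (continuous_energyGap_left hd hβ (hb.trans hab) κ).continuousWithinAt
  refine le_of_tendsto hlim ?_
  filter_upwards [Ioo_mem_nhdsGT h] with ν hν
  simpa only [energyGap_zero] using ((isEquilibrium_kappa hd hβ hb hab hκ hν.1 hν.2.le).2 0
    (isLongDensity_zero _) hκ.ne).le

lemma transitionPotential_zero_lt (hd : 1 ≤ d) (hβ : 0 < β) (hb : 0 < b) (hab : b < a) {κ : ℝ}
    (hκ : 0 < κ) (h : transitionPotential d β a b 0 < muR d β a b κ) :
    transitionPotential d β a b 0 < transitionPotential d β a b κ := by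
  refine (transitionPotential_mono hd hβ hb hab hκ.le).lt_of_ne fun heq => ?_
  have hpos := energyGap_transitionPotential_pos hd hβ hb hab hκ
    (yTwo_lt_of_lt_muR hb hab (muT_le_transitionPotential hd hβ hb hab 0) h).ne'
  rw [heq, energyGap_transitionPotential_kappa hd hβ hb hab hκ (heq ▸ h)] at hpos
  exact hpos.false

lemma rateZeroes_transitionPotential_pos (hd : 1 ≤ d) (hβ : 0 < β) (hb : 0 < b) (hab : b < a)
    {κ : ℝ} (hκ : 0 < κ) (h : transitionPotential d β a b κ < muR d β a b κ) :
    rateZeroes d β a b (ENNReal.ofReal κ) (transitionPotential d β a b κ) =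
      {(xOne d β a (transitionPotential d β a b κ), 0),
        (xThree d β a κ (transitionPotential d β a b κ), κ)} := by
  have hμt := muT_le_transitionPotential (d := d) hd hβ hb hab κ
  have hgap := energyGap_transitionPotential_kappa hd hβ hb hab hκ h
  refine rateZeroes_eq_pair hd hβ (hb.trans hab)
    ((isLongDensity_ofReal_iff hκ.le).2 (Or.inr le_rfl)) hgap fun z hz h0 hne => ?_
  have hκz := ((isLongDensity_ofReal_iff hκ.le).1 hz).resolve_left h0
  exact hgap ▸ energyGap_lt_of_le_muR hd hβ hb hab hκ hμt (hμt.trans_lt h) h.le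
    (hκz.lt_of_ne' hne)

lemma isTransitionPos_transitionPotential (hd : 1 ≤ d) (hβ : 0 < β) (hb : 0 < b)
    (hab : b < a) {κ : ℝ} (hκ : 0 < κ) :
    IsTransitionPos d β a b κ (transitionPotential d β a b 0) (transitionPotential d β a b κ) := by
  have hlong {μ : ℝ} (hμ : muR d β a b κ ≤ μ) :
      IsLongDensity (ENNReal.ofReal κ) (yTwo d β a b μ) :=
    (isLongDensity_ofReal_iff hκ.le).2 (Or.inr (le_yTwo_of_muR_le hβ hb hab hκ hμ))
  refine ⟨transitionPotential_eq_of_muR_le hd hβ hb hab hκ,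
    fun h => ⟨transitionPotential_zero_lt hd hβ hb hab hκ h,
      transitionPotential_lt_muR hd hβ hb hab hκ h⟩,
    fun μ => ⟨rateZeroes_of_lt_transitionPotential hd hβ hb hab hκ.le, ?_, ?_,
      fun h hr => (isEquilibrium_kappa hd hβ hb hab hκ h hr).rateZeroes_eq hd hβ (hb.trans hab),
      fun h hr => rateZeroes_of_transitionPotential_lt hd hβ hb hab
        ((transitionPotential_mono hd hβ hb hab hκ.le).trans_lt h) (hlong hr)⟩⟩
  · rintro rfl hr
    exact rateZeroes_transitionPotential_pos hd hβ hb hab hκ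
      (transitionPotential_lt_muR hd hβ hb hab hκ hr)
  · rintro rfl hr
    rw [transitionPotential_eq_of_muR_le hd hβ hb hab hκ hr]
    exact rateZeroes_transitionPotential_zero hd hβ hb hab (hlong hr)

end Transition

/-! ### Sums over cycle counts -/

section PoissonProd

variable {ι : Type*} {w : ι → ℝ}

/-- The weight `∏_k w_k^{n_k} / n_k!` of the occupation numbers `n`: up to the factor
`e^{-∑_k w_k}`, the law of independent Poisson variables with means `w_k`. -/
noncomputable def poissonProd (w : ι → ℝ) (n : ι →₀ ℕ) : ℝ :=
  n.prod fun k j => w k ^ j / (j.factorial : ℝ)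

lemma poissonProd_pos (hw : ∀ k, 0 < w k) (n : ι →₀ ℕ) : 0 < poissonProd w n := by
  refine Finset.prod_pos fun k _ => ?_
  have := hw k
  positivity

lemma poissonProd_nonneg (hw : ∀ k, 0 ≤ w k) (n : ι →₀ ℕ) : 0 ≤ poissonProd w n := by
  refine Finset.prod_nonneg fun k _ => ?_
  have := hw k
  positivity

lemma poissonProd_mul_exp (w x : ι → ℝ) (n : ι →₀ ℕ) :
    poissonProd (fun k => w k * Real.exp (x k)) n =
      poissonProd w n * Real.exp (n.sum fun k j => x k * j) := by
  rw [poissonProd, poissonProd, Finsupp.prod, Finsupp.prod, Finsupp.sum, Real.exp_sum,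
    ← Finset.prod_mul_distrib]
  refine Finset.prod_congr rfl fun k _ => ?_
  rw [mul_pow, ← Real.exp_nat_mul, mul_comm ((n k : ℕ) : ℝ) (x k)]
  ring

lemma sum_finsupp_poissonProd (w : ι → ℝ) (A : Finset ι) (t : ι → Finset ℕ) :
    ∑ n ∈ A.finsupp t, poissonProd w n =
      ∏ k ∈ A, ∑ j ∈ t k, w k ^ j / (j.factorial : ℝ) := by
  classical
  rw [Finset.finsupp, Finset.sum_map, Finset.prod_sum]
  exact Finset.sum_congr rfl fun p _ =>
    Finsupp.prod_indicator_index_eq_prod_attach p fun _ _ => by simp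

lemma exists_subset_finsupp_range (S : Finset (ι →₀ ℕ)) :
    ∃ (A : Finset ι) (N : ℕ), S ⊆ A.finsupp fun _ => Finset.range (N + 1) := by
  classical
  refine ⟨S.biUnion Finsupp.support, S.sup fun n => n.support.sup n, fun n hn => ?_⟩
  refine Finset.mem_finsupp_iff.2 ⟨Finset.subset_biUnion_of_mem _ hn, fun k _ => ?_⟩
  rw [Finset.mem_range, Nat.lt_succ_iff]
  by_cases hk : k ∈ n.support
  · exact (Finset.le_sup (f := n) hk).trans
      (Finset.le_sup (f := fun n : ι →₀ ℕ => n.support.sup n) hn)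
  · rw [Finsupp.notMem_support_iff.1 hk]
    exact Nat.zero_le _

lemma sum_poissonProd_le (hw : ∀ k, 0 ≤ w k) (hs : Summable w) (S : Finset (ι →₀ ℕ)) :
    ∑ n ∈ S, poissonProd w n ≤ Real.exp (∑' k, w k) := by
  obtain ⟨A, N, hS⟩ := exists_subset_finsupp_range S
  calc ∑ n ∈ S, poissonProd w n
      ≤ ∑ n ∈ A.finsupp fun _ => Finset.range (N + 1), poissonProd w n :=
        Finset.sum_le_sum_of_subset_of_nonneg hS fun n _ _ => poissonProd_nonneg hw n
    _ = ∏ k ∈ A, ∑ j ∈ Finset.range (N + 1), w k ^ j / (j.factorial : ℝ) :=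
        sum_finsupp_poissonProd w A _
    _ ≤ ∏ k ∈ A, Real.exp (w k) := by
        refine Finset.prod_le_prod (fun k _ => Finset.sum_nonneg fun j _ => ?_)
          fun k _ => Real.sum_le_exp_of_nonneg (hw k) _
        have := hw k
        positivity
    _ = Real.exp (∑ k ∈ A, w k) := (Real.exp_sum _ _).symm
    _ ≤ Real.exp (∑' k, w k) := Real.exp_le_exp.2 (hs.sum_le_tsum A fun k _ => hw k)

end PoissonProd

section LongCycles

/-- The number of particles in cycles of length at least `m`. -/
noncomputable def longCount (m : ℕ) (n : CycleCounts) : ℕ :=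
  n.sum fun k j => if m ≤ (k : ℕ) then (k : ℕ) * j else 0

/-- The term `∑_{k ≥ m} k² λ_k²` of the Hamiltonian. -/
noncomputable def longSquare (V : ℝ) (m : ℕ) (n : CycleCounts) : ℝ :=
  n.sum fun k j => if m ≤ (k : ℕ) then (k : ℝ) ^ 2 * ((j : ℝ) / V) ^ 2 else 0

lemma longCycleDensity_eq_longCount_div (V : ℝ) (m : ℕ) (n : CycleCounts) :
    longCycleDensity V m n = longCount m n / V := by
  rw [longCycleDensity, longCount, Finsupp.sum, Finsupp.sum, Nat.cast_sum, Finset.sum_div]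
  refine Finset.sum_congr rfl fun k _ => ?_
  split_ifs
  · push_cast
    ring
  · simp

lemma longCount_eq_zero_or_le (m : ℕ) (n : CycleCounts) :
    longCount m n = 0 ∨ m ≤ longCount m n := by
  by_cases h : ∃ k ∈ n.support, m ≤ (k : ℕ)
  · obtain ⟨k, hk, hmk⟩ := h
    have hterm : (if m ≤ (k : ℕ) then (k : ℕ) * n k else 0) ≤ longCount m n :=
      Finset.single_le_sum (f := fun k : ℕ+ => if m ≤ (k : ℕ) then (k : ℕ) * n k else 0)
        (fun _ _ => Nat.zero_le _) hk
    rw [if_pos hmk] at hterm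
    have hnk : 0 < n k := Nat.pos_of_ne_zero (Finsupp.mem_support_iff.1 hk)
    exact Or.inr ((hmk.trans (Nat.le_mul_of_pos_right _ hnk)).trans hterm)
  · push Not at h
    exact Or.inl (Finset.sum_eq_zero fun k hk => if_neg (h k hk).not_ge)

lemma longSquare_le_sq {V : ℝ} (hV : 0 ≤ V) (m : ℕ) (n : CycleCounts) :
    longSquare V m n ≤ longCycleDensity V m n ^ 2 := by
  rw [longSquare, longCycleDensity, Finsupp.sum, Finsupp.sum]
  have hnonneg : ∀ k ∈ n.support, 0 ≤ if m ≤ (k : ℕ) then (k : ℝ) * ((n k : ℝ) / V) else 0 :=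
    fun k _ => by split_ifs <;> positivity
  refine le_trans (le_of_eq ?_) (Finset.sum_sq_le_sq_sum_of_nonneg hnonneg)
  refine Finset.sum_congr rfl fun k _ => ?_
  split_ifs <;> ring

lemma particleDensity_sub_longCycleDensity (V : ℝ) (m : ℕ) (n : CycleCounts) :
    particleDensity V n - longCycleDensity V m n =
      n.sum fun k j => if m ≤ (k : ℕ) then 0 else (k : ℝ) * ((j : ℝ) / V) := by
  rw [particleDensity, longCycleDensity, Finsupp.sum, Finsupp.sum, Finsupp.sum,
    ← Finset.sum_sub_distrib]
  refine Finset.sum_congr rfl fun k _ => ?_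
  split_ifs <;> ring

end LongCycles

/-! ### The Gibbs weights -/

section GibbsWeight

variable {d m : ℕ} {β a b V : ℝ}

/-- The density of the Gibbs measure with respect to the counting measure, up to normalisation. The
parameter `α` of the reference measure cancels. -/
noncomputable def gibbsWeight (d : ℕ) (β μ a b V : ℝ) (m : ℕ) (n : CycleCounts) : ℝ :=
  poissonProd (fun k => V * cycleWeight d β k) n *
    Real.exp (β * V * (μ * particleDensity V n - a / 2 * particleDensity V n ^ 2 +
      b / 2 * longSquare V m n))

lemma gibbsWeight_pos (hβ : 0 < β) (hV : 0 < V) (μ : ℝ) (m : ℕ) (n : CycleCounts) :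
    0 < gibbsWeight d β μ a b V m n :=
  mul_pos (poissonProd_pos (fun k => mul_pos hV (cycleWeight_pos hβ k)) n) (Real.exp_pos _)

lemma referenceMass_eq_poissonProd (hV : V ≠ 0) (α : ℝ) (n : CycleCounts) :
    referenceMass d β α V n = Real.exp (-(V * totalCycleWeight d β α)) *
      (poissonProd (fun k => V * cycleWeight d β k) n *
        Real.exp (β * V * (α * particleDensity V n))) := by
  have htilt := poissonProd_mul_exp (fun k => V * cycleWeight d β k) (fun k : ℕ+ => β * α * k) n
  rw [referenceMass]
  congr 1
  refine htilt.trans ?_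
  congr 2
  rw [particleDensity, Finsupp.sum, Finsupp.sum, Finset.mul_sum, Finset.mul_sum]
  refine Finset.sum_congr rfl fun k _ => ?_
  field_simp

lemma referenceMass_nonneg (hβ : 0 < β) (hV : 0 < V) (α : ℝ) (n : CycleCounts) :
    0 ≤ referenceMass d β α V n := by
  rw [referenceMass_eq_poissonProd hV.ne']
  have := poissonProd_pos (fun k => mul_pos hV (cycleWeight_pos (d := d) hβ k)) n
  positivity

lemma referenceMass_mul_exp (hV : V ≠ 0) (α μ : ℝ) (m : ℕ) (n : CycleCounts) :
    referenceMass d β α V n * Real.exp (-(β * hamiltonian α μ a b V m n)) =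
      Real.exp (-(V * totalCycleWeight d β α)) * gibbsWeight d β μ a b V m n := by
  rw [referenceMass_eq_poissonProd hV, gibbsWeight, mul_assoc, mul_assoc, ← Real.exp_add]
  congr 3
  rw [hamiltonian, longSquare]
  ring

instance : DiscreteMeasurableSpace CycleCounts := ⟨fun _ => MeasurableSpace.measurableSet_top⟩

lemma integrable_referenceMeasure (hβ : 0 < β) (hV : 0 < V) (α : ℝ) {f : CycleCounts → ℝ}
    (hf : Summable fun n => referenceMass d β α V n * |f n|) :
    Integrable f (referenceMeasure d β α V) := by
  refine integrable_sum_dirac (fun n => ENNReal.ofReal_ne_top) (hf.congr fun n => ?_)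
  rw [ENNReal.toReal_ofReal (referenceMass_nonneg hβ hV α n), Real.norm_eq_abs]

lemma integral_referenceMeasure (hβ : 0 < β) (hV : 0 < V) (α : ℝ) (f : CycleCounts → ℝ) :
    ∫ n, f n ∂(referenceMeasure d β α V) = ∑' n, referenceMass d β α V n * f n := by
  rw [referenceMeasure, integral_sum_dirac fun n => ENNReal.ofReal_ne_top]
  refine tsum_congr fun n => ?_
  rw [ENNReal.toReal_ofReal (referenceMass_nonneg hβ hV α n), smul_eq_mul]

lemma integrable_exp_hamiltonian (hβ : 0 < β) (hV : 0 < V) (α : ℝ) {μ : ℝ}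
    (hW : Summable (gibbsWeight d β μ a b V m)) :
    Integrable (fun n => Real.exp (-(β * hamiltonian α μ a b V m n)))
      (referenceMeasure d β α V) := by
  refine integrable_referenceMeasure hβ hV α ?_
  simp_rw [abs_of_pos (Real.exp_pos _), referenceMass_mul_exp hV.ne']
  exact hW.mul_left _

lemma integral_exp_hamiltonian (hβ : 0 < β) (hV : 0 < V) (α μ : ℝ) :
    ∫ n, Real.exp (-(β * hamiltonian α μ a b V m n)) ∂(referenceMeasure d β α V) =
      Real.exp (-(V * totalCycleWeight d β α)) * ∑' n, gibbsWeight d β μ a b V m n := by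
  simp_rw [integral_referenceMeasure hβ hV α, referenceMass_mul_exp hV.ne', tsum_mul_left]

lemma tsum_gibbsWeight_pos (hβ : 0 < β) (hV : 0 < V) {μ : ℝ}
    (hW : Summable (gibbsWeight d β μ a b V m)) : 0 < ∑' n, gibbsWeight d β μ a b V m n :=
  hW.tsum_pos (fun n => (gibbsWeight_pos hβ hV μ m n).le) 0 (gibbsWeight_pos hβ hV μ m 0)

lemma isProbabilityMeasure_gibbsMeasure (hβ : 0 < β) (hV : 0 < V) (α : ℝ) {μ : ℝ}
    (hW : Summable (gibbsWeight d β μ a b V m)) :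
    IsProbabilityMeasure (gibbsMeasure d β α μ a b V m) := by
  have : NeZero (referenceMeasure d β α V) := ⟨fun hzero => by
    have hint := integral_exp_hamiltonian (d := d) (m := m) (a := a) (b := b) hβ hV α μ
    rw [hzero, integral_zero_measure] at hint
    exact (mul_pos (Real.exp_pos _) (tsum_gibbsWeight_pos hβ hV hW)).ne hint⟩
  exact isProbabilityMeasure_tilted (integrable_exp_hamiltonian hβ hV α hW)

lemma integrable_gibbsMeasure (hβ : 0 < β) (hV : 0 < V) (α : ℝ) {μ : ℝ}
    (hW : Summable (gibbsWeight d β μ a b V m)) {f : CycleCounts → ℝ}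
    (hf : Summable fun n => gibbsWeight d β μ a b V m n * |f n|) :
    Integrable f (gibbsMeasure d β α μ a b V m) := by
  rw [gibbsMeasure, integrable_tilted_iff (integrable_exp_hamiltonian hβ hV α hW)]
  refine integrable_referenceMeasure hβ hV α
    ((hf.mul_left (Real.exp (-(V * totalCycleWeight d β α)))).congr fun n => ?_)
  rw [smul_eq_mul, abs_mul, abs_of_pos (Real.exp_pos _), ← mul_assoc, ← mul_assoc,
    referenceMass_mul_exp hV.ne']

lemma integral_gibbsMeasure (hβ : 0 < β) (hV : 0 < V) (α μ : ℝ) (f : CycleCounts → ℝ) :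
    ∫ n, f n ∂(gibbsMeasure d β α μ a b V m) =
      (∑' n, gibbsWeight d β μ a b V m n * f n) / ∑' n, gibbsWeight d β μ a b V m n := by
  rw [gibbsMeasure, integral_tilted, integral_exp_hamiltonian hβ hV α μ]
  simp_rw [smul_eq_mul, div_mul_eq_mul_div]
  rw [integral_div, integral_referenceMeasure hβ hV α]
  simp_rw [← mul_assoc, referenceMass_mul_exp hV.ne', mul_assoc]
  rw [tsum_mul_left, mul_div_mul_left _ _ (Real.exp_pos _).ne']

end GibbsWeight

/-! ### Upper bounds on the Gibbs weights -/

section UpperBound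

variable {d : ℕ} {β a b V : ℝ}

/-- The total weight `∑_{k ≥ m} q_k` of the long cycles. -/
noncomputable def longWeight (d : ℕ) (β : ℝ) (m : ℕ) : ℝ :=
  ∑' k : ℕ+, if m ≤ (k : ℕ) then cycleWeight d β k else 0

lemma summable_longWeight (hd : 1 ≤ d) (hβ : 0 < β) (m : ℕ) :
    Summable fun k : ℕ+ => if m ≤ (k : ℕ) then cycleWeight d β k else 0 :=
  (((summable_cycleWeight_iff hβ).2 hd).indicator {k : ℕ+ | m ≤ (k : ℕ)}).congr fun k => by
    simp only [Set.indicator_apply, Set.mem_ofPred_eq]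

lemma tendsto_longWeight (hd : 1 ≤ d) (hβ : 0 < β) :
    Tendsto (longWeight d β) atTop (𝓝 0) := by
  have hlim := tendsto_tsum_of_dominated_convergence (𝓕 := atTop)
    (f := fun (m : ℕ) (k : ℕ+) => if m ≤ (k : ℕ) then cycleWeight d β k else 0)
    (g := fun _ => 0) ((summable_cycleWeight_iff hβ).2 hd) (fun k => ?_)
    (Eventually.of_forall fun m k => ?_)
  · rwa [tsum_zero] at hlim
  · refine tendsto_const_nhds.congr' ?_
    filter_upwards [eventually_gt_atTop (k : ℕ)] with m hm
    rw [if_neg hm.not_ge]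
  · have := (cycleWeight_pos (d := d) hβ k).le
    split_ifs
    · rw [Real.norm_of_nonneg this]
    · rwa [norm_zero]

/-- The Poisson means `V q_k`, tilted by `e^{βsk}` on the cycles shorter than `m` only: the weight
of the long cycles is negligible, so they need no tilt. -/
noncomputable def tiltedWeight (d : ℕ) (β V : ℝ) (m : ℕ) (s : ℝ) (k : ℕ+) : ℝ :=
  V * cycleWeight d β k * Real.exp (if m ≤ (k : ℕ) then 0 else β * s * k)

lemma tiltedWeight_nonneg (hβ : 0 < β) (hV : 0 < V) (m : ℕ) (s : ℝ) (k : ℕ+) :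
    0 ≤ tiltedWeight d β V m s k := by
  have := cycleWeight_pos (d := d) hβ k
  unfold tiltedWeight
  positivity

lemma tiltedWeight_le (hβ : 0 < β) (hV : 0 < V) (m : ℕ) (s : ℝ) (k : ℕ+) :
    tiltedWeight d β V m s k ≤ V * (cycleWeight d β k * Real.exp (β * s * k) +
      if m ≤ (k : ℕ) then cycleWeight d β k else 0) := by
  have := cycleWeight_pos (d := d) hβ k
  have hshort : 0 ≤ V * (cycleWeight d β k * Real.exp (β * s * k)) := by positivity
  unfold tiltedWeight
  split_ifs
  · rw [Real.exp_zero]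
    linarith
  · rw [add_zero, mul_assoc]

lemma summable_tiltedWeight (hd : 1 ≤ d) (hβ : 0 < β) (hV : 0 < V) (m : ℕ) {s : ℝ}
    (hs : s ≤ 0) : Summable (tiltedWeight d β V m s) :=
  Summable.of_nonneg_of_le (tiltedWeight_nonneg hβ hV m s) (tiltedWeight_le hβ hV m s)
    (((summable_cycleWeight_mul_exp hd hβ hs).add (summable_longWeight hd hβ m)).mul_left V)

lemma tsum_tiltedWeight_le (hd : 1 ≤ d) (hβ : 0 < β) (hV : 0 < V) (m : ℕ) {s : ℝ}
    (hs : s ≤ 0) : ∑' k, tiltedWeight d β V m s k ≤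
      V * (β * idealPressure d β s + longWeight d β m) := by
  have hshort := summable_cycleWeight_mul_exp hd hβ hs
  have hlong := summable_longWeight hd hβ m
  refine ((summable_tiltedWeight hd hβ hV m hs).tsum_le_tsum (tiltedWeight_le hβ hV m s)
    ((hshort.add hlong).mul_left V)).trans_eq ?_
  rw [tsum_mul_left, hshort.tsum_add hlong, idealPressure_eq_tsum_cycleWeight,
    mul_inv_cancel_left₀ hβ.ne', longWeight]

lemma poissonProd_tiltedWeight (hV : V ≠ 0) (m : ℕ) (s : ℝ) (n : CycleCounts) :
    poissonProd (tiltedWeight d β V m s) n =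
      poissonProd (fun k => V * cycleWeight d β k) n *
        Real.exp (β * V * (s * (particleDensity V n - longCycleDensity V m n))) := by
  refine (poissonProd_mul_exp (fun k => V * cycleWeight d β k)
    (fun k : ℕ+ => if m ≤ (k : ℕ) then 0 else β * s * k) n).trans ?_
  congr 2
  rw [particleDensity_sub_longCycleDensity, Finsupp.sum, Finsupp.sum, Finset.mul_sum,
    Finset.mul_sum]
  refine Finset.sum_congr rfl fun k _ => ?_
  split_ifs
  · simp
  · field_simp

lemma mul_sub_sq_add_sq_le (ha : 0 < a) (μ s ρ y : ℝ) :
    μ * ρ - a / 2 * ρ ^ 2 + b / 2 * y ^ 2 ≤ s * (ρ - y) +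
      ((μ - a * y - s) ^ 2 / (2 * a) - (a - b) / 2 * y ^ 2 + μ * y) := by
  have hsquare : 0 ≤ (μ - a * y - s - a * (ρ - y)) ^ 2 / (2 * a) := by positivity
  have hexpand : (μ - a * y - s - a * (ρ - y)) ^ 2 / (2 * a) = (μ - a * y - s) ^ 2 / (2 * a) -
      (μ - a * y - s) * (ρ - y) + a / 2 * (ρ - y) ^ 2 := by
    field_simp
    ring
  linarith

lemma gibbsWeight_le (hβ : 0 < β) (ha : 0 < a) (hb : 0 ≤ b) (hV : 0 < V) (μ s : ℝ)
    (m : ℕ) (n : CycleCounts) :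
    gibbsWeight d β μ a b V m n ≤ poissonProd (tiltedWeight d β V m s) n *
      Real.exp (β * V * ((μ - a * longCycleDensity V m n - s) ^ 2 / (2 * a) -
        (a - b) / 2 * longCycleDensity V m n ^ 2 + μ * longCycleDensity V m n)) := by
  have hprod := poissonProd_pos (fun k => mul_pos hV (cycleWeight_pos (d := d) hβ k)) n
  have hlong : b / 2 * longSquare V m n ≤ b / 2 * longCycleDensity V m n ^ 2 := by
    gcongr
    exact longSquare_le_sq hV.le m n
  rw [gibbsWeight, poissonProd_tiltedWeight hV.ne', mul_assoc (poissonProd _ n), ← Real.exp_add,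
    ← mul_add]
  refine mul_le_mul_of_nonneg_left (Real.exp_le_exp.2
    (mul_le_mul_of_nonneg_left ?_ (mul_pos hβ hV).le)) hprod.le
  linarith [mul_sub_sq_add_sq_le (b := b) ha μ s (particleDensity V n) (longCycleDensity V m n)]

lemma meanFieldPressure_eq (hβ : 0 < β) (ha : 0 < a) (u : ℝ) :
    meanFieldPressure d β a u = (u - stationarySlope d β a u) ^ 2 / (2 * a) +
      idealPressure d β (stationarySlope d β a u) := by
  rw [meanFieldPressure, ← mul_xOne hβ ha]
  field_simp

lemma sum_gibbsWeight_le_of_longCount_eq (hd : 1 ≤ d) (hβ : 0 < β) (ha : 0 < a) (hb : 0 ≤ b)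
    (hV : 0 < V) (μ : ℝ) {m j : ℕ} {S : Finset CycleCounts} (hS : ∀ n ∈ S, longCount m n = j) :
    ∑ n ∈ S, gibbsWeight d β μ a b V m n ≤ Real.exp (V * longWeight d β m +
      β * V * (meanFieldPressure d β a μ - energyGap d β a b μ (j / V))) := by
  set y : ℝ := j / V
  set s := stationarySlope d β a (μ - a * y) with hs
  set E := (μ - a * y - s) ^ 2 / (2 * a) - (a - b) / 2 * y ^ 2 + μ * y with hE
  have hs0 : s ≤ 0 := stationarySlope_nonpos hβ ha _
  calc ∑ n ∈ S, gibbsWeight d β μ a b V m n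
      ≤ ∑ n ∈ S, poissonProd (tiltedWeight d β V m s) n * Real.exp (β * V * E) := by
        refine Finset.sum_le_sum fun n hn => ?_
        have hle := gibbsWeight_le (d := d) hβ ha hb hV μ s m n
        rwa [longCycleDensity_eq_longCount_div, hS n hn] at hle
    _ ≤ Real.exp (V * (β * idealPressure d β s + longWeight d β m)) * Real.exp (β * V * E) := by
        rw [← Finset.sum_mul]
        gcongr
        exact (sum_poissonProd_le (tiltedWeight_nonneg hβ hV m s)
          (summable_tiltedWeight hd hβ hV m hs0) S).trans
          (Real.exp_le_exp.2 (tsum_tiltedWeight_le hd hβ hV m hs0))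
    _ = Real.exp (V * longWeight d β m +
          β * V * (meanFieldPressure d β a μ - energyGap d β a b μ y)) := by
        rw [← Real.exp_add, energyGap, meanFieldPressure_eq hβ ha (μ - a * y), ← hs, hE]
        congr 1
        ring

section SumLongCount

variable {m : ℕ} {μ : ℝ} {g u : ℕ → ℝ}

lemma sum_gibbsWeight_mul_le (hd : 1 ≤ d) (hβ : 0 < β) (ha : 0 < a) (hb : 0 ≤ b) (hV : 0 < V)
    (hg : ∀ j, 0 ≤ g j) (hu : Summable u) (hu0 : ∀ j, 0 ≤ u j)
    (hgu : ∀ j, (j = 0 ∨ m ≤ j) → g j * Real.exp (V * longWeight d β m +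
      β * V * (meanFieldPressure d β a μ - energyGap d β a b μ (j / V))) ≤ u j)
    (S : Finset CycleCounts) :
    ∑ n ∈ S, gibbsWeight d β μ a b V m n * g (longCount m n) ≤ ∑' j, u j := by
  classical
  rw [← Finset.sum_fiberwise_of_maps_to (t := S.image (longCount m))
    (g := longCount m) fun n hn => Finset.mem_image_of_mem _ hn]
  refine le_trans (Finset.sum_le_sum fun j hj => ?_)
    (hu.sum_le_tsum (S.image (longCount m)) fun j _ => hu0 j)
  have hj0 : j = 0 ∨ m ≤ j := by
    obtain ⟨n, -, rfl⟩ := Finset.mem_image.1 hj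
    exact longCount_eq_zero_or_le m n
  calc ∑ n ∈ S with longCount m n = j, gibbsWeight d β μ a b V m n * g (longCount m n)
      = g j * ∑ n ∈ S with longCount m n = j, gibbsWeight d β μ a b V m n := by
        rw [Finset.mul_sum]
        refine Finset.sum_congr rfl fun n hn => ?_
        rw [(Finset.mem_filter.1 hn).2, mul_comm]
    _ ≤ g j * Real.exp (V * longWeight d β m +
          β * V * (meanFieldPressure d β a μ - energyGap d β a b μ (j / V))) :=
        mul_le_mul_of_nonneg_left (sum_gibbsWeight_le_of_longCount_eq hd hβ ha hb hV μ
          fun n hn => (Finset.mem_filter.1 hn).2) (hg j)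
    _ ≤ u j := hgu j hj0

lemma summable_gibbsWeight_mul (hd : 1 ≤ d) (hβ : 0 < β) (ha : 0 < a) (hb : 0 ≤ b) (hV : 0 < V)
    (hg : ∀ j, 0 ≤ g j) (hu : Summable u) (hu0 : ∀ j, 0 ≤ u j)
    (hgu : ∀ j, (j = 0 ∨ m ≤ j) → g j * Real.exp (V * longWeight d β m +
      β * V * (meanFieldPressure d β a μ - energyGap d β a b μ (j / V))) ≤ u j) :
    Summable fun n => gibbsWeight d β μ a b V m n * g (longCount m n) :=
  summable_of_sum_le (fun n => mul_nonneg (gibbsWeight_pos hβ hV μ m n).le (hg _))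
    (sum_gibbsWeight_mul_le hd hβ ha hb hV hg hu hu0 hgu)

lemma tsum_gibbsWeight_mul_le (hd : 1 ≤ d) (hβ : 0 < β) (ha : 0 < a) (hb : 0 ≤ b) (hV : 0 < V)
    (hg : ∀ j, 0 ≤ g j) (hu : Summable u) (hu0 : ∀ j, 0 ≤ u j)
    (hgu : ∀ j, (j = 0 ∨ m ≤ j) → g j * Real.exp (V * longWeight d β m +
      β * V * (meanFieldPressure d β a μ - energyGap d β a b μ (j / V))) ≤ u j) :
    ∑' n, gibbsWeight d β μ a b V m n * g (longCount m n) ≤ ∑' j, u j :=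
  Real.tsum_le_of_sum_le (fun n => mul_nonneg (gibbsWeight_pos hβ hV μ m n).le (hg _))
    (sum_gibbsWeight_mul_le hd hβ ha hb hV hg hu hu0 hgu)

end SumLongCount

lemma summable_natCast_add_mul_exp (C : ℝ) {r : ℝ} (hr : 0 < r) :
    Summable fun j : ℕ => ((j : ℝ) + C) * Real.exp (-(r * j)) := by
  have hconst := (Real.summable_pow_mul_exp_neg_nat_mul 0 hr).mul_left C
  refine ((Real.summable_pow_mul_exp_neg_nat_mul 1 hr).add hconst).congr fun j => ?_
  rw [neg_mul]
  ring

lemma sub_le_energyGap (hd : 1 ≤ d) (hβ : 0 < β) (ha : 0 < a) (hab : b < a) {y : ℝ} (hy : 0 ≤ y)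
    (μ c : ℝ) : c * y - (μ + c) ^ 2 / (2 * (a - b)) ≤ energyGap d β a b μ y := by
  have hab' : 0 < a - b := sub_pos.2 hab
  have hsquare : 0 ≤ ((a - b) * y - (μ + c)) ^ 2 / (2 * (a - b)) := by positivity
  have hexpand : ((a - b) * y - (μ + c)) ^ 2 / (2 * (a - b)) =
      (a - b) / 2 * y ^ 2 - (μ + c) * y + (μ + c) ^ 2 / (2 * (a - b)) := by
    field_simp
    ring
  linarith [le_energyGap (d := d) (b := b) hd hβ ha (μ := μ) hy]

lemma summable_gibbsWeight_mul_longCount_add_one (hd : 1 ≤ d) (hβ : 0 < β) (hb : 0 ≤ b)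
    (hab : b < a) (hV : 0 < V) (μ : ℝ) (m : ℕ) :
    Summable fun n => gibbsWeight d β μ a b V m n * ((longCount m n : ℝ) + 1) := by
  have ha : 0 < a := hb.trans_lt hab
  refine summable_gibbsWeight_mul hd hβ ha hb hV (g := fun j => (j : ℝ) + 1)
    (u := fun j => Real.exp (V * longWeight d β m + β * V * (meanFieldPressure d β a μ +
      (μ + 1) ^ 2 / (2 * (a - b)))) * (((j : ℝ) + 1) * Real.exp (-(β * j))))
    (fun j => by positivity) ((summable_natCast_add_mul_exp 1 hβ).mul_left _)
    (fun j => by positivity) fun j _ => ?_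
  have hgap := sub_le_energyGap (d := d) hd hβ ha hab (by positivity : (0 : ℝ) ≤ j / V) μ 1
  have hscaled : β * V * (meanFieldPressure d β a μ - energyGap d β a b μ (j / V)) ≤
      β * V * (meanFieldPressure d β a μ + (μ + 1) ^ 2 / (2 * (a - b)) - j / V) :=
    mul_le_mul_of_nonneg_left (by linarith) (by positivity)
  have hcancel : β * V * (j / V) = β * j := by field_simp
  rw [mul_left_comm, ← Real.exp_add]
  exact mul_le_mul_of_nonneg_left (Real.exp_le_exp.2 (by linarith)) (by positivity)

lemma summable_gibbsWeight (hd : 1 ≤ d) (hβ : 0 < β) (hb : 0 ≤ b) (hab : b < a)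
    (hV : 0 < V) (μ : ℝ) (m : ℕ) : Summable (gibbsWeight d β μ a b V m) :=
  Summable.of_nonneg_of_le (fun n => (gibbsWeight_pos hβ hV μ m n).le)
    (fun n => le_mul_of_one_le_right (gibbsWeight_pos hβ hV μ m n).le
      (le_add_of_nonneg_left (Nat.cast_nonneg _)))
    (summable_gibbsWeight_mul_longCount_add_one hd hβ hb hab hV μ m)

lemma summable_gibbsWeight_mul_abs_longCycleDensity (hd : 1 ≤ d) (hβ : 0 < β) (hb : 0 ≤ b)
    (hab : b < a) (hV : 0 < V) (μ : ℝ) (m : ℕ) :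
    Summable fun n => gibbsWeight d β μ a b V m n * |longCycleDensity V m n| := by
  have hpos := gibbsWeight_pos (d := d) (a := a) (b := b) hβ hV μ m
  refine Summable.of_nonneg_of_le (fun n => mul_nonneg (hpos n).le (abs_nonneg _)) (fun n => ?_)
    ((summable_gibbsWeight_mul_longCount_add_one hd hβ hb hab hV μ m).mul_left V⁻¹)
  rw [longCycleDensity_eq_longCount_div, abs_of_nonneg (by positivity), div_eq_inv_mul,
    mul_left_comm]
  have := (hpos n).le
  gcongr
  exact le_add_of_nonneg_right zero_le_one

end UpperBound

/-! ### The lower bound on the partition function -/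

section PoissonAsymptotics

lemma tendsto_log_factorial_div_sub_log :
    Tendsto (fun n : ℕ => Real.log n.factorial / n - Real.log n) atTop (𝓝 (-1)) := by
  have hstirling := (Stirling.tendsto_stirlingSeq_sqrt_pi.log
    (Real.sqrt_pos.2 Real.pi_pos).ne').div_atTop (tendsto_natCast_atTop_atTop (R := ℝ))
  have hlog : Tendsto (fun n : ℕ => Real.log (2 * n) / (2 * n)) atTop (𝓝 0) :=
    Real.isLittleO_log_id_atTop.tendsto_div_nhds_zero.comp
      (tendsto_natCast_atTop_atTop.const_mul_atTop two_pos)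
  have hsum := (hstirling.add hlog).sub_const 1
  rw [add_zero, zero_sub] at hsum
  refine hsum.congr' ?_
  filter_upwards [eventually_gt_atTop 0] with n hn
  have hn' : (0 : ℝ) < n := Nat.cast_pos.2 hn
  rw [Stirling.log_stirlingSeq_formula, Real.log_div hn'.ne' (Real.exp_ne_zero 1), Real.log_exp]
  field_simp
  ring

variable {ι : Type*} {l : Filter ι} {V : ι → ℝ}

lemma tendsto_log_div_self (hV : Tendsto V l atTop) :
    Tendsto (fun i => Real.log (V i) / V i) l (𝓝 0) :=
  Real.isLittleO_log_id_atTop.tendsto_div_nhds_zero.comp hV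

lemma tendsto_floor_mul_div (hV : Tendsto V l atTop) {t : ℝ} (ht : 0 ≤ t) :
    Tendsto (fun i => (⌊V i * t⌋₊ : ℝ) / V i) l (𝓝 t) := by
  simpa only [Function.comp_def, mul_comm t] using
    (tendsto_nat_floor_mul_div_atTop (R := ℝ) ht).comp hV

lemma tendsto_log_poisson_div {q t : ℝ} (hq : 0 < q) (ht : 0 < t) (hV : Tendsto V l atTop) :
    Tendsto (fun i => Real.log ((V i * q) ^ ⌊V i * t⌋₊ / (⌊V i * t⌋₊.factorial : ℝ)) / V i) l
      (𝓝 (t * (1 - Real.log (t / q)))) := by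
  have hn : Tendsto (fun i => ⌊V i * t⌋₊) l atTop :=
    tendsto_nat_floor_atTop.comp (hV.atTop_mul_const ht)
  have hfloor := tendsto_floor_mul_div hV ht.le
  have hlim := hfloor.mul (((tendsto_log_factorial_div_sub_log.comp hn).const_sub
    (Real.log q)).sub (hfloor.log ht.ne'))
  rw [show t * (1 - Real.log (t / q)) = t * (Real.log q - -1 - Real.log t) by
    rw [Real.log_div ht.ne' hq.ne']; ring]
  refine hlim.congr' ?_
  filter_upwards [hV.eventually_gt_atTop 0, hn.eventually_gt_atTop 0] with i hVi hni
  have hni' : (0 : ℝ) < ⌊V i * t⌋₊ := Nat.cast_pos.2 hni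
  rw [Function.comp_apply, Real.log_div (x := (V i * q) ^ ⌊V i * t⌋₊) (by positivity)
    (by positivity), Real.log_pow, Real.log_mul hVi.ne' hq.ne', Real.log_div hni'.ne' hVi.ne']
  field_simp
  ring

end PoissonAsymptotics

section FiniteTilt

variable {d : ℕ} {β : ℝ}

lemma exists_lt_natCast_mul_cycleWeight_mul_exp (hβ : 0 < β) {s : ℝ} (hs : 0 < s) (B : ℝ) :
    ∃ k : ℕ+, B < (k : ℝ) * cycleWeight d β k * Real.exp (β * s * k) := by
  have hc := thermalConst_pos (d := d) hβ
  have hlim := ((tendsto_exp_mul_div_rpow_atTop ((d : ℝ) / 2) (β * s) (mul_pos hβ hs)).comp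
    tendsto_natCast_atTop_atTop).const_mul_atTop (inv_pos.2 hc)
  obtain ⟨k, hkB, hk⟩ := ((hlim.eventually_gt_atTop B).and (eventually_gt_atTop 0)).exists
  lift k to ℕ+ using hk
  refine ⟨k, hkB.trans_eq ?_⟩
  rw [natCast_mul_cycleWeight, Function.comp_apply]
  ring

lemma exists_finset_lt_sum_of_sBeta_lt (hβ : 0 < β) {x s : ℝ} (hx : 0 < x)
    (hs : sBeta d β x < s) :
    ∃ A : Finset ℕ+, x < ∑ k ∈ A, (k : ℝ) * cycleWeight d β k * Real.exp (β * s * k) := by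
  rcases lt_trichotomy s 0 with hneg | rfl | hpos
  · have hlt := strictMonoOn_cycleMoment (d := d) hβ 1 (hs.trans hneg) hneg hs
    rw [cycleMoment_sBeta hβ hx (hs.trans hneg)] at hlt
    simpa only [pow_one] using
      ((summable_cycleMoment (d := d) hβ 1 hneg).hasSum.eventually_const_lt hlt).exists
  · simp only [mul_zero, zero_mul, Real.exp_zero, mul_one]
    exact exists_finset_lt_sum_of_lt_criticalDensity hβ
      (not_le.1 fun hle => hs.ne ((sBeta_eq_zero_iff hβ hx).2 hle))
  · obtain ⟨k, hk⟩ := exists_lt_natCast_mul_cycleWeight_mul_exp (d := d) hβ hpos x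
    exact ⟨{k}, by rwa [Finset.sum_singleton]⟩

lemma sum_natCast_mul_cycleWeight_mul_exp_sBeta_le (hβ : 0 < β) {x : ℝ} (hx : 0 < x)
    (A : Finset ℕ+) :
    ∑ k ∈ A, (k : ℝ) * cycleWeight d β k * Real.exp (β * sBeta d β x * k) ≤ x := by
  rcases (sBeta_nonpos (d := d) hβ hx).lt_or_eq with hneg | hzero
  · exact (sum_le_cycleMoment_one hβ hneg A).trans_eq (cycleMoment_sBeta hβ hx hneg)
  · have hcrit := (sBeta_eq_zero_iff hβ hx).1 hzero
    have hd3 := three_le_of_criticalDensity_le_coe hcrit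
    rw [criticalDensity_of_three_le hd3, EReal.coe_le_coe_iff] at hcrit
    simp only [hzero, mul_zero, zero_mul, Real.exp_zero, mul_one]
    exact (((summable_natCast_mul_cycleWeight_iff hβ).2 hd3).sum_le_tsum A
      fun k _ => (mul_pos (by positivity) (cycleWeight_pos hβ k)).le).trans hcrit

lemma exists_finset_tilt (hd : 1 ≤ d) (hβ : 0 < β) {x ε : ℝ} (hx : 0 < x) (hε : 0 < ε) :
    ∃ (A : Finset ℕ+) (s : ℝ),
      ∑ k ∈ A, (k : ℝ) * cycleWeight d β k * Real.exp (β * s * k) = x ∧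
      s * x - β⁻¹ * ∑ k ∈ A, cycleWeight d β k * Real.exp (β * s * k) ≤
        idealFreeEnergy d β x + ε := by
  classical
  set t := sBeta d β x
  have ht : t ≤ 0 := sBeta_nonpos hβ hx
  have hpos (k : ℕ+) (s : ℝ) : 0 < cycleWeight d β k * Real.exp (β * s * k) :=
    mul_pos (cycleWeight_pos hβ k) (Real.exp_pos _)
  obtain ⟨A₀, hA₀⟩ := exists_finset_lt_sum_of_sBeta_lt (d := d) hβ hx
    (lt_add_of_pos_right t (by positivity : 0 < ε / (2 * x)))
  obtain ⟨A₁, hA₁⟩ := (((summable_cycleWeight_mul_exp hd hβ ht).hasSum.mul_left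
    β⁻¹).eventually_const_lt (sub_lt_self _ (half_pos hε))).exists
  rw [← idealPressure_eq_tsum_cycleWeight, ← Finset.mul_sum] at hA₁
  set A := A₀ ∪ A₁
  have hupper : x ≤ ∑ k ∈ A, (k : ℝ) * cycleWeight d β k * Real.exp (β * (t + ε / (2 * x)) * k) :=
    hA₀.le.trans (Finset.sum_le_sum_of_subset_of_nonneg Finset.subset_union_left fun k _ _ => by
      rw [mul_assoc]
      exact mul_nonneg (by positivity) (hpos k _).le)
  obtain ⟨s, ⟨hts, hst⟩, hsx⟩ := intermediate_value_Icc (f := fun s : ℝ => ∑ k ∈ A,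
    (k : ℝ) * cycleWeight d β k * Real.exp (β * s * k)) (le_add_of_nonneg_right (by positivity))
    (by fun_prop) ⟨sum_natCast_mul_cycleWeight_mul_exp_sBeta_le hβ hx A, hupper⟩
  refine ⟨A, s, hsx, ?_⟩
  have hslope : s * x ≤ t * x + ε / 2 := by
    have := mul_le_mul_of_nonneg_right hst hx.le
    rwa [add_mul, show ε / (2 * x) * x = ε / 2 by field_simp] at this
  have hpressure : β⁻¹ * ∑ k ∈ A₁, cycleWeight d β k * Real.exp (β * t * k) ≤
      β⁻¹ * ∑ k ∈ A, cycleWeight d β k * Real.exp (β * s * k) := by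
    refine mul_le_mul_of_nonneg_left ?_ (inv_pos.2 hβ).le
    refine (Finset.sum_le_sum_of_subset_of_nonneg Finset.subset_union_right
      fun k _ _ => (hpos k t).le).trans (Finset.sum_le_sum fun k _ => ?_)
    have := (cycleWeight_pos (d := d) hβ k).le
    gcongr
  rw [idealFreeEnergy_eq hd hβ hx]
  linarith

end FiniteTilt

section TrialCounts

/-- The cycle counts with `⌊V w_k⌋` cycles of each length `k ∈ A` and `e` cycles of length `K`. -/
noncomputable def trialCounts (V : ℝ) (A : Finset ℕ+) (w : ℕ+ → ℝ) (K : ℕ+) (e : ℕ) :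
    CycleCounts :=
  Finsupp.single K e + Finsupp.indicator A fun k _ => ⌊V * w k⌋₊

variable {V : ℝ} {A : Finset ℕ+} {w : ℕ+ → ℝ} {K : ℕ+} {e : ℕ}

@[to_additive]
lemma prod_trialCounts {M : Type*} [CommMonoid M] (hK : K ∉ A) {f : ℕ+ → ℕ → M}
    (hf : ∀ k, f k 0 = 1) :
    (trialCounts V A w K e).prod f = f K e * ∏ k ∈ A, f k ⌊V * w k⌋₊ := by
  rw [trialCounts, Finsupp.prod_add_index_of_disjoint, Finsupp.prod_single_index (hf K),
    Finsupp.prod_indicator_index _ fun k _ => hf k]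
  exact Finset.disjoint_of_subset_left Finsupp.support_single_subset
    (Finset.disjoint_of_subset_right (Finsupp.support_indicator_subset _ _)
      (Finset.disjoint_singleton_left.2 hK))

lemma particleDensity_trialCounts (hK : K ∉ A) : particleDensity V (trialCounts V A w K e) =
    K * (e / V) + ∑ k ∈ A, (k : ℝ) * (⌊V * w k⌋₊ / V) :=
  sum_trialCounts hK fun k => by rw [Nat.cast_zero, zero_div, mul_zero]

lemma longSquare_trialCounts {m : ℕ} (hA : ∀ k ∈ A, (k : ℕ) < m) (hm : m ≤ (K : ℕ)) :
    longSquare V m (trialCounts V A w K e) = (K * (e / V)) ^ 2 := by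
  rw [longSquare, sum_trialCounts (fun hK => (hA K hK).not_ge hm) (by simp), if_pos hm,
    Finset.sum_eq_zero fun k hk => if_neg (hA k hk).not_ge, add_zero, mul_pow]

lemma log_poissonProd_trialCounts (hV : 0 < V) {q : ℕ+ → ℝ} (hq : ∀ k, 0 < q k) (hK : K ∉ A) :
    Real.log (poissonProd (fun k => V * q k) (trialCounts V A w K e)) =
      Real.log ((V * q K) ^ e / (e.factorial : ℝ)) +
        ∑ k ∈ A, Real.log ((V * q k) ^ ⌊V * w k⌋₊ / (⌊V * w k⌋₊.factorial : ℝ)) := by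
  have hterm (k : ℕ+) (j : ℕ) : (V * q k) ^ j / (j.factorial : ℝ) ≠ 0 := by
    have := hq k
    positivity
  rw [poissonProd, prod_trialCounts hK (by simp), Real.log_mul (hterm K e)
    (Finset.prod_ne_zero_iff.2 fun k _ => hterm k _), Real.log_prod fun k _ => hterm k _]

end TrialCounts

section LowerBound

variable {d : ℕ} {β a b : ℝ} {ι : Type*} {l : Filter ι} {V : ι → ℝ} {m : ι → ℕ}

lemma tendsto_log_mul_cycleWeight_div (hβ : 0 < β) {K : ι → ℕ+} {y : ℝ} (hy : 0 < y)
    (hV : Tendsto V l atTop) (hK : Tendsto (fun i => (K i : ℝ) / V i) l (𝓝 y)) :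
    Tendsto (fun i => Real.log (V i * cycleWeight d β (K i)) / V i) l (𝓝 0) := by
  have hc := thermalConst_pos (d := d) hβ
  have hlogV := tendsto_log_div_self hV
  have hlogK := ((hK.log hy.ne').div_atTop hV).add hlogV
  have hlim := (hlogV.sub (tendsto_const_nhds (x := Real.log ((4 * Real.pi * β) ^ ((d : ℝ) / 2)))
    |>.div_atTop hV)).sub (hlogK.const_mul (1 + (d : ℝ) / 2))
  rw [add_zero, mul_zero, sub_zero, sub_zero] at hlim
  refine hlim.congr' ?_
  filter_upwards [hV.eventually_gt_atTop 0] with i hVi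
  have hKi : (0 : ℝ) < K i := by positivity
  rw [Real.log_mul hVi.ne' (cycleWeight_pos hβ _).ne', cycleWeight, one_div, Real.log_inv,
    Real.log_mul hc.ne' (by positivity), Real.log_rpow hKi, Real.log_div hKi.ne' hVi.ne']
  ring

lemma exists_longCycle {κ : ℝ≥0∞} {y : ℝ} (hy : 0 < y) (hκy : κ ≤ ENNReal.ofReal y)
    (hV : Tendsto V l atTop) (hκ : Tendsto (fun i => ENNReal.ofReal (m i / V i)) l (𝓝 κ)) :
    ∃ K : ι → ℕ+, (∀ i, m i ≤ (K i : ℕ)) ∧ Tendsto (fun i => (K i : ℝ) / V i) l (𝓝 y) := by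
  refine ⟨fun i => ⟨max (max (m i) 1) ⌈y * V i⌉₊, by positivity⟩,
    fun i => (le_max_left _ _).trans (le_max_left _ _), ?_⟩
  have hm : Tendsto (fun i => (m i : ℝ) / V i) l (𝓝 κ.toReal) := by
    refine ((ENNReal.tendsto_toReal (ne_top_of_le_ne_top ENNReal.ofReal_ne_top hκy)).comp
      hκ).congr' ?_
    filter_upwards [hV.eventually_ge_atTop 0] with i hVi
    exact ENNReal.toReal_ofReal (by positivity)
  have hlim := (hm.max (tendsto_inv_atTop_zero.comp hV)).max
    ((tendsto_nat_ceil_mul_div_atTop (R := ℝ) hy.le).comp hV)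
  rw [max_eq_right (max_le (ENNReal.toReal_le_of_le_ofReal hy.le hκy) hy.le)] at hlim
  refine hlim.congr' ?_
  filter_upwards [hV.eventually_gt_atTop 0] with i hVi
  rw [Function.comp_apply, Function.comp_apply, PNat.mk_coe, Nat.cast_max, Nat.cast_max,
    Nat.cast_one, ← one_div, max_div_div_right hVi.le, max_div_div_right hVi.le]

lemma exists_longCycles_of_isLongDensity (hβ : 0 < β) {κ : ℝ≥0∞} {y : ℝ}
    (hy : IsLongDensity κ y) (hV : Tendsto V l atTop)
    (hκ : Tendsto (fun i => ENNReal.ofReal (m i / V i)) l (𝓝 κ)) :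
    ∃ (K : ι → ℕ+) (e : ℕ), (∀ i, m i ≤ (K i : ℕ)) ∧
      Tendsto (fun i => (K i : ℝ) * (e / V i)) l (𝓝 y) ∧
      Tendsto (fun i => Real.log ((V i * cycleWeight d β (K i)) ^ e / (e.factorial : ℝ)) / V i)
        l (𝓝 0) := by
  rcases hy.1.eq_or_lt with rfl | hypos
  · exact ⟨fun i => (m i).succPNat, 0, fun i => (m i).le_succ,
      by simp [tendsto_const_nhds], by simp [tendsto_const_nhds]⟩
  · obtain ⟨K, hmK, hK⟩ := exists_longCycle hypos (hy.2.resolve_left hypos.ne') hV hκ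
    refine ⟨K, 1, hmK, ?_, ?_⟩
    · simpa only [Nat.cast_one, mul_one_div] using hK
    · simpa only [pow_one, Nat.factorial_one, Nat.cast_one, div_one] using
        tendsto_log_mul_cycleWeight_div hβ hypos hV hK

lemma tendsto_log_gibbsWeight_trialCounts (hβ : 0 < β) (μ : ℝ) {A : Finset ℕ+} {w : ℕ+ → ℝ}
    (hw : ∀ k, 0 < w k) {K : ι → ℕ+} {e : ℕ} {y : ℝ} (hV : Tendsto V l atTop)
    (hm : Tendsto m l atTop) (hmK : ∀ i, m i ≤ (K i : ℕ))
    (hK : Tendsto (fun i => (K i : ℝ) * (e / V i)) l (𝓝 y))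
    (hKlog : Tendsto (fun i =>
      Real.log ((V i * cycleWeight d β (K i)) ^ e / (e.factorial : ℝ)) / V i) l (𝓝 0)) :
    Tendsto (fun i => Real.log (gibbsWeight d β μ a b (V i) (m i)
        (trialCounts (V i) A w (K i) e)) / V i) l
      (𝓝 (∑ k ∈ A, w k * (1 - Real.log (w k / cycleWeight d β k)) +
        β * (μ * (y + ∑ k ∈ A, k * w k) - a / 2 * (y + ∑ k ∈ A, k * w k) ^ 2 +
          b / 2 * y ^ 2))) := by
  have hentropy := tendsto_finsetSum A fun k _ =>
    tendsto_log_poisson_div (cycleWeight_pos (d := d) hβ k) (hw k) hV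
  have hdensity := hK.add (tendsto_finsetSum A fun k _ =>
    (tendsto_floor_mul_div hV (hw k).le).const_mul (k : ℝ))
  have henergy := (((hdensity.const_mul μ).sub ((hdensity.pow 2).const_mul (a / 2))).add
    ((hK.pow 2).const_mul (b / 2))).const_mul β
  have hlim := (hKlog.add hentropy).add henergy
  rw [zero_add] at hlim
  have hshort : ∀ᶠ i in l, ∀ k ∈ A, (k : ℕ) < m i :=
    (eventually_all_finset A).2 fun k _ => hm.eventually_gt_atTop _
  refine hlim.congr' ?_
  filter_upwards [hshort, hV.eventually_gt_atTop 0] with i hA hVi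
  have hKA : K i ∉ A := fun h => (hA _ h).not_ge (hmK i)
  have hpos := poissonProd_pos (fun k => mul_pos hVi (cycleWeight_pos (d := d) hβ k))
    (trialCounts (V i) A w (K i) e)
  rw [gibbsWeight, Real.log_mul hpos.ne' (Real.exp_ne_zero _), Real.log_exp,
    log_poissonProd_trialCounts hVi (cycleWeight_pos hβ) hKA, particleDensity_trialCounts hKA,
    longSquare_trialCounts hA (hmK i), add_div, add_div, Finset.sum_div]
  field_simp

lemma eventually_exp_le_tsum_gibbsWeight (hd : 1 ≤ d) (hβ : 0 < β) (hb : 0 ≤ b) (hab : b < a)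
    {κ : ℝ≥0∞} {x y ε : ℝ} (μ : ℝ) (hx : 0 < x) (hy : IsLongDensity κ y) (hε : 0 < ε)
    (hV : Tendsto V l atTop) (hm : Tendsto m l atTop)
    (hκ : Tendsto (fun i => ENNReal.ofReal (m i / V i)) l (𝓝 κ)) :
    ∀ᶠ i in l, Real.exp (-(β * V i * (freeEnergyFunctional d β a b μ (x, y) + ε))) ≤
      ∑' n, gibbsWeight d β μ a b (V i) (m i) n := by
  obtain ⟨K, e, hmK, hK, hKlog⟩ := exists_longCycles_of_isLongDensity (d := d) hβ hy hV hκ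
  obtain ⟨A, s, hAx, hAs⟩ := exists_finset_tilt (d := d) hd hβ hx (half_pos hε)
  set w : ℕ+ → ℝ := fun k => cycleWeight d β k * Real.exp (β * s * k) with hw
  have hwpos (k : ℕ+) : 0 < w k := mul_pos (cycleWeight_pos hβ k) (Real.exp_pos _)
  have hAx' : ∑ k ∈ A, k * w k = x := by simpa only [hw, mul_assoc] using hAx
  have hentropy : ∑ k ∈ A, w k * (1 - Real.log (w k / cycleWeight d β k)) =
      ∑ k ∈ A, w k - β * s * x := by
    rw [← hAx', Finset.mul_sum, ← Finset.sum_sub_distrib]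
    refine Finset.sum_congr rfl fun k _ => ?_
    rw [hw, mul_div_cancel_left₀ _ (cycleWeight_pos hβ k).ne', Real.log_exp]
    ring
  have hlim := tendsto_log_gibbsWeight_trialCounts (d := d) (a := a) (b := b) hβ μ (A := A) hwpos
    hV hm hmK hK hKlog
  rw [hAx', hentropy] at hlim
  have hvalue : -(β * (freeEnergyFunctional d β a b μ (x, y) + ε)) < ∑ k ∈ A, w k - β * s * x +
      β * (μ * (y + x) - a / 2 * (y + x) ^ 2 + b / 2 * y ^ 2) := by
    have hscaled := mul_le_mul_of_nonneg_left hAs hβ.le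
    rw [mul_sub, mul_inv_cancel_left₀ hβ.ne'] at hscaled
    rw [freeEnergyFunctional]
    linarith [mul_pos hβ hε]
  filter_upwards [hlim.eventually_const_lt hvalue, hV.eventually_gt_atTop 0] with i hi hVi
  have hpos := gibbsWeight_pos (d := d) (a := a) (b := b) hβ hVi μ (m i)
  refine le_trans ?_ ((summable_gibbsWeight hd hβ hb hab hVi μ (m i)).le_tsum
    (trialCounts (V i) A w (K i) e) fun n _ => (hpos n).le)
  rw [← Real.le_log_iff_exp_le (hpos _)]
  linarith [(lt_div_iff₀ hVi).1 hi]

end LowerBound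

/-! ### Concentration of the long-cycle density -/

section Concentration

variable {d : ℕ} {β a b μ y δ η : ℝ}

section Margin

variable {ι : Type*} {l : Filter ι} {κ : ℝ≥0∞} {ρ : ι → ℝ}

lemma IsEquilibrium.eventually_lt_energyGap (hd : 1 ≤ d) (hβ : 0 < β) (ha : 0 < a)
    (hy : IsEquilibrium d β a b κ μ y) (hρ : Tendsto (fun i => ENNReal.ofReal (ρ i)) l (𝓝 κ))
    {z : ℝ} (hz : 0 ≤ z) (hzy : z ≠ y) :
    ∀ᶠ p : (ι × ℝ) × ℝ in (l ×ˢ 𝓝[>] 0) ×ˢ 𝓝 z, (p.2 = 0 ∨ ρ p.1.1 ≤ p.2) →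
      energyGap d β a b μ y + p.1.2 * (1 + p.2) < energyGap d β a b μ p.2 := by
  have hsnd : Tendsto (fun p : (ι × ℝ) × ℝ => p.2) ((l ×ˢ 𝓝[>] 0) ×ˢ 𝓝 z) (𝓝 z) := tendsto_snd
  by_cases hlong : IsLongDensity κ z
  · have hη : Tendsto (fun p : (ι × ℝ) × ℝ => p.1.2) ((l ×ˢ 𝓝[>] 0) ×ˢ 𝓝 z) (𝓝 0) :=
      (tendsto_snd.mono_right nhdsWithin_le_nhds).comp tendsto_fst
    have hleft := (hη.mul (hsnd.const_add 1)).const_add (energyGap d β a b μ y)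
    have hright := ((continuous_energyGap_right (b := b) hd hβ ha μ).tendsto z).comp hsnd
    rw [zero_mul, add_zero] at hleft
    exact (hleft.eventually_lt hright (hy.2 z hlong hzy)).mono fun p hp _ => hp
  · obtain ⟨hz0, hzκ⟩ := not_or.1 fun h => hlong ⟨hz, h⟩
    filter_upwards [hsnd.eventually_ne hz0, (ENNReal.tendsto_ofReal hsnd).eventually_lt
      (hρ.comp (tendsto_fst.comp tendsto_fst)) (not_le.1 hzκ)] with p hp0 hpρ hp
    exact absurd (ENNReal.ofReal_le_ofReal (hp.resolve_left hp0)) hpρ.not_ge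

lemma IsEquilibrium.exists_energyGap_margin (hd : 1 ≤ d) (hβ : 0 < β) (ha : 0 < a) (hab : b < a)
    (hy : IsEquilibrium d β a b κ μ y) (hρ : Tendsto (fun i => ENNReal.ofReal (ρ i)) l (𝓝 κ))
    (hδ : 0 < δ) :
    ∃ η > 0, ∀ᶠ i in l, ∀ z, 0 ≤ z → (z = 0 ∨ ρ i ≤ z) → δ ≤ |z - y| →
      energyGap d β a b μ y + η * (1 + z) ≤ energyGap d β a b μ z := by
  set R := energyGap d β a b μ y + 1 + (μ + 2) ^ 2 / (2 * (a - b))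
  have hK : IsCompact (Set.Icc 0 R ∩ {z | δ ≤ |z - y|}) :=
    isCompact_Icc.inter_right (isClosed_le continuous_const (by fun_prop))
  have hnear := hK.mem_prod_nhdsSet_of_forall fun z hz =>
    hy.eventually_lt_energyGap hd hβ ha hρ hz.1.1 fun h => hδ.not_ge (by simpa [h] using hz.2)
  obtain ⟨P, hP, Q, hQ, hPQ⟩ := eventually_prod_iff.1 hnear
  obtain ⟨η, hηP, hη0, hη1⟩ := ((eventually_swap_iff.1 hP).curry.and
    (Ioc_mem_nhdsGT zero_lt_one)).exists
  refine ⟨η, hη0, hηP.mono fun i hi z hz hzρ hzy => ?_⟩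
  rcases le_or_gt z R with hzR | hzR
  · exact (hPQ hi (hQ.self_of_nhdsSet z ⟨⟨hz, hzR⟩, hzy⟩) hzρ).le
  · have hgrowth := sub_le_energyGap (d := d) hd hβ ha hab hz μ 2
    have hslope : η * (1 + z) ≤ 1 + z := mul_le_of_le_one_left (by positivity) hη1
    linarith

end Margin

section FiniteVolume

variable {V : ℝ} {m : ℕ}

lemma abs_integral_sub_const_le {X : Type*} [MeasurableSpace X] {P : Measure X}
    [IsProbabilityMeasure P] {f g : X → ℝ} (hf : Integrable f P) (hg : Integrable g P)
    (h : ∀ x, |f x - y| ≤ δ + g x) : |∫ x, f x ∂P - y| ≤ δ + ∫ x, g x ∂P := by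
  calc |∫ x, f x ∂P - y| = |∫ x, f x - y ∂P| := by
        rw [integral_sub hf (integrable_const y), integral_const, probReal_univ, one_smul]
    _ ≤ ∫ x, δ + g x ∂P := abs_integral_le_integral_abs.trans
        (integral_mono (hf.sub (integrable_const y)).abs ((integrable_const δ).add hg) h)
    _ = δ + ∫ x, g x ∂P := by
        rw [integral_add (integrable_const δ) hg, integral_const, probReal_univ, one_smul]

lemma abs_integral_longCycleDensity_sub_le (hd : 1 ≤ d) (hβ : 0 < β) (hb : 0 ≤ b) (hab : b < a)
    (hV : 0 < V) (α μ y : ℝ) (hδ : 0 ≤ δ) {u : ℕ → ℝ} (hu : Summable u) (hu0 : ∀ j, 0 ≤ u j)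
    (hgu : ∀ j : ℕ, (j = 0 ∨ m ≤ j) → δ ≤ |j / V - y| →
      |j / V - y| * Real.exp (V * longWeight d β m +
        β * V * (meanFieldPressure d β a μ - energyGap d β a b μ (j / V))) ≤ u j) :
    |∫ n, longCycleDensity V m n ∂(gibbsMeasure d β α μ a b V m) - y| ≤
      δ + (∑' j, u j) / ∑' n, gibbsWeight d β μ a b V m n := by
  classical
  have ha : 0 < a := hb.trans_lt hab
  have hW := summable_gibbsWeight (d := d) hd hβ hb hab hV μ m
  have hprob := isProbabilityMeasure_gibbsMeasure hβ hV α hW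
  have hint := integrable_gibbsMeasure hβ hV α hW
    (summable_gibbsWeight_mul_abs_longCycleDensity hd hβ hb hab hV μ m)
  set g : ℕ → ℝ := fun j => if δ ≤ |j / V - y| then |j / V - y| else 0 with hg
  have hg0 (j : ℕ) : 0 ≤ g j := by positivity
  have hgu' (j : ℕ) (hj : j = 0 ∨ m ≤ j) : g j * Real.exp (V * longWeight d β m +
      β * V * (meanFieldPressure d β a μ - energyGap d β a b μ (j / V))) ≤ u j := by
    rw [hg]
    dsimp only
    split_ifs with hfar
    · exact hgu j hj hfar
    · rw [zero_mul]
      exact hu0 j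
  have hgint : Integrable (fun n => g (longCount m n)) (gibbsMeasure d β α μ a b V m) :=
    integrable_gibbsMeasure hβ hV α hW (by
      simpa only [abs_of_nonneg (hg0 _)] using
        summable_gibbsWeight_mul hd hβ ha hb hV hg0 hu hu0 hgu')
  have hpointwise (n : CycleCounts) : |longCycleDensity V m n - y| ≤ δ + g (longCount m n) := by
    rw [longCycleDensity_eq_longCount_div, hg]
    dsimp only
    split_ifs with hfar
    · exact le_add_of_nonneg_left hδ
    · rw [add_zero]
      exact (not_le.1 hfar).le
  refine (abs_integral_sub_const_le hint hgint hpointwise).trans ?_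
  have hZ := tsum_gibbsWeight_pos hβ hV hW
  rw [integral_gibbsMeasure hβ hV]
  gcongr
  exact tsum_gibbsWeight_mul_le hd hβ ha hb hV hg0 hu hu0 hgu'

lemma abs_sub_mul_exp_le_of_margin (hβ : 0 < β) (hV : 1 ≤ V) {j : ℕ} {p e E W : ℝ}
    (hgap : e + η * (1 + j / V) ≤ E) (hW : W ≤ β * η / 4) :
    |j / V - y| * Real.exp (V * W + β * V * (p - E)) ≤
      Real.exp (-(β * η / 2 * V)) * Real.exp (-(β * V * (e - p + η / 4))) *
        (((j : ℝ) + |y|) * Real.exp (-(β * η * j))) := by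
  have hdist : |(j : ℝ) / V - y| ≤ j + |y| := by
    refine (abs_sub _ _).trans ?_
    rw [abs_of_nonneg (by positivity)]
    gcongr
    exact div_le_self (by positivity) hV
  have hexponent : V * W + β * V * (p - E) ≤
      -(β * η / 2 * V) + -(β * V * (e - p + η / 4)) + -(β * η * j) := by
    calc V * W + β * V * (p - E)
        ≤ V * (β * η / 4) + β * V * (p - (e + η * (1 + j / V))) := by gcongr
      _ = -(β * η / 2 * V) + -(β * V * (e - p + η / 4)) + -(β * η * j) := by
        field_simp
        ring
  rw [mul_left_comm, ← Real.exp_add, ← Real.exp_add]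
  exact mul_le_mul hdist (Real.exp_le_exp.2 hexponent) (Real.exp_pos _).le (by positivity)

lemma abs_integral_longCycleDensity_sub_le_of_margin (hd : 1 ≤ d) (hβ : 0 < β) (hb : 0 ≤ b)
    (hab : b < a) (hV : 1 ≤ V) (α : ℝ) (hδ : 0 ≤ δ) (hη : 0 < η)
    (hmargin : ∀ z, 0 ≤ z → (z = 0 ∨ m / V ≤ z) → δ ≤ |z - y| →
      energyGap d β a b μ y + η * (1 + z) ≤ energyGap d β a b μ z)
    (hlong : longWeight d β m ≤ β * η / 4)
    (hlow : Real.exp (-(β * V * (energyGap d β a b μ y - meanFieldPressure d β a μ + η / 4))) ≤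
      ∑' n, gibbsWeight d β μ a b V m n) :
    |∫ n, longCycleDensity V m n ∂(gibbsMeasure d β α μ a b V m) - y| ≤
      δ + (∑' j : ℕ, ((j : ℝ) + |y|) * Real.exp (-(β * η * j))) *
        Real.exp (-(β * η / 2 * V)) := by
  have hfar (j : ℕ) (hj : j = 0 ∨ m ≤ j) (hjδ : δ ≤ |j / V - y|) :=
    abs_sub_mul_exp_le_of_margin (y := y) (p := meanFieldPressure d β a μ) hβ hV
      (hmargin (j / V) (by positivity) (hj.imp (fun h => by simp [h]) fun h => by gcongr) hjδ) hlong
  refine (abs_integral_longCycleDensity_sub_le hd hβ hb hab (by positivity) α μ y hδ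
    ((summable_natCast_add_mul_exp |y| (mul_pos hβ hη)).mul_left _)
    (fun j => by positivity) hfar).trans ?_
  gcongr
  rw [tsum_mul_left, div_le_iff₀ ((Real.exp_pos _).trans_le hlow), mul_comm, ← mul_assoc]
  exact mul_le_mul_of_nonneg_left hlow (by positivity)

end FiniteVolume

lemma IsEquilibrium.tendsto_integral_longCycleDensity {ι : Type*} {l : Filter ι} {V : ι → ℝ}
    {m : ι → ℕ} {κ : ℝ≥0∞} (hd : 1 ≤ d) (hβ : 0 < β) (hb : 0 ≤ b) (hab : b < a)
    (hy : IsEquilibrium d β a b κ μ y) (α : ℝ) (hV : Tendsto V l atTop)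
    (hm : Tendsto m l atTop) (hκ : Tendsto (fun i => ENNReal.ofReal (m i / V i)) l (𝓝 κ)) :
    Tendsto (fun i => ∫ n, longCycleDensity (V i) (m i) n ∂(gibbsMeasure d β α μ a b (V i) (m i)))
      l (𝓝 y) := by
  have ha : 0 < a := hb.trans_lt hab
  refine Metric.tendsto_nhds.2 fun ε hε => ?_
  obtain ⟨η, hη, hmargin⟩ := hy.exists_energyGap_margin hd hβ ha hab hκ (half_pos hε)
  have hlow := eventually_exp_le_tsum_gibbsWeight (d := d) hd hβ hb hab μ
    (xOne_pos (d := d) hβ ha (μ - a * y)) hy.1 (by positivity : 0 < η / 4) hV hm hκ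
  rw [freeEnergyFunctional_xOne hd hβ ha] at hlow
  have hlong := ((tendsto_longWeight (d := d) hd hβ).comp hm).eventually_le_const
    (by positivity : 0 < β * η / 4)
  have hdecay := (Real.tendsto_exp_neg_atTop_nhds_zero.comp
    (hV.const_mul_atTop (by positivity : 0 < β * η / 2))).const_mul
    (∑' j : ℕ, ((j : ℝ) + |y|) * Real.exp (-(β * η * j)))
  rw [mul_zero] at hdecay
  filter_upwards [hmargin, hlow, hlong, hdecay.eventually_lt_const (half_pos hε),
    hV.eventually_ge_atTop 1] with i hi_margin hi_low hi_long hi_decay hVi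
  rw [Real.dist_eq]
  exact (abs_integral_longCycleDensity_sub_le_of_margin hd hβ hb hab hVi α (half_pos hε).le hη
    hi_margin hi_long hi_low).trans_lt (by
      rw [Function.comp_apply] at hi_decay
      linarith)

end Concentration

/-! ### Thermodynamic sequences -/

section ThermodynamicSequence

variable {d : ℕ} {β a b : ℝ} {κ : ℝ≥0∞}

lemma ofReal_natCast_div_measureReal {X : Type*} [MeasurableSpace X] {ν : Measure X} {s : Set X}
    (hs : 0 < ν.real s) (n : ℕ) : ENNReal.ofReal (n / ν.real s) = n / ν s := by
  rw [ENNReal.ofReal_div_of_pos hs, ENNReal.ofReal_natCast, Measure.real,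
    ENNReal.ofReal_toReal (ENNReal.toReal_pos_iff.1 hs).2.ne]

theorem IsEquilibrium.isLongCycleLimit {μ y : ℝ} (h : IsEquilibrium d β a b κ μ y) (hd : 1 ≤ d)
    (hβ : 0 < β) (hb : 0 ≤ b) (hab : b < a) (α : ℝ) : IsLongCycleLimit d β α a b κ μ y := by
  rintro Λ m ⟨-, hV, hm, hκ⟩
  refine h.tendsto_integral_longCycleDensity hd hβ hb hab α hV hm (hκ.congr' ?_)
  filter_upwards [hV.eventually_gt_atTop 0] with i hVi
  exact (ofReal_natCast_div_measureReal hVi (m i)).symm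

lemma exists_tendsto_ofReal_natCast_div {ι : Type*} {l : Filter ι} {V : ι → ℝ}
    (hV : Tendsto V l atTop) (κ : ℝ≥0∞) :
    ∃ m : ι → ℕ, Tendsto m l atTop ∧
      Tendsto (fun i => ENNReal.ofReal (m i / V i)) l (𝓝 κ) := by
  have hsqrt := Real.tendsto_sqrt_atTop.comp hV
  induction κ with
  | top =>
    refine ⟨fun i => ⌈V i ^ 2⌉₊, tendsto_nat_ceil_atTop.comp
      ((tendsto_pow_atTop two_ne_zero).comp hV), ENNReal.tendsto_ofReal_atTop.comp
      (tendsto_atTop_mono' l ?_ hV)⟩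
    filter_upwards [hV.eventually_gt_atTop 0] with i hVi
    rw [le_div_iff₀ hVi, ← sq]
    exact Nat.le_ceil _
  | coe κ =>
    refine ⟨fun i => ⌈κ * V i⌉₊ + ⌈√(V i)⌉₊, tendsto_atTop_mono (fun i => Nat.le_add_left _ _)
      (tendsto_nat_ceil_atTop.comp hsqrt), ?_⟩
    have hceil := ((tendsto_nat_ceil_mul_div_atTop (R := ℝ) κ.coe_nonneg).comp hV).add
      (((tendsto_nat_ceil_div_atTop (R := ℝ)).comp hsqrt).mul (tendsto_inv_atTop_zero.comp hsqrt))
    rw [mul_zero, add_zero] at hceil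
    refine (ENNReal.ofReal_coe_nnreal (p := κ) ▸ ENNReal.tendsto_ofReal hceil).congr' ?_
    filter_upwards [hV.eventually_gt_atTop 0] with i hVi
    congr 1
    simp only [Function.comp_apply, Nat.cast_add, add_div, ← div_eq_mul_inv, div_div,
      Real.mul_self_sqrt hVi.le]

lemma exists_isThermodynamicSequence (hd : 1 ≤ d) (κ : ℝ≥0∞) :
    ∃ Λ m, IsThermodynamicSequence d κ Λ m := by
  set Λ : ℕ → Set (Fin d → ℝ) := fun i =>
    Set.Icc (-fun _ => ((i : ℝ) + 1) / 2) fun _ => ((i : ℝ) + 1) / 2 with hΛ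
  have hvol (i : ℕ) : volume.real (Λ i) = ((i : ℝ) + 1) ^ d := by
    rw [hΛ, Measure.real, Real.volume_Icc_pi_toReal (neg_le_self fun _ => by positivity)]
    simp
  have hV : Tendsto (fun i => volume.real (Λ i)) atTop atTop := by
    simp only [hvol]
    exact (tendsto_pow_atTop (by omega)).comp
      (tendsto_natCast_atTop_atTop.atTop_add tendsto_const_nhds)
  obtain ⟨m, hm, hκ⟩ := exists_tendsto_ofReal_natCast_div hV κ
  refine ⟨Λ, m, fun i => ⟨_, fun _ => by positivity, rfl⟩, hV, hm, hκ.congr fun i => ?_⟩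
  exact ofReal_natCast_div_measureReal (by rw [hvol]; positivity) (m i)

lemma IsLongCycleLimit.unique (hd : 1 ≤ d) {α μ r r' : ℝ}
    (h : IsLongCycleLimit d β α a b κ μ r) (h' : IsLongCycleLimit d β α a b κ μ r') : r = r' := by
  obtain ⟨Λ, m, hΛm⟩ := exists_isThermodynamicSequence hd κ
  exact tendsto_nhds_unique (h Λ m hΛm) (h' Λ m hΛm)

end ThermodynamicSequence

/-! ### Continuity of the limiting density -/

section Continuity

variable {d : ℕ} {α β a b κ : ℝ} {ϱ : ℝ → ℝ}

lemma not_continuousAt_of_jump {f : ℝ → ℝ} {x c : ℝ} (hc : 0 < c) (hleft : ∀ y < x, f y = 0)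
    (hright : ∀ y > x, c ≤ f y) : ¬ ContinuousAt f x := by
  intro h
  have hle : f x ≤ 0 := le_of_tendsto (h.mono_left nhdsWithin_le_nhds)
    (eventually_nhdsWithin_of_forall (s := Set.Iio x) fun y hy => (hleft y hy).le)
  have hge : c ≤ f x := ge_of_tendsto (h.mono_left nhdsWithin_le_nhds)
    (eventually_nhdsWithin_of_forall (s := Set.Ioi x) hright)
  exact (hc.trans_le hge).not_ge hle

lemma IsLongCycleLimit.eq_of_isEquilibrium {κ : ℝ≥0∞} {μ y r : ℝ} (hd : 1 ≤ d) (hβ : 0 < β)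
    (hb : 0 ≤ b) (hab : b < a) (hr : IsLongCycleLimit d β α a b κ μ r)
    (hy : IsEquilibrium d β a b κ μ y) : r = y :=
  hr.unique hd (hy.isLongCycleLimit hd hβ hb hab α)

lemma continuousAt_of_eq_yTwo (hβ : 0 < β) (hb : 0 < b) (hab : b < a) {f : ℝ → ℝ} {x : ℝ}
    (hx : muT d β a b ≤ x) (hleft : ∀ᶠ ν in 𝓝[≤] x, f ν = yTwo d β a b x)
    (hright : ∀ ν > x, f ν = yTwo d β a b ν) : ContinuousAt f x := by
  have hfx : f x = yTwo d β a b x := hleft.self_of_nhdsWithin Set.self_mem_Iic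
  rw [continuousAt_iff_continuous_left_right, ContinuousWithinAt, ContinuousWithinAt, hfx]
  refine ⟨tendsto_const_nhds.congr' (hleft.mono fun ν hν => hν.symm),
    (tendsto_yTwo_nhdsGE hβ hb hab hx).congr' (eventually_nhdsWithin_of_forall fun ν hν => ?_)⟩
  rcases (Set.mem_Ici.1 hν).eq_or_lt with rfl | hxν
  · exact hfx.symm
  · exact (hright ν hxν).symm

lemma isEquilibrium_zero_zero (hd : 1 ≤ d) (hβ : 0 < β) (hb : 0 < b) (hab : b < a) {μ : ℝ}
    (hμ : μ < transitionPotential d β a b 0) : IsEquilibrium d β a b 0 μ 0 := by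
  simpa only [ENNReal.ofReal_zero] using
    isEquilibrium_zero_of_lt_transitionPotential hd hβ hb hab le_rfl hμ

lemma isEquilibrium_zero_yTwo (hd : 1 ≤ d) (hβ : 0 < β) (hb : 0 < b) (hab : b < a) {μ : ℝ}
    (hμ : transitionPotential d β a b 0 < μ) : IsEquilibrium d β a b 0 μ (yTwo d β a b μ) :=
  isEquilibrium_yTwo hd hβ hb hab hμ (isLongDensity_zero_iff.2
    (yTwo_nonneg hβ hb hab ((muT_le_transitionPotential hd hβ hb hab 0).trans hμ.le)))

lemma isEquilibrium_yTwo_of_muR_le (hd : 1 ≤ d) (hβ : 0 < β) (hb : 0 < b) (hab : b < a) {μ : ℝ}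
    (hκ : 0 < κ) (hμ : transitionPotential d β a b κ < μ) (hμr : muR d β a b κ ≤ μ) :
    IsEquilibrium d β a b (ENNReal.ofReal κ) μ (yTwo d β a b μ) :=
  isEquilibrium_yTwo hd hβ hb hab ((transitionPotential_mono hd hβ hb hab hκ.le).trans_lt hμ)
    ((isLongDensity_ofReal_iff hκ.le).2 (Or.inr (le_yTwo_of_muR_le hβ hb hab hκ hμr)))

lemma yTwo_transitionPotential_eq_zero_iff_eq_muC (hd : 1 ≤ d) (hβ : 0 < β) (hb : 0 < b)
    (hab : b < a) : yTwo d β a b (transitionPotential d β a b 0) = 0 ↔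
      ((transitionPotential d β a b 0 : ℝ) : EReal) = muC d β a :=
  (yTwo_transitionPotential_eq_zero_iff hd hβ hb hab).trans
    (transitionPotential_eq_muC_iff hd hβ hb hab).symm

lemma xOne_transitionPotential_eq_xTwo (hd : 1 ≤ d) (hβ : 0 < β) (hb : 0 < b) (hab : b < a)
    (h0 : yTwo d β a b (transitionPotential d β a b 0) = 0) :
    xOne d β a (transitionPotential d β a b 0) = xTwo d β a b (transitionPotential d β a b 0) := by
  have hx := xOne_sub_mul_yTwo hβ hb hab (muT_le_transitionPotential (d := d) hd hβ hb hab 0)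
  rwa [h0, mul_zero, sub_zero] at hx

lemma not_continuousAt_transitionPotential_zero (hd : 1 ≤ d) (hβ : 0 < β) (hb : 0 < b)
    (hab : b < a) (hlt : ((transitionPotential d β a b 0 : ℝ) : EReal) < muC d β a)
    (hϱ : ∀ μ ≠ transitionPotential d β a b 0, IsLongCycleLimit d β α a b 0 μ (ϱ μ)) :
    ¬ ContinuousAt ϱ (transitionPotential d β a b 0) := by
  have hμt := muT_le_transitionPotential (d := d) hd hβ hb hab 0
  have hjump : 0 < yTwo d β a b (transitionPotential d β a b 0) :=
    (yTwo_nonneg hβ hb hab hμt).lt_of_ne' fun h =>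
      hlt.ne ((yTwo_transitionPotential_eq_zero_iff_eq_muC hd hβ hb hab).1 h)
  refine not_continuousAt_of_jump hjump (fun μ hμ => ?_) fun μ hμ => ?_
  · exact (hϱ μ hμ.ne).eq_of_isEquilibrium hd hβ hb.le hab
      (isEquilibrium_zero_zero hd hβ hb hab hμ)
  · rw [(hϱ μ hμ.ne').eq_of_isEquilibrium hd hβ hb.le hab
      (isEquilibrium_zero_yTwo hd hβ hb hab hμ)]
    exact yTwo_mono hβ hb hab hμt (le_of_lt hμ)

lemma continuousAt_transitionPotential_zero (hd : 1 ≤ d) (hβ : 0 < β) (hb : 0 < b) (hab : b < a)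
    (h0 : yTwo d β a b (transitionPotential d β a b 0) = 0)
    (hϱ : ∀ μ, IsLongCycleLimit d β α a b 0 μ (ϱ μ)) :
    ContinuousAt ϱ (transitionPotential d β a b 0) := by
  refine continuousAt_of_eq_yTwo hβ hb hab (muT_le_transitionPotential hd hβ hb hab 0)
    (eventually_nhdsWithin_of_forall fun μ hμ => ?_) fun μ hμ =>
      (hϱ μ).eq_of_isEquilibrium hd hβ hb.le hab (isEquilibrium_zero_yTwo hd hβ hb hab hμ)
  rw [h0]
  refine (hϱ μ).eq_of_isEquilibrium hd hβ hb.le hab ?_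
  rcases (Set.mem_Iic.1 hμ).lt_or_eq with hlt | rfl
  · exact isEquilibrium_zero_zero hd hβ hb hab hlt
  · exact isEquilibrium_zero_transitionPotential hd hβ hb hab h0 0

lemma not_continuousAt_transitionPotential_pos (hd : 1 ≤ d) (hβ : 0 < β) (hb : 0 < b)
    (hab : b < a) (hκ : 0 < κ) (hϱ : ∀ μ ≠ transitionPotential d β a b κ,
      IsLongCycleLimit d β α a b (ENNReal.ofReal κ) μ (ϱ μ)) :
    ¬ ContinuousAt ϱ (transitionPotential d β a b κ) := by
  refine not_continuousAt_of_jump hκ (fun μ hμ => (hϱ μ hμ.ne).eq_of_isEquilibrium hd hβ hb.le hab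
    (isEquilibrium_zero_of_lt_transitionPotential hd hβ hb hab hκ.le hμ)) fun μ hμ => ?_
  have heq {y : ℝ} := (hϱ μ hμ.ne').eq_of_isEquilibrium (y := y) hd hβ hb.le hab
  rcases le_total μ (muR d β a b κ) with hμr | hμr
  · exact (heq (isEquilibrium_kappa hd hβ hb hab hκ hμ hμr)).ge
  · exact (le_yTwo_of_muR_le hβ hb hab hκ hμr).trans
      (heq (isEquilibrium_yTwo_of_muR_le hd hβ hb hab hκ hμ hμr)).ge

lemma continuousAt_muR (hd : 1 ≤ d) (hβ : 0 < β) (hb : 0 < b) (hab : b < a) (hκ : 0 < κ)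
    (hϱ : ∀ μ ≠ transitionPotential d β a b κ,
      IsLongCycleLimit d β α a b (ENNReal.ofReal κ) μ (ϱ μ))
    (hne : muR d β a b κ ≠ transitionPotential d β a b κ) :
    ContinuousAt ϱ (muR d β a b κ) := by
  rcases hne.lt_or_gt with h | h
  · refine continuousAt_const.congr (f := fun _ => (0 : ℝ)) ?_
    filter_upwards [Iio_mem_nhds h] with μ hμ
    exact ((hϱ μ hμ.ne).eq_of_isEquilibrium hd hβ hb.le hab
      (isEquilibrium_zero_of_lt_transitionPotential hd hβ hb hab hκ.le hμ)).symm
  · have htr := (muT_le_transitionPotential (d := d) hd hβ hb hab κ).trans_lt h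
    refine continuousAt_of_eq_yTwo hβ hb hab htr.le ?_ fun μ hμ =>
      (hϱ μ (h.trans hμ).ne').eq_of_isEquilibrium hd hβ hb.le hab
        (isEquilibrium_yTwo_of_muR_le hd hβ hb hab hκ (h.trans hμ) (le_of_lt hμ))
    rw [yTwo_muR hβ hb hab hκ htr]
    filter_upwards [Ioc_mem_nhdsLE h] with μ hμ
    exact (hϱ μ hμ.1.ne').eq_of_isEquilibrium hd hβ hb.le hab
      (isEquilibrium_kappa hd hβ hb hab hκ hμ.1 hμ.2)

end Continuity

end CycleHYL

theorem mainTheorem6 (d : ℕ) (hd : 1 ≤ d) (β a b : ℝ) (hβ : 0 < β) (hb : 0 < b) (hab : b < a) :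
    -- the expectations are well defined
    (∀ α < 0, ∀ μ V : ℝ, 0 < V → ∀ m : ℕ,
      IsProbabilityMeasure (gibbsMeasure d β α μ a b V m) ∧
      Integrable (longCycleDensity V m) (gibbsMeasure d β α μ a b V m)) ∧
    ∃ μs : ℝ, IsTransitionZero d β a b μs ∧
      -- the case κ = 0
      (∀ α < 0,
        (∀ μ < μs, IsLongCycleLimit d β α a b 0 μ 0) ∧
        (∀ μ > μs, IsLongCycleLimit d β α a b 0 μ ((μ - a * xTwo d β a b μ) / (a - b))) ∧
        ((μs : EReal) < muC d β a →
          ∀ ϱ : ℝ → ℝ, (∀ μ ≠ μs, IsLongCycleLimit d β α a b 0 μ (ϱ μ)) →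
            ¬ ContinuousAt ϱ μs) ∧
        ((μs : EReal) = muC d β a →
          xOne d β a μs = xTwo d β a b μs ∧
          IsLongCycleLimit d β α a b 0 μs 0 ∧
          ∀ ϱ : ℝ → ℝ, (∀ μ, IsLongCycleLimit d β α a b 0 μ (ϱ μ)) → ContinuousAt ϱ μs)) ∧
      ((μs : EReal) = muC d β a ↔
        idealPressureSecondAtZero d β ≤ (((a - b) / (a * b) : ℝ) : EReal)) ∧
      -- the case κ ∈ (0, ∞)
      (∀ κ : ℝ, 0 < κ → ∃ μκ : ℝ, IsTransitionPos d β a b κ μs μκ ∧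
        ∀ α < 0,
          (∀ μ < μκ, IsLongCycleLimit d β α a b (ENNReal.ofReal κ) μ 0) ∧
          (∀ μ, μκ < μ → μ ≤ muR d β a b κ →
            IsLongCycleLimit d β α a b (ENNReal.ofReal κ) μ κ) ∧
          (∀ μ, μκ < μ → muR d β a b κ ≤ μ →
            IsLongCycleLimit d β α a b (ENNReal.ofReal κ) μ
              ((μ - a * xTwo d β a b μ) / (a - b))) ∧
          ∀ ϱ : ℝ → ℝ,
            (∀ μ ≠ μκ, IsLongCycleLimit d β α a b (ENNReal.ofReal κ) μ (ϱ μ)) →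
            (muR d β a b κ ≠ μκ → ContinuousAt ϱ (muR d β a b κ)) ∧
            ¬ ContinuousAt ϱ μκ) ∧
      -- the case κ = ∞
      (∀ α < 0, ∀ μ : ℝ, IsLongCycleLimit d β α a b ⊤ μ 0) := by
  have hlim {κ : ℝ≥0∞} {μ y : ℝ} (h : IsEquilibrium d β a b κ μ y) (α : ℝ) :
      IsLongCycleLimit d β α a b κ μ y := h.isLongCycleLimit hd hβ hb.le hab α
  refine ⟨fun α _ μ V hV m => ?_, transitionPotential d β a b 0,
    isTransitionZero_transitionPotential hd hβ hb hab, fun α _ =>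
      ⟨fun μ hμ => hlim (isEquilibrium_zero_zero hd hβ hb hab hμ) α,
        fun μ hμ => hlim (isEquilibrium_zero_yTwo hd hβ hb hab hμ) α,
        fun hlt ϱ => not_continuousAt_transitionPotential_zero hd hβ hb hab hlt, fun heq => ?_⟩,
    transitionPotential_eq_muC_iff_second hd hβ hb hab,
    fun κ hκ => ⟨transitionPotential d β a b κ, isTransitionPos_transitionPotential hd hβ hb hab hκ,
      fun α _ =>
        ⟨fun μ hμ => hlim (isEquilibrium_zero_of_lt_transitionPotential hd hβ hb hab hκ.le hμ) α,
          fun μ hμ hμr => hlim (isEquilibrium_kappa hd hβ hb hab hκ hμ hμr) α,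
          fun μ hμ hμr => hlim (isEquilibrium_yTwo_of_muR_le hd hβ hb hab hκ hμ hμr) α,
          fun ϱ hϱ => ⟨continuousAt_muR hd hβ hb hab hκ hϱ,
            not_continuousAt_transitionPotential_pos hd hβ hb hab hκ hϱ⟩⟩⟩,
    fun α _ μ => hlim (isEquilibrium_top d β a b μ) α⟩
  · have hW := summable_gibbsWeight (d := d) hd hβ hb.le hab hV μ m
    exact ⟨isProbabilityMeasure_gibbsMeasure hβ hV α hW, integrable_gibbsMeasure hβ hV α hW
      (summable_gibbsWeight_mul_abs_longCycleDensity hd hβ hb.le hab hV μ m)⟩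
  · have h0 := (yTwo_transitionPotential_eq_zero_iff_eq_muC hd hβ hb hab).2 heq
    exact ⟨xOne_transitionPotential_eq_xTwo hd hβ hb hab h0,
      hlim (isEquilibrium_zero_transitionPotential hd hβ hb hab h0 0) α,
      fun ϱ => continuousAt_transitionPotential_zero hd hβ hb hab h0⟩
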